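/- **Setting.** Let $H$ be the genus-2 handlebody, viewed as the complement of two vertical base strands (1 on the left, 2 on the right) in a thickened rectangle. A skein in $H$ is a framed link up to isotopy. It is given by a link diagram in the rectangle (blackboard framing), in general position to the base strands, up to planar isotopy and the framed Reidemeister moves relative to the base strands. The Kauffman bracket skein module $\mathcal S(H)$ is the $\mathbb C[t,t^{-1}]$-module spanned by the skeins, with the relations $D=t\,D_A+t^{-1}D_B$ at every crossing of the link with itself ($D_A$ joins the two regions swept out when the upper strand is turned counterclockwise, $D_B$ the other two regions) and $\bigcirc\sqcup D=(-t^2-t^{-2})D$. **Arrays.** Let a diagram have oriented components $1,\dots,k$ and self-crossings (crossings of the link with itself) labelled $1\times 10^{-\kappa},\dots,r\times 10^{-\kappa}$, abbreviated $1,\dots,r$. Traverse each component $l$ from a base point and record at its successive points the sequences $E^l,I^l,Q^l$. In $E^l$ record $\pm n$ where the link passes over/under base strand $n$, and $\pm(\text{label})$ where it passes over/under at a self-crossing. In $I^l$ record an index that increases from bottom to top along each base strand. In $Q^l$ record $3$ or $4$ where strand 1 is passed from left to right or from right to left, $4$ or $5$ where strand 2 is passed from left to right or from right to left, and $0$ at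 a self-crossing. Put $E=[E^1,\dots,E^k]$, and $I$, $Q$ likewise, and let $U=[u_1,\dots,u_r]$ be the list of the signs $\pm1$ of the self-crossings. Write $K=[E,I,Q]$ for the skein of the diagram so described (the signs of the crossings still present being those in $U$); an empty component is a circle without crossings. A term $[s,c,U,E,I,Q]$ stands for $c\,t^sK$. **Operators.** For arrays $x=[x_0,\dots,x_{m-1}]$, $y=[y_0,\dots,y_{n-1}]$ let $$\mathcal C(x,j',j'')=\big([x_{j'+1},\dots,x_{j''-1}],\ [x_0,\dots,x_{j'-1},x_{j''+1},\dots,x_{m-1}]\big),$$ $$\mathcal R(x,j',j'')=[x_0,\dots,x_{j'-1},x_{j''-1},\dots,x_{j'+1},x_{j''+1},\dots,x_{m-1}],$$ $$\mathcal F(x,y,j',j'')=[x_0,\dots,x_{j'-1},y_{j''+1},\dots,y_{n-1},y_0,\dots,y_{j''-1},x_{j'+1},\dots,x_{m-1}],$$ $$\mathcal B(x,y,j',j'')=[x_0,\dots,x_{j'-1},y_{j''-1},\dots,y_0,y_{n-1},\dots,y_{j''+1},x_{j'+1},\dots,x_{m-1}].$$ **Resolving crossing $\rho$** of sign $u$ in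 a term $[s,c,U,E,I,Q]$ yields two terms $Z'$, $Z''$ as follows. Let the two occurrences of the label $\rho$ be at index $j'$ of component $l'$ and index $j''$ of component $l''$. * If $l'=l''$ (with $j'<j''$), then in $Z'$ component $l'$ of each of $E,I,Q$ is replaced by the two arrays given by $\mathcal C$, and in $Z''$ by the array given by $\mathcal R$. * If $l'<l''$, then in $Z'$ the components $l'$, $l''$ are replaced by the array given by $\mathcal F$, and in $Z''$ by the one given by $\mathcal B$, at place $l'$. The new exponent is $s+u$ in $Z'$ and $s-u$ in $Z''$; $c$ is unchanged; the entry $u$ is deleted from $U$. In $Z''$, where a section of the link is reversed (the entries strictly between $j'$ and $j''$ in the first case, component $l''$ in the second), the sign in $U$ of every remaining crossing with exactly one of its two points in that section is changed, and the values of $Q$ in that section are changed to those of the reversed direction ($3\leftrightarrow4$ on strand 1, $4\leftrightarrow5$ on strand 2). **Proposition 1.** Let $[U,E,I,Q]$ be the array of a link diagram $D$ with $r$ self-crossings, let $K_0$ be its skein, and let $0\le w\le r$. Start from $Z=[Z_0]$ with $Z_0=[0,1,U,E,I,Q]$ and, for $\rho=1,2,\dots,w$ in this order, replace every term of $Z$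 by the two terms obtained from it by resolving crossing $\rho$. The result is an array $Z=[Z_0,\dots,Z_{2^w-1}]$ of $2^w$ terms $Z_z=[s_z,c_z,U_z,E_z,I_z,Q_z]$ such that: 1. each $[U_z,E_z,I_z,Q_z]$ is the array of a link diagram whose self-crossings are those with the labels $w+1,\dots,r$, so $\dim U_z=r-w$; 2. in $\mathcal S(H)$, with $K_z=[E_z,I_z,Q_z]$, $$K_0=\sum_{z=0}^{2^w-1}c_zt^{s_z}K_z;$$ 3. there is a bijection $z\mapsto\sigma_z$ from the terms to the states $\sigma\in\{A,B\}^w$ of the crossings $1,\dots,w$ such that $c_z=1$, $s_z$ is the number of $A$'s minus the number of $B$'s in $\sigma_z$, and the diagram described by $Z_z$ is planar isotopic to the diagram $D_{\sigma_z}$ obtained from $D$ by smoothing the crossings $1,\dots,w$ according to $\sigma_z$. When $w=r$, every $U_z$ is empty, no $E_z$ contains a self-crossing, no $D_\sigma$ has a self-crossing, and the sum is the full Kauffman bracket state expansion of the original skein, $$K_0=\sum_{z=0}^{2^r-1}c_zt^{s_z}K_z=\sum_{\sigma\in\{A,B\}^r}t^{\#A(\sigma)-\#B(\sigma)}D_\sigma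 .$$ -/

import Mathlib

open scoped LaurentPolynomial

noncomputable section

/-! ## Link diagrams in a strip with two vertical base strands

The genus-2 handlebody is the complement, in a thickened rectangle, of two vertical base strands.
A framed link in it is given by a diagram in the rectangle (blackboard framing) in general position
with respect to the two base strands. -/

namespace Skein

/-- Names of the arcs of a link diagram; only equality of names matters. -/
abbrev Arc := ℕ × ℕ

/-- A crossing of the link with itself: the four arc ends in counterclockwise order,
`a`, `c` being the ends of the lower strand and `b`, `d` those of the upper strand. -/
structure Crossing where
  a : Arc
  b : Arc
  c : Arc
  d : Arc

/-- A point where the link passes over or under a base strand: the arc ends to the west and to the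
east of the base strand. -/
structure Passage where
  upper : Bool
  west : Arc
  east : Arc

/-- A diagram: its self-crossings, its joints (points at which two arc ends are glued to each other;
a joint `(a, a)` is a circle) and, for each of the two base strands (`0` is the left one, `1` the
right one), the passages of the link over or under it, listed from bottom to top. -/
structure Diagram where
  crossings : List Crossing
  joints : List (Arc × Arc)
  strands : Fin 2 → List Passage

/-- The arc ends at a crossing, counterclockwise. -/
def Crossing.ends (X : Crossing) : List Arc := [X.a, X.b, X.c, X.d]

def Crossing.map (f : Arc → Arc) (X : Crossing) : Crossing := ⟨f X.a, f X.b, f X.c, f X.d⟩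

def Passage.map (f : Arc → Arc) (p : Passage) : Passage := ⟨p.upper, f p.west, f p.east⟩

/-- Renaming of arcs. -/
def Diagram.map (f : Arc → Arc) (D : Diagram) : Diagram where
  crossings := D.crossings.map (Crossing.map f)
  joints := D.joints.map (Prod.map f f)
  strands := fun n => (D.strands n).map (Passage.map f)

/-- All the arc ends of a diagram. -/
def Diagram.arcEnds (D : Diagram) : List Arc :=
  D.crossings.flatMap Crossing.ends ++ D.joints.flatMap (fun p => [p.1, p.2]) ++
    (D.strands 0).flatMap (fun p => [p.west, p.east]) ++
    (D.strands 1).flatMap (fun p => [p.west, p.east])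

/-- Every arc has exactly two ends. -/
def Diagram.WellFormed (D : Diagram) : Prop :=
  ∀ a : Arc, D.arcEnds.count a = 0 ∨ D.arcEnds.count a = 2

/-! ### Planarity: the underlying graph with its rotation system has genus zero -/

section Map

variable {ε : Type*}

/-- A dart (half-edge) of the graph whose vertices are given by their lists of edge names,
in counterclockwise order. -/
abbrev Dart (vs : List (List ε)) : Type := Σ v : Fin vs.length, Fin (vs.get v).length

/-- The edge to which a dart belongs. -/
def Dart.edge {vs : List (List ε)} (d : Dart vs) : ε := (vs.get d.1).get d.2

/-- The next dart at the same vertex, counterclockwise. -/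
def Dart.next {vs : List (List ε)} (d : Dart vs) : Dart vs := ⟨d.1, finRotate _ d.2⟩

/-- Travel along the edge of `d` to its other dart, then turn to the next dart there: the orbits of
this step are the faces. -/
def FaceStep (vs : List (List ε)) (d d' : Dart vs) : Prop :=
  ∃ e : Dart vs, e ≠ d ∧ e.edge = d.edge ∧ d' = e.next

/-- Two vertices share an edge. -/
def Adjacent (vs : List (List ε)) (v w : Fin vs.length) : Prop :=
  ∃ a, a ∈ vs.get v ∧ a ∈ vs.get w

/-- Euler's formula `V - E + F = 2 C` (doubled): every connected component of the graph with its
rotation system is drawn on a sphere. -/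
def IsSpherical (vs : List (List ε)) : Prop :=
  2 * (vs.length + Nat.card (Quot (FaceStep vs))) =
    Nat.card (Dart vs) + 4 * Nat.card (Quot (Adjacent vs))

end Map

/-- The vertices of the diagram together with the base strands. `Sum.inr (n, k)` names the piece of
base strand `n` just below its `k`-th passage (counted from `0`). At a passage the counterclockwise
order is east, up, west, down. The outside of the rectangle is shrunk to a single last vertex, around
which one meets, counterclockwise on the sphere, the bottom of the left strand, the top of the left
strand, the top of the right strand and the bottom of the right strand. -/
def Diagram.vertices (D : Diagram) : List (List (Arc ⊕ (Fin 2 × ℕ))) :=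
  D.crossings.map (fun X => X.ends.map Sum.inl) ++
  D.joints.map (fun p => [Sum.inl p.1, Sum.inl p.2]) ++
  (List.finRange 2).flatMap (fun n => (D.strands n).zipIdx.map (fun pk =>
    [Sum.inl pk.1.east, Sum.inr (n, pk.2 + 1), Sum.inl pk.1.west, Sum.inr (n, pk.2)])) ++
  [[Sum.inr (0, 0), Sum.inr (0, (D.strands 0).length),
    Sum.inr (1, (D.strands 1).length), Sum.inr (1, 0)]]

/-- `D` is the diagram of a link in the rectangle with its two base strands. -/
def Diagram.IsLink (D : Diagram) : Prop := D.WellFormed ∧ IsSpherical D.vertices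

/-! ### Isotopies -/

/-- Elementary changes of the description of a diagram that do not change the drawing up to planar
isotopy. -/
inductive PlanarMove : Diagram → Diagram → Prop
  | perm {cs cs' js js'} (s) (hc : List.Perm cs cs') (hj : List.Perm js js') :
      PlanarMove ⟨cs, js, s⟩ ⟨cs', js', s⟩
  | rename (f : Equiv.Perm Arc) (D : Diagram) : PlanarMove D (D.map f)
  | turn (a b c d cs js s) :
      PlanarMove ⟨⟨a, b, c, d⟩ :: cs, js, s⟩ ⟨⟨c, d, a, b⟩ :: cs, js, s⟩
  | swap (a b cs js s) : PlanarMove ⟨cs, (a, b) :: js, s⟩ ⟨cs, (b, a) :: js, s⟩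
  | splice (a b cs js s) (hab : a ≠ b) :
      PlanarMove ⟨cs, (a, b) :: js, s⟩
        ((⟨cs, js, s⟩ : Diagram).map (fun x => if x = b then a else x))

/-- Planar isotopy of link diagrams. -/
def PlanarIsotopic : Diagram → Diagram → Prop :=
  Relation.EqvGen (fun D D' => D.IsLink ∧ D'.IsLink ∧ PlanarMove D D')

/-- The crossing with counterclockwise ends `p q p' q'`, of a strand with ends `p`, `p'` and
a strand with ends `q`, `q'`; the former is the upper one if `o = true`. -/
def mkCrossing (o : Bool) (p q p' q' : Arc) : Crossing :=
  if o then ⟨q, p', q', p⟩ else ⟨p, q, p', q'⟩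

/-- A curl from `p` to `q` with loop `x`, of writhe `1` (`w = true`) or `-1` (`w = false`); the upper
strand ends in `q` if `o = true` and in `p` otherwise. -/
def mkCurl (w o : Bool) (p q x : Arc) : Crossing :=
  match w, o with
  | true, true => ⟨x, x, p, q⟩
  | true, false => ⟨x, x, q, p⟩
  | false, true => ⟨p, x, x, q⟩
  | false, false => ⟨q, x, x, p⟩

/-- The Reidemeister moves for framed links in the complement of the two base strands. -/
inductive ReidemeisterMove : Diagram → Diagram → Prop
  /-- Two consecutive curls of opposite writhe cancel. -/
  | r1 (w o o' : Bool) (p m q x y cs js s) :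
      ReidemeisterMove ⟨mkCurl w o p m x :: mkCurl (!w) o' m q y :: cs, js, s⟩
        ⟨cs, (p, q) :: js, s⟩
  /-- The upper strand from `p` to `q` is pulled off the lower strand from `r` to `r'`. -/
  | r2 (p q r r' x y cs js s) :
      ReidemeisterMove ⟨⟨r, x, y, p⟩ :: ⟨y, x, r', q⟩ :: cs, js, s⟩
        ⟨cs, (p, q) :: (r, r') :: js, s⟩
  /-- Three strands, with ends `p i` and `p' i`, forming a triangle; `oij` says that strand `i`
  is above strand `j` and the two hypotheses say that "above" is not cyclic. -/
  | r3 (o12 o13 o23 : Bool) (p1 p2 p3 p1' p2' p3' u v w cs js s)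
      (h : ¬ (o12 = true ∧ o23 = true ∧ o13 = false))
      (h' : ¬ (o12 = false ∧ o23 = false ∧ o13 = true)) :
      ReidemeisterMove
        ⟨mkCrossing o23 p2 p3 v w :: mkCrossing o13 p1 w u p3' ::
          mkCrossing o12 u v p1' p2' :: cs, js, s⟩
        ⟨mkCrossing o23 v w p2' p3' :: mkCrossing o13 u p3 p1' w ::
          mkCrossing o12 p1 p2 u v :: cs, js, s⟩
  /-- An arc `x` lying east of base strand `n` is pulled off it. -/
  | r2east (n : Fin 2) (o : Bool) (p q x cs js s pre post)
      (hs : s n = pre ++ [⟨o, p, x⟩, ⟨o, q, x⟩] ++ post) :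
      ReidemeisterMove ⟨cs, js, s⟩ ⟨cs, (p, q) :: js, Function.update s n (pre ++ post)⟩
  /-- An arc `x` lying west of base strand `n` is pulled off it. -/
  | r2west (n : Fin 2) (o : Bool) (p q x cs js s pre post)
      (hs : s n = pre ++ [⟨o, x, p⟩, ⟨o, x, q⟩] ++ post) :
      ReidemeisterMove ⟨cs, js, s⟩ ⟨cs, (p, q) :: js, Function.update s n (pre ++ post)⟩
  /-- A crossing of strand `2` and strand `3` is moved from the west of base strand `n` to the east
  of it; `o2`, `o3` say that strand `2`, strand `3` is above the base strand. -/
  | r3base (n : Fin 2) (o2 o3 o23 : Bool) (p2 p3 p2' p3' v w cs js s pre post)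
      (h : ¬ (o2 = true ∧ o3 = false ∧ o23 = false))
      (h' : ¬ (o2 = false ∧ o3 = true ∧ o23 = true))
      (hs : s n = pre ++ [⟨o2, v, p2'⟩, ⟨o3, w, p3'⟩] ++ post) :
      ReidemeisterMove ⟨mkCrossing o23 p2 p3 v w :: cs, js, s⟩
        ⟨mkCrossing o23 v w p2' p3' :: cs, js,
          Function.update s n (pre ++ [⟨o3, p3, w⟩, ⟨o2, p2, v⟩] ++ post)⟩

/-! ### The Kauffman bracket skein module -/

/-- The two joints that replace a crossing: those of the `A`-smoothing (`true`), which merges the two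
regions swept out when the upper strand is turned counterclockwise, or those of the
`B`-smoothing (`false`). -/
def Crossing.smoothing (X : Crossing) : Bool → List (Arc × Arc)
  | true => [(X.a, X.b), (X.c, X.d)]
  | false => [(X.a, X.d), (X.b, X.c)]

/-- The link diagrams, as a type. -/
abbrev LinkDiagram : Type := {D : Diagram // D.IsLink}

/-- The free module on the link diagrams. -/
abbrev FreeSkein : Type := LinkDiagram →₀ ℂ[T;T⁻¹]

/-- The diagram `D` as an element of the free module. -/
def gen (D : LinkDiagram) : FreeSkein := Finsupp.single D 1

/-- The relations of the Kauffman bracket skein module: isotopy, the skein relation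
`X = t A + t⁻¹ B`, and `O ⊔ D = (-t² - t⁻²) D`. -/
inductive SkeinRel : FreeSkein → Prop
  | planar (D D' : LinkDiagram) (h : PlanarMove D.1 D'.1) : SkeinRel (gen D - gen D')
  | reidemeister (D D' : LinkDiagram) (h : ReidemeisterMove D.1 D'.1) : SkeinRel (gen D - gen D')
  | skein (X : Crossing) (cs js s) (D DA DB : LinkDiagram)
      (hD : D.1 = ⟨X :: cs, js, s⟩)
      (hA : DA.1 = ⟨cs, X.smoothing true ++ js, s⟩)
      (hB : DB.1 = ⟨cs, X.smoothing false ++ js, s⟩) :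
      SkeinRel (gen D - (LaurentPolynomial.T 1 : ℂ[T;T⁻¹]) • gen DA
        - (LaurentPolynomial.T (-1) : ℂ[T;T⁻¹]) • gen DB)
  | loop (a : Arc) (cs js s) (D D' : LinkDiagram)
      (hD : D.1 = ⟨cs, (a, a) :: js, s⟩) (hD' : D'.1 = ⟨cs, js, s⟩) :
      SkeinRel (gen D -
        (-LaurentPolynomial.T 2 - LaurentPolynomial.T (-2) : ℂ[T;T⁻¹]) • gen D')

/-- The Kauffman bracket skein module of the genus-2 handlebody, over `ℂ[t, t⁻¹]`. -/
abbrev SkeinModule : Type := FreeSkein ⧸ Submodule.span ℂ[T;T⁻¹] {x | SkeinRel x}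

open Classical in
/-- The class of a diagram in the skein module (`0` if it is not the diagram of a link). -/
def Diagram.toSkein (D : Diagram) : SkeinModule :=
  if h : D.IsLink then Submodule.Quotient.mk (gen ⟨D, h⟩) else 0

/-- The diagram obtained from `D` by smoothing its first crossings as told by the list `σ`. -/
def Diagram.smooth (D : Diagram) (σ : List Bool) : Diagram where
  crossings := D.crossings.drop σ.length
  joints := (List.zipWith Crossing.smoothing D.crossings σ).flatten ++ D.joints
  strands := D.strands

/-- The number of `A`-smoothings minus the number of `B`-smoothings of a state. -/
def stateExponent {w : ℕ} (σ : Fin w → Bool) : ℤ := ∑ k, if σ k then 1 else -1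

/-! ## Skein arrays -/

/-- An entry of the crossing array: `strand n upper` for a passage over (`true`) or under (`false`)
base strand `n + 1`, written `±1`, `±2` in numbers; `self k upper` for a passage over or under the
self-crossing with label `k`, written `±k · 10^(-κ)` in numbers. -/
inductive Entry where
  | strand (n : Fin 2) (upper : Bool)
  | self (k : ℕ) (upper : Bool)
  deriving DecidableEq

/-- One term `[s, c, U, E, I, Q]` of a skein array. -/
structure Term where
  s : ℤ
  c : ℂ
  U : List ℤ
  E : List (List Entry)
  I : List (List ℕ)
  Q : List (List ℕ)

/-- A recorded point: its entries in `E`, `I`, `Q` and the arcs that enter and leave it. -/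
structure Point where
  e : Entry
  i : ℕ
  q : ℕ
  inn : Arc
  out : Arc

/-- The recorded points of a term. The arc `(l, j)` leads from point `j` of component `l` to the
cyclically next point of this component. -/
def Term.points (Z : Term) : List Point :=
  Z.E.zipIdx.flatMap fun cl => cl.1.zipIdx.map fun ej =>
    { e := ej.1
      i := (Z.I.getD cl.2 []).getD ej.2 0
      q := (Z.Q.getD cl.2 []).getD ej.2 0
      inn := (cl.2, (ej.2 + cl.1.length - 1) % cl.1.length)
      out := (cl.2, ej.2) }

/-- The points on base strand `n`. -/
def Term.strandPoints (Z : Term) (n : Fin 2) : List Point :=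
  Z.points.filter fun p => p.e = .strand n true ∨ p.e = .strand n false

/-- The link passes from left to right at a point of base strand `n` with `q = 3` (left strand) or
`q = 4` (right strand), and from right to left if `q = 4`, `q = 5` respectively. -/
def Point.passage (n : Fin 2) (p : Point) : Passage :=
  if p.q = (n : ℕ) + 3 then ⟨decide (p.e = .strand n true), p.inn, p.out⟩
  else ⟨decide (p.e = .strand n true), p.out, p.inn⟩

/-- The self-crossing of sign `u` with the given lower and upper point. -/
def mkSigned (u : ℤ) (lower upper : Point) : Crossing :=
  if u = 1 then ⟨lower.inn, upper.out, lower.out, upper.inn⟩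
  else ⟨lower.inn, upper.inn, lower.out, upper.out⟩

/-- The diagram described by a term in which the crossings `1, …, w` have been resolved, so that the
entries of `U` are the signs of the crossings `w + 1, w + 2, …`. -/
def Term.diagram (w : ℕ) (Z : Term) : Diagram where
  crossings := (Z.U.zipIdx (w + 1)).flatMap fun uk =>
    match Z.points.find? (fun p => p.e = .self uk.2 false),
      Z.points.find? (fun p => p.e = .self uk.2 true) with
    | some lower, some upper => [mkSigned uk.1 lower upper]
    | _, _ => []
  joints := Z.E.zipIdx.flatMap fun cl => if cl.1 = [] then [((cl.2, 0), (cl.2, 0))] else []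
  strands := fun n =>
    ((Z.strandPoints n).insertionSort (fun p p' => p.i ≤ p'.i)).map (Point.passage n)

/-- The value of `q` that may be recorded at an entry of the crossing array. -/
def Entry.Admits : Entry → ℕ → Prop
  | .strand n _, q => q = (n : ℕ) + 3 ∨ q = (n : ℕ) + 4
  | .self _ _, q => q = 0

/-- `[U, E, I, Q]` is the array of a link diagram whose self-crossings have the labels
`w + 1, …, w + dim U`. -/
structure Term.IsSkeinArray (w : ℕ) (Z : Term) : Prop where
  dimI : Z.I.map List.length = Z.E.map List.length
  dimQ : Z.Q.map List.length = Z.E.map List.length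
  /-- Each self-crossing is recorded once as overcrossing and once as undercrossing. -/
  labels : ∀ k o, Z.E.flatten.count (.self k o) = if w < k ∧ k ≤ w + Z.U.length then 1 else 0
  signs : ∀ u ∈ Z.U, u = 1 ∨ u = -1
  /-- The indices along each base strand are different. -/
  indices : ∀ n, ((Z.strandPoints n).map Point.i).Nodup
  orientations : ∀ p ∈ Z.points, p.e.Admits p.q
  isLink : (Z.diagram w).IsLink

/-! ## The array operators -/

section Operators

variable {α : Type*}

/-- `[x_{j'+1}, …, x_{j''-1}]` -/
def inner (x : List α) (j' j'' : ℕ) : List α := (x.take j'').drop (j' + 1)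

/-- Split section, concatenate. -/
def opC (x : List α) (j' j'' : ℕ) : List α × List α :=
  (inner x j' j'', x.take j' ++ x.drop (j'' + 1))

/-- Reverse section. -/
def opR (x : List α) (j' j'' : ℕ) : List α :=
  x.take j' ++ (inner x j' j'').reverse ++ x.drop (j'' + 1)

/-- Forward section insert. -/
def opF (x y : List α) (j' j'' : ℕ) : List α :=
  x.take j' ++ (y.drop (j'' + 1) ++ y.take j'') ++ x.drop (j' + 1)

/-- Backward section insert. -/
def opB (x y : List α) (j' j'' : ℕ) : List α :=
  x.take j' ++ ((y.take j'').reverse ++ (y.drop (j'' + 1)).reverse) ++ x.drop (j' + 1)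

/-- Replace component `l` by the two components given by `opC`. -/
def applyC (X : List (List α)) (l j' j'' : ℕ) : List (List α) :=
  (X.set l (opC (X.getD l []) j' j'').1).insertIdx (l + 1) (opC (X.getD l []) j' j'').2

/-- Replace component `l` by the one given by `opR`. -/
def applyR (X : List (List α)) (l j' j'' : ℕ) : List (List α) :=
  X.set l (opR (X.getD l []) j' j'')

/-- Replace the components `l' < l''` by the one given by `opF`, at index `l'`. -/
def applyF (X : List (List α)) (l' l'' j' j'' : ℕ) : List (List α) :=
  (X.eraseIdx l'').set l' (opF (X.getD l' []) (X.getD l'' []) j' j'')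

/-- Replace the components `l' < l''` by the one given by `opB`, at index `l'`. -/
def applyB (X : List (List α)) (l' l'' j' j'' : ℕ) : List (List α) :=
  (X.eraseIdx l'').set l' (opB (X.getD l' []) (X.getD l'' []) j' j'')

end Operators

/-- The value of `q` after the direction of travel has been reversed: `3 ↔ 4` on the left strand,
`4 ↔ 5` on the right strand, `0` at a self-crossing. -/
def Entry.turnQ : Entry → ℕ → ℕ
  | .strand n _, q => if q = (n : ℕ) + 3 then (n : ℕ) + 4 else (n : ℕ) + 3
  | .self _ _, q => q

/-- The orientation array with the values in the section `j' < j < j''` of component `l` turned. -/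
def turnInner (E : List (List Entry)) (Q : List (List ℕ)) (l j' j'' : ℕ) : List (List ℕ) :=
  let q := Q.getD l []
  Q.set l (q.take (j' + 1) ++
    List.zipWith Entry.turnQ (inner (E.getD l []) j' j'') (inner q j' j'') ++ q.drop j'')

/-- The orientation array with all the values of component `l` turned. -/
def turnAll (E : List (List Entry)) (Q : List (List ℕ)) (l : ℕ) : List (List ℕ) :=
  Q.set l (List.zipWith Entry.turnQ (E.getD l []) (Q.getD l []))

/-- The signs of the crossings `ρ + 1, ρ + 2, …` after crossing `ρ` has been resolved with the given
section reversed: the sign of a crossing changes if exactly one of its two points lies there. -/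
def adjustU (ρ : ℕ) (reversed : List Entry) (U : List ℤ) : List ℤ :=
  (U.tail.zipIdx (ρ + 1)).map fun uk =>
    if reversed.count (.self uk.2 true) + reversed.count (.self uk.2 false) = 1 then -uk.1
    else uk.1

/-- The places (component, index) of the crossing label `ρ`, in increasing order. -/
def locate (ρ : ℕ) (E : List (List Entry)) : List (ℕ × ℕ) :=
  E.zipIdx.flatMap fun cl => cl.1.zipIdx.filterMap fun ej =>
    if ej.1 = .self ρ true ∨ ej.1 = .self ρ false then some (cl.2, ej.2) else none

/-- Resolution of crossing `ρ`, whose sign is the first entry of `U`, in a single term: the two terms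
`Z'`, `Z''`. -/
def Term.resolve (ρ : ℕ) (Z : Term) : List Term :=
  match locate ρ Z.E with
  | [(l', j'), (l'', j'')] =>
    if l' = l'' then
      [{ s := Z.s + Z.U.headD 0
         c := Z.c
         U := Z.U.tail
         E := applyC Z.E l' j' j''
         I := applyC Z.I l' j' j''
         Q := applyC Z.Q l' j' j'' },
       { s := Z.s - Z.U.headD 0
         c := Z.c
         U := adjustU ρ (inner (Z.E.getD l' []) j' j'') Z.U
         E := applyR Z.E l' j' j''
         I := applyR Z.I l' j' j''
         Q := applyR (turnInner Z.E Z.Q l' j' j'') l' j' j'' }]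
    else
      [{ s := Z.s + Z.U.headD 0
         c := Z.c
         U := Z.U.tail
         E := applyF Z.E l' l'' j' j''
         I := applyF Z.I l' l'' j' j''
         Q := applyF Z.Q l' l'' j' j'' },
       { s := Z.s - Z.U.headD 0
         c := Z.c
         U := adjustU ρ (Z.E.getD l'' []) Z.U
         E := applyB Z.E l' l'' j' j''
         I := applyB Z.I l' l'' j' j''
         Q := applyB (turnAll Z.E Z.Q l'') l' l'' j' j'' }]
  | _ => []

/-- The array `Z` after the crossings `1, …, w` have been resolved in this order, each of them in all
the terms present at that stage. -/
def resolveArray (Z₀ : Term) : ℕ → List Term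
  | 0 => [Z₀]
  | w + 1 => (resolveArray Z₀ w).flatMap (Term.resolve (w + 1))

/-- The initial term `[0, 1, U, E, I, Q]`. -/
def initialTerm (U : List ℤ) (E : List (List Entry)) (I Q : List (List ℕ)) : Term :=
  ⟨0, 1, U, E, I, Q⟩

/-- The coefficient `c t^s` of a term. -/
def Term.coeff (Z : Term) : ℂ[T;T⁻¹] := LaurentPolynomial.C Z.c * LaurentPolynomial.T Z.s

end Skein

end

open scoped LaurentPolynomial

noncomputable section

namespace Skein

open Relation Equiv

section Classes

variable {A B : Type*}

/-- The number of classes of the equivalence relation generated by `r`. -/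
def numClasses (r : A → A → Prop) : ℕ := Nat.card (Quot r)

theorem eqvGen_of_forall {r : A → A → Prop} {s : B → B → Prop} (f : A → B)
    (h : ∀ a b, r a b → EqvGen s (f a) (f b)) {a b : A} (hab : EqvGen r a b) :
    EqvGen s (f a) (f b) := by
  induction hab with
  | rel _ _ h' => exact h _ _ h'
  | refl _ => exact .refl _
  | symm _ _ _ ih => exact .symm _ _ ih
  | trans _ _ _ _ _ ih ih' => exact .trans _ _ _ ih ih'

theorem numClasses_congr {r : A → A → Prop} {s : B → B → Prop} (f : A → B) (g : B → A)
    (hf : ∀ a b, r a b → EqvGen s (f a) (f b)) (hg : ∀ a b, s a b → EqvGen r (g a) (g b))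
    (hgf : ∀ a, EqvGen r (g (f a)) a) (hfg : ∀ b, EqvGen s (f (g b)) b) :
    numClasses r = numClasses s :=
  Nat.card_congr
    { toFun := Quot.lift (fun a => Quot.mk s (f a)) fun _ _ h => Quot.eqvGen_sound (hf _ _ h)
      invFun := Quot.lift (fun b => Quot.mk r (g b)) fun _ _ h => Quot.eqvGen_sound (hg _ _ h)
      left_inv := by rintro ⟨a⟩; exact Quot.eqvGen_sound (hgf a)
      right_inv := by rintro ⟨b⟩; exact Quot.eqvGen_sound (hfg b) }

theorem numClasses_congr_id {r s : A → A → Prop} (h : ∀ a b, r a b → EqvGen s a b)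
    (h' : ∀ a b, s a b → EqvGen r a b) : numClasses r = numClasses s :=
  numClasses_congr id id h h' (fun _ => .refl _) (fun _ => .refl _)

/-- The relation `r` together with the pair `(x, y)`. -/
def addPair (r : A → A → Prop) (x y : A) (a b : A) : Prop := r a b ∨ (a = x ∧ b = y)

theorem numClasses_addPair_of_eqvGen {r : A → A → Prop} {x y : A} (h : EqvGen r x y) :
    numClasses (addPair r x y) = numClasses r := by
  refine numClasses_congr_id ?_ fun a b hab => .rel _ _ (.inl hab)
  rintro a b (hab | ⟨rfl, rfl⟩)
  · exact .rel _ _ hab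
  · exact h

theorem numClasses_addPair_of_not_eqvGen [Finite A] {r : A → A → Prop} {x y : A}
    (h : ¬ EqvGen r x y) : numClasses (addPair r x y) + 1 = numClasses r := by
  classical
  have hxy : Quot.mk r x ≠ Quot.mk r y := fun e => h (Quot.eqvGen_exact e)
  let g : Quot (addPair r x y) → {q : Quot r // q ≠ Quot.mk r y} :=
    Quot.lift (fun a => if ha : Quot.mk r a = Quot.mk r y then ⟨Quot.mk r x, hxy⟩
      else ⟨Quot.mk r a, ha⟩) <| by
        rintro a b (hab | ⟨rfl, rfl⟩)
        · have : Quot.mk r a = Quot.mk r b := Quot.sound hab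
          simp [this]
        · simp [hxy]
  let f : {q : Quot r // q ≠ Quot.mk r y} → Quot (addPair r x y) := fun q =>
    Quot.lift (fun a => Quot.mk (addPair r x y) a) (fun a b hab => Quot.sound (.inl hab)) q.1
  have e : {q : Quot r // q ≠ Quot.mk r y} ≃ Quot (addPair r x y) :=
    { toFun := f
      invFun := g
      left_inv := by
        rintro ⟨⟨a⟩, ha⟩
        have ha' : ¬ Quot.mk r a = Quot.mk r y := ha
        simp [f, g, ha']
      right_inv := by
        rintro ⟨a⟩
        by_cases ha : Quot.mk r a = Quot.mk r y
        · simp only [f, g, ha, dite_true]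
          have h1 : EqvGen (addPair r x y) a y :=
            (Quot.eqvGen_exact ha).mono fun _ _ h => .inl h
          exact (Quot.sound (.inr ⟨rfl, rfl⟩)).trans (Quot.eqvGen_sound h1.symm)
        · simp [f, g, ha] }
  have := Nat.card_congr (Equiv.optionSubtypeNe (Quot.mk r y))
  rw [Finite.card_option, Nat.card_congr e] at this
  exact this

end Classes

section Cycles

variable {A : Type*}

/-- The number of cycles of a permutation, fixed points included. -/
def numCycles (σ : Perm A) : ℕ := numClasses fun a b => b = σ a

theorem SameCycle.eqvGen {σ : Perm A} {s : A → A → Prop} (hs : ∀ a, EqvGen s a (σ a)) {a b : A}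
    (h : σ.SameCycle a b) : EqvGen s a b := by
  have key : ∀ (n : ℕ) (a : A), EqvGen s a ((σ ^ n) a) := by
    intro n
    induction n with
    | zero => exact fun a => .refl _
    | succ n ih =>
      intro a
      rw [pow_succ', Perm.mul_apply]
      exact (ih a).trans _ _ _ (hs _)
  obtain ⟨n, rfl⟩ := h
  obtain ⟨n, rfl | rfl⟩ := n.eq_nat_or_neg
  · exact key n a
  · have := key n ((σ ^ (-(n : ℤ))) a)
    rw [← Perm.mul_apply, ← zpow_natCast, ← zpow_add, add_neg_cancel, zpow_zero] at this
    exact this.symm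

theorem eqvGen_iff_sameCycle {σ : Perm A} {a b : A} :
    EqvGen (fun a b => b = σ a) a b ↔ σ.SameCycle a b := by
  refine ⟨fun h => ?_, fun h =>
    SameCycle.eqvGen (s := fun a b => b = σ a) (fun a => .rel _ _ rfl) h⟩
  induction h with
  | rel a b h => subst h; exact ⟨1, by simp⟩
  | refl a => exact Perm.SameCycle.refl _ _
  | symm _ _ _ ih => exact ih.symm
  | trans _ _ _ _ _ ih ih' => exact ih.trans ih'

variable [DecidableEq A]

theorem not_sameCycle_mul_swap [Finite A] {σ : Perm A} {x y : A} (hxy : x ≠ y)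
    (h : σ.SameCycle x y) : ¬ (σ * swap x y).SameCycle x y := by
  classical
  have hex : ∃ k, (σ ^ k) x = y := h.exists_nat_pow_eq
  let k := Nat.find hex
  have hk : (σ ^ k) x = y := Nat.find_spec hex
  have hmin : ∀ i < k, (σ ^ i) x ≠ y := fun i hi => Nat.find_min hex hi
  have hk0 : 1 ≤ k := by
    by_contra hk'
    have : k = 0 := by omega
    rw [this] at hk
    exact hxy hk
  have hret : ∀ i, 1 ≤ i → i ≤ k → (σ ^ i) x ≠ x := by
    intro i h1 h2 hi
    refine hmin (k - i) (by omega) ?_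
    rw [← hk]
    conv_rhs => rw [← Nat.sub_add_cancel h2, pow_add, Perm.mul_apply, hi]
  have key : ∀ n : ℕ, ∃ i, 1 ≤ i ∧ i ≤ k ∧ ((σ * swap x y) ^ n) y = (σ ^ i) x := by
    intro n
    induction n with
    | zero => exact ⟨k, hk0, le_rfl, hk.symm⟩
    | succ n ih =>
      obtain ⟨i, h1, h2, h3⟩ := ih
      rw [pow_succ', Perm.mul_apply, h3, Perm.mul_apply]
      rcases h2.lt_or_eq with h2 | rfl
      · refine ⟨i + 1, by omega, h2, ?_⟩
        rw [swap_apply_of_ne_of_ne (hret i h1 h2.le) (hmin i h2), pow_succ', Perm.mul_apply]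
      · refine ⟨1, le_rfl, hk0, ?_⟩
        rw [hk, swap_apply_right, pow_one]
  intro hs
  obtain ⟨n, hn⟩ := hs.symm.exists_nat_pow_eq
  obtain ⟨i, h1, h2, h3⟩ := key n
  exact hret i h1 h2 (h3.symm.trans hn)

theorem sameCycle_mul_swap [Finite A] {σ : Perm A} {x y : A} (h : ¬ σ.SameCycle x y) :
    (σ * swap x y).SameCycle x y := by
  classical
  have hex : ∃ k, 0 < k ∧ (σ ^ k) x = x :=
    ⟨orderOf σ, orderOf_pos σ, by rw [pow_orderOf_eq_one]; rfl⟩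
  let k := Nat.find hex
  obtain ⟨hk0, hk⟩ : 0 < k ∧ (σ ^ k) x = x := Nat.find_spec hex
  have hmin : ∀ i, 1 ≤ i → i < k → (σ ^ i) x ≠ x := fun i h1 hi hx =>
    Nat.find_min hex hi ⟨h1, hx⟩
  have key : ∀ i, i + 1 ≤ k → (σ * swap x y).SameCycle y ((σ ^ (i + 1)) x) := by
    intro i
    induction i with
    | zero => exact fun _ => ⟨1, by simp⟩
    | succ i ih =>
      intro hi
      refine (ih (by omega)).trans ⟨1, ?_⟩
      have hy : (σ ^ (i + 1)) x ≠ y := fun e => h ⟨(i + 1 : ℕ), by rwa [zpow_natCast]⟩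
      rw [zpow_one, Perm.mul_apply, swap_apply_of_ne_of_ne (hmin _ (by omega) (by omega)) hy,
        pow_succ' _ (i + 1), Perm.mul_apply]
  have := key (k - 1) (by omega)
  rw [Nat.sub_add_cancel hk0, hk] at this
  exact this.symm

theorem numCycles_mul_swap_of_sameCycle [Finite A] {σ : Perm A} {x y : A} (hxy : x ≠ y)
    (h : σ.SameCycle x y) : numCycles (σ * swap x y) = numCycles σ + 1 := by
  have h1 := numClasses_addPair_of_eqvGen (eqvGen_iff_sameCycle.2 h)
  have h2 := numClasses_addPair_of_not_eqvGen
    (mt eqvGen_iff_sameCycle.1 (not_sameCycle_mul_swap hxy h))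
  have h3 : numClasses (addPair (fun a b => b = σ a) x y) =
      numClasses (addPair (fun a b => b = (σ * swap x y) a) x y) := by
    have aux : ∀ (σ τ : Perm A), τ = σ * swap x y → ∀ a b, addPair (fun a b => b = σ a) x y a b →
        EqvGen (addPair (fun a b => b = τ a) x y) a b := by
      rintro σ τ rfl a b (rfl | ⟨rfl, rfl⟩)
      · have hp : EqvGen (addPair (fun a b => b = (σ * swap x y) a) x y) x y :=
          .rel _ _ (.inr ⟨rfl, rfl⟩)
        have hs : ∀ c, EqvGen (addPair (fun a b => b = (σ * swap x y) a) x y) (swap x y c) (σ c) :=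
          fun c => .rel _ _ (.inl (by simp))
        refine EqvGen.trans _ _ _ ?_ (hs a)
        by_cases hx : a = x
        · subst hx; rwa [swap_apply_left]
        · by_cases hy : a = y
          · subst hy; rw [swap_apply_right]; exact hp.symm
          · rw [swap_apply_of_ne_of_ne hx hy]; exact .refl _
      · exact .rel _ _ (.inr ⟨rfl, rfl⟩)
    exact numClasses_congr_id (aux _ _ rfl) (aux _ _ (by rw [mul_assoc, swap_mul_self, mul_one]))
  unfold numCycles
  omega

theorem numCycles_mul_swap_of_not_sameCycle [Finite A] {σ : Perm A} {x y : A}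
    (h : ¬ σ.SameCycle x y) : numCycles (σ * swap x y) + 1 = numCycles σ := by
  have hxy : x ≠ y := fun e => h (e ▸ Perm.SameCycle.refl _ _)
  have := numCycles_mul_swap_of_sameCycle hxy (sameCycle_mul_swap h)
  rw [mul_assoc, swap_mul_self, mul_one] at this
  exact this.symm

end Cycles

section Genus

variable {A : Type*} [Finite A]

/-- Adjacency in the orbits of the group generated by two permutations. -/
def Linked (σ α : Perm A) (a b : A) : Prop := b = σ a ∨ b = α a

omit [Finite A] in
theorem SameCycle.eqvGen_linked {σ α : Perm A} {a b : A} (h : (σ * α).SameCycle a b) :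
    EqvGen (Linked σ α) a b :=
  SameCycle.eqvGen (fun a => .trans _ (α a) _ (.rel _ _ (.inr rfl)) (.rel _ _ (.inl rfl))) h

/-- The genus of a combinatorial map is nonnegative. -/
theorem euler_inequality [DecidableEq A] (σ α : Perm A) (hα : ∀ a, α (α a) = a) :
    2 * (numCycles σ + numCycles (σ * α)) ≤
      Nat.card {a // α a ≠ a} + 4 * numClasses (Linked σ α) := by
  classical
  cases nonempty_fintype A
  obtain ⟨k, hk⟩ : ∃ k, k = α.support.card := ⟨_, rfl⟩
  have hcard : ∀ α : Perm A, Nat.card {a // α a ≠ a} = α.support.card := by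
    intro α
    rw [Nat.card_eq_fintype_card, Fintype.card_subtype]
    rfl
  induction k using Nat.strong_induction_on generalizing α with
  | _ k ih =>
    rw [hcard]
    by_cases h1 : α = 1
    · subst h1
      have : numClasses (Linked σ 1) = numCycles σ := by
        refine numClasses_congr_id ?_ fun a b h => .rel _ _ (.inl h)
        rintro a b (h | rfl)
        · exact .rel _ _ h
        · exact .refl _
      rw [mul_one, this]
      omega
    · obtain ⟨x, hx⟩ : ∃ x, α x ≠ x := by
        by_contra! hcon
        exact h1 (Equiv.ext hcon)
      obtain ⟨y, hy⟩ : ∃ y, y = α x := ⟨_, rfl⟩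
      have hyx : α y = x := by rw [hy, hα]
      have hne : x ≠ y := by rw [hy]; exact hx.symm
      obtain ⟨β, hβ⟩ : ∃ β, β = α * swap x y := ⟨_, rfl⟩
      have hβx : β x = x := by rw [hβ, Perm.mul_apply, swap_apply_left, hyx]
      have hβy : β y = y := by rw [hβ, Perm.mul_apply, swap_apply_right, hy]
      have hβo : ∀ a, a ≠ x → a ≠ y → β a = α a := fun a h h' => by
        rw [hβ, Perm.mul_apply, swap_apply_of_ne_of_ne h h']
      have hαβ : α = β * swap x y := by rw [hβ, mul_assoc, swap_mul_self, mul_one]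
      have hβi : ∀ a, β (β a) = a := by
        intro a
        by_cases h : a = x
        · subst h; rw [hβx, hβx]
        by_cases h' : a = y
        · subst h'; rw [hβy, hβy]
        rw [hβo a h h', hβo, hα]
        · intro e; apply h'; rw [hy, ← e, hα]
        · intro e; apply h; rw [← hyx, ← e, hα, ]
      have hsupp : α.support = insert x (insert y β.support) := by
        ext a
        simp only [Perm.mem_support, Finset.mem_insert]
        by_cases h : a = x
        · subst h; simp [hx]
        by_cases h' : a = y
        · subst h'; simp [hyx, hne]
        simp [h, h', hβo a h h']
      have hc : α.support.card = β.support.card + 2 := by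
        rw [hsupp, Finset.card_insert_of_notMem, Finset.card_insert_of_notMem]
        · simp [hβy]
        · simp [hne, hβx]
      have IH := ih β.support.card (by omega) β hβi rfl
      rw [hcard] at IH
      have hφ : σ * α = σ * β * swap x y := by rw [hαβ, mul_assoc]
      have hlink : numClasses (Linked σ α) = numClasses (addPair (Linked σ β) x y) := by
        have hp : EqvGen (addPair (Linked σ β) x y) x y := .rel _ _ (.inr ⟨rfl, rfl⟩)
        refine numClasses_congr_id ?_ ?_
        · rintro a b (h | rfl)
          · exact .rel _ _ (.inl (.inl h))
          · by_cases h : a = x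
            · subst h; rw [← hy]; exact hp
            by_cases h' : a = y
            · subst h'; rw [hyx]; exact hp.symm
            exact .rel _ _ (.inl (.inr (hβo a h h').symm))
        · rintro a b ((h | rfl) | ⟨rfl, rfl⟩)
          · exact .rel _ _ (.inl h)
          · by_cases h : a = x
            · subst h; rw [hβx]; exact .refl _
            by_cases h' : a = y
            · subst h'; rw [hβy]; exact .refl _
            exact .rel _ _ (.inr (hβo a h h'))
          · exact .rel _ _ (.inr hy)
      rw [hlink, hφ]
      by_cases hc' : EqvGen (Linked σ β) x y
      · have h3 := numClasses_addPair_of_eqvGen hc'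
        have h4 : numCycles (σ * β * swap x y) ≤ numCycles (σ * β) + 1 := by
          by_cases hs : (σ * β).SameCycle x y
          · exact (numCycles_mul_swap_of_sameCycle hne hs).le
          · have := numCycles_mul_swap_of_not_sameCycle hs
            omega
        omega
      · have h3 := numClasses_addPair_of_not_eqvGen hc'
        have h4 := numCycles_mul_swap_of_not_sameCycle (σ := σ * β)
          (fun hs => hc' (SameCycle.eqvGen_linked hs))
        omega

/-- Every component of the combinatorial map with vertex rotation `σ` and edge involution `α` has
genus zero. -/
def GenusZero (σ α : Perm A) : Prop :=
  2 * (numCycles σ + numCycles (σ * α)) = Nat.card A + 4 * numClasses (Linked σ α)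

/-- Splitting a vertex between two of its corners keeps the genus zero. -/
theorem GenusZero.mul_swap [DecidableEq A] {σ α : Perm A} (h : GenusZero σ α)
    (hα : ∀ a, α (α a) = a) (hfix : ∀ a, α a ≠ a) {x y : A} (hxy : x ≠ y)
    (hc : σ.SameCycle x y) : GenusZero (σ * swap x y) α := by
  have h1 := numCycles_mul_swap_of_sameCycle hxy hc
  have hφ : σ * swap x y * α = σ * α * swap (α x) (α y) := by
    ext a
    simp only [Perm.mul_apply]
    congr 1
    by_cases hx : a = α x
    · subst hx; rw [swap_apply_left, hα, swap_apply_left, hα]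
    by_cases hy : a = α y
    · subst hy; rw [swap_apply_right, hα, swap_apply_right, hα]
    rw [swap_apply_of_ne_of_ne hx hy, swap_apply_of_ne_of_ne]
    · intro e; apply hx; rw [← e, hα]
    · intro e; apply hy; rw [← e, hα]
  have hne : α x ≠ α y := fun e => hxy (α.injective e)
  have heuler := euler_inequality (σ * swap x y) α hα
  have hcard : Nat.card {a // α a ≠ a} = Nat.card A :=
    Nat.card_congr (Equiv.subtypeUnivEquiv hfix)
  have hlink : numClasses (Linked σ α) = numClasses (addPair (Linked (σ * swap x y) α) x y) := by
    have hp : EqvGen (addPair (Linked (σ * swap x y) α) x y) x y := .rel _ _ (.inr ⟨rfl, rfl⟩)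
    have hswap : ∀ a {r : A → A → Prop}, EqvGen r x y → EqvGen r a (swap x y a) := by
      intro a r hr
      by_cases hx : a = x
      · subst hx; rwa [swap_apply_left]
      by_cases hy : a = y
      · subst hy; rw [swap_apply_right]; exact hr.symm
      rw [swap_apply_of_ne_of_ne hx hy]; exact .refl _
    have hσ : EqvGen (Linked σ α) x y := SameCycle.eqvGen (fun a => .rel _ _ (.inl rfl)) hc
    refine numClasses_congr_id ?_ ?_
    · rintro a b (rfl | h)
      · refine (hswap a hp).trans _ _ _ (.rel _ _ (.inl (.inl ?_)))
        simp
      · exact .rel _ _ (.inl (.inr h))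
    · rintro a b ((rfl | h) | ⟨rfl, rfl⟩)
      · exact (hswap a hσ).trans _ _ _ (.rel _ _ (.inl rfl))
      · exact .rel _ _ (.inr h)
      · exact hσ
  unfold GenusZero at h ⊢
  rw [hφ] at heuler ⊢
  rw [hcard] at heuler
  by_cases hl : EqvGen (Linked (σ * swap x y) α) x y
  · have h3 := numClasses_addPair_of_eqvGen hl
    by_cases hs : (σ * α).SameCycle (α x) (α y)
    · have := numCycles_mul_swap_of_sameCycle hne hs
      omega
    · have := numCycles_mul_swap_of_not_sameCycle hs
      omega
  · have h3 := numClasses_addPair_of_not_eqvGen hl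
    have hs : (σ * α).SameCycle (α x) (α y) := by
      by_contra hs
      refine hl ?_
      have h5 := sameCycle_mul_swap hs
      rw [← hφ] at h5
      exact .trans _ _ _ (.rel _ _ (.inr rfl))
        (.trans _ _ _ (SameCycle.eqvGen_linked h5) (.symm _ _ (.rel _ _ (.inr rfl))))
    have := numCycles_mul_swap_of_sameCycle hne hs
    omega

end Genus

section Rotation

variable {A B ε ε' : Type*}

/-- The face step of the map with rotation `σ` whose darts have the given edge names. -/
def EdgeStep (σ : Perm A) (edge : A → ε) (d d' : A) : Prop :=
  ∃ e, e ≠ d ∧ edge e = edge d ∧ d' = σ e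

/-- Two darts are consecutive at a vertex or belong to the same edge. -/
def EdgeLinked (σ : Perm A) (edge : A → ε) (d d' : A) : Prop := d' = σ d ∨ edge d = edge d'

/-- Euler's formula for a map with `V` vertices, all of whose components are spherical. -/
def EulerFormula (V : ℕ) (σ : Perm A) (edge : A → ε) : Prop :=
  2 * (V + numClasses (EdgeStep σ edge)) = Nat.card A + 4 * numClasses (EdgeLinked σ edge)

/-- Every edge name belongs to exactly two darts, if to any. -/
def PairedEdges (edge : A → ε) : Prop :=
  ∀ a, ∃ b, b ≠ a ∧ edge b = edge a ∧ ∀ c, edge c = edge a → c = a ∨ c = b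

theorem EulerFormula.congr {V : ℕ} {σ : Perm A} {τ : Perm B} {edge : A → ε} {edge' : B → ε'}
    (h : EulerFormula V σ edge) (e : A ≃ B) (hσ : ∀ a, e (σ a) = τ (e a))
    (he : ∀ a b, edge a = edge b ↔ edge' (e a) = edge' (e b)) : EulerFormula V τ edge' := by
  have h1 : numClasses (EdgeStep σ edge) = numClasses (EdgeStep τ edge') := by
    refine Nat.card_congr (Quot.congr e fun a b => ⟨?_, ?_⟩)
    · rintro ⟨c, h1, h2, rfl⟩
      exact ⟨e c, fun h => h1 (e.injective h), (he _ _).1 h2, hσ _⟩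
    · rintro ⟨c, h1, h2, h3⟩
      obtain ⟨c, rfl⟩ := e.surjective c
      exact ⟨c, fun h => h1 (h ▸ rfl), (he _ _).2 h2, e.injective (h3.trans (hσ _).symm)⟩
  have h2 : numClasses (EdgeLinked σ edge) = numClasses (EdgeLinked τ edge') := by
    refine Nat.card_congr (Quot.congr e fun a b => or_congr ⟨?_, ?_⟩ (he _ _))
    · rintro rfl; exact hσ _
    · exact fun h => e.injective (h.trans (hσ _).symm)
  unfold EulerFormula at h ⊢
  rwa [← h1, ← h2, ← Nat.card_congr e]

theorem PairedEdges.exists_involution {edge : A → ε} (h : PairedEdges edge) :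
    ∃ α : Perm A, (∀ a, α (α a) = a) ∧ (∀ a, α a ≠ a) ∧
      ∀ a b, edge a = edge b ↔ b = a ∨ b = α a := by
  choose α h1 h2 h3 using h
  have hinv : Function.Involutive α := by
    intro a
    rcases h3 a (α (α a)) ((h2 _).trans (h2 _)) with h | h
    · exact h
    · exact absurd h (h1 _)
  refine ⟨hinv.toPerm, hinv, h1, fun a b => ⟨fun h => h3 _ _ h.symm, ?_⟩⟩
  rintro (rfl | rfl)
  · rfl
  · exact (h2 a).symm

theorem eulerFormula_iff_genusZero {σ α : Perm A} {edge : A → ε} (hfix : ∀ a, α a ≠ a)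
    (he : ∀ a b, edge a = edge b ↔ b = a ∨ b = α a) {V : ℕ}
    (hV : V = numCycles σ) : EulerFormula V σ edge ↔ GenusZero σ α := by
  have h1 : numClasses (EdgeStep σ edge) = numCycles (σ * α) := by
    refine congrArg numClasses ?_
    funext a b
    refine propext ⟨?_, ?_⟩
    · rintro ⟨c, h1, h2, rfl⟩
      rcases (he _ _).1 h2.symm with h | rfl
      · exact absurd h h1
      · rfl
    · rintro rfl
      exact ⟨α a, hfix a, ((he _ _).2 (.inr rfl)).symm, rfl⟩
  have h2 : numClasses (EdgeLinked σ edge) = numClasses (Linked σ α) := by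
    refine numClasses_congr_id ?_ ?_
    · rintro a b (h | h)
      · exact .rel _ _ (.inl h)
      · rcases (he _ _).1 h with rfl | h
        · exact .refl _
        · exact .rel _ _ (.inr h)
    · rintro a b (h | h)
      · exact .rel _ _ (.inl h)
      · exact .rel _ _ (.inr ((he _ _).2 (.inr h)))
  unfold EulerFormula GenusZero
  rw [h1, h2, hV]

theorem EulerFormula.mul_swap [Finite A] [DecidableEq A] {σ : Perm A} {edge : A → ε}
    (h : EulerFormula (numCycles σ) σ edge) (hp : PairedEdges edge) {x y : A} (hxy : x ≠ y)
    (hc : σ.SameCycle x y) : EulerFormula (numCycles σ + 1) (σ * swap x y) edge := by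
  obtain ⟨α, h1, h2, h3⟩ := hp.exists_involution
  rw [eulerFormula_iff_genusZero h2 h3 rfl] at h
  rw [eulerFormula_iff_genusZero h2 h3 (numCycles_mul_swap_of_sameCycle hxy hc).symm]
  exact h.mul_swap h1 h2 hxy hc

/-- The rotation of the darts when a vertex with `n` darts is added. -/
def addVertex (n : ℕ) (σ : Perm A) : Perm (Fin n ⊕ A) := Equiv.sumCongr (finRotate n) σ

/-- Contraction of one of the two edges at a vertex with two darts. -/
theorem EulerFormula.splice [Finite A] [DecidableEq ε] {V : ℕ} {σ : Perm A} {edge : A → ε}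
    {a b : ε} (hab : a ≠ b)
    (h : EulerFormula (V + 1) (addVertex 2 σ) (Sum.elim ![a, b] edge))
    (hp : PairedEdges (Sum.elim ![a, b] edge)) :
    EulerFormula V σ (fun d => if edge d = b then a else edge d) := by
  have hpart : ∀ i : Fin 2, ∃ y, edge y = ![a, b] i ∧ ∀ d, edge d = ![a, b] i → d = y := by
    intro i
    obtain ⟨y | y, h1, h2, h3⟩ := hp (.inl i)
    · exfalso
      simp only [Sum.elim_inl] at h2
      fin_cases i <;> fin_cases y <;> simp_all
    · refine ⟨y, h2, fun d hd => ?_⟩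
      simpa using h3 (.inr d) hd
  obtain ⟨y₀, hy₀, hu₀⟩ := hpart 0
  obtain ⟨y₁, hy₁, hu₁⟩ := hpart 1
  simp only [Matrix.cons_val_zero, Matrix.cons_val_one] at hy₀ hy₁ hu₀ hu₁
  have hy : y₀ ≠ y₁ := by rintro rfl; exact hab (hy₀.symm.trans hy₁)
  have hr0 : finRotate 2 0 = 1 := rfl
  have hr1 : finRotate 2 1 = 0 := rfl
  have hpair : ∀ d e, e ≠ d → edge e = edge d → ¬ (edge d = a) ∧ ¬ (edge d = b) := by
    intro d e h1 h2
    constructor <;> intro h3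
    · exact h1 ((hu₀ _ (h2.trans h3)).trans (hu₀ _ h3).symm)
    · exact h1 ((hu₁ _ (h2.trans h3)).trans (hu₁ _ h3).symm)
  have hF : numClasses (EdgeStep σ (fun d => if edge d = b then a else edge d)) =
      numClasses (EdgeStep (addVertex 2 σ) (Sum.elim ![a, b] edge)) := by
    refine numClasses_congr Sum.inr (Sum.elim ![σ y₀, σ y₁] id) ?_ ?_ (fun _ => .refl _) ?_
    · rintro d d' ⟨e, h1, h2, rfl⟩
      beta_reduce at h2
      by_cases hd : edge d = b
      · rw [if_pos hd] at h2
        have hd' := hu₁ _ hd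
        have : edge e ≠ b := fun h => h1 ((hu₁ _ h).trans hd'.symm)
        rw [if_neg this] at h2
        have he := hu₀ _ h2
        subst hd' he
        refine .trans _ (.inl 0) _ (.rel _ _ ⟨.inl 1, by simp, hy₁.symm, ?_⟩)
          (.rel _ _ ⟨.inr e, by simp, by simpa using hy₀, rfl⟩)
        simp [addVertex, hr1]
      · rw [if_neg hd] at h2
        by_cases he : edge e = b
        · rw [if_pos he] at h2
          have hd' := hu₀ _ h2.symm
          have he' := hu₁ _ he
          subst hd' he'
          refine .trans _ (.inl 1) _ (.rel _ _ ⟨.inl 0, by simp, hy₀.symm, ?_⟩)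
            (.rel _ _ ⟨.inr e, by simp, by simpa using hy₁, rfl⟩)
          simp [addVertex, hr0]
        · rw [if_neg he] at h2
          exact .rel _ _ ⟨.inr e, by simpa using h1, h2, rfl⟩
    · rintro (i | d) x' ⟨e | e, h1, h2, rfl⟩
      · exfalso
        simp only [Sum.elim_inl] at h2
        fin_cases i <;> fin_cases e <;> simp_all
      · fin_cases i
        · have := hu₀ _ h2; subst this; exact .refl _
        · have := hu₁ _ h2; subst this; exact .refl _
      · fin_cases e
        · have := hu₀ _ h2.symm
          subst this
          exact .rel _ _ ⟨y₁, hy.symm, by simp [hy₁, hy₀], by simp [addVertex, hr0]⟩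
        · have := hu₁ _ h2.symm
          subst this
          exact .rel _ _ ⟨y₀, hy, by simp [hy₁, hy₀], by simp [addVertex, hr1]⟩
      · have h1' : e ≠ d := fun h => h1 (h ▸ rfl)
        obtain ⟨h3, h4⟩ := hpair d e h1' h2
        have h2' : edge e = edge d := h2
        exact .rel _ _ ⟨e, h1', by simp [h2', h4], rfl⟩
    · rintro (i | d)
      · fin_cases i
        · exact .symm _ _ (.rel _ _ ⟨.inr y₀, by simp, hy₀, rfl⟩)
        · exact .symm _ _ (.rel _ _ ⟨.inr y₁, by simp, hy₁, rfl⟩)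
      · exact .refl _
  have hC : numClasses (EdgeLinked σ (fun d => if edge d = b then a else edge d)) =
      numClasses (EdgeLinked (addVertex 2 σ) (Sum.elim ![a, b] edge)) := by
    have h0 : EqvGen (EdgeLinked (addVertex 2 σ) (Sum.elim ![a, b] edge)) (.inr y₀) (.inl 0) :=
      .rel _ _ (.inr hy₀)
    have h1 : EqvGen (EdgeLinked (addVertex 2 σ) (Sum.elim ![a, b] edge)) (.inr y₁) (.inl 1) :=
      .rel _ _ (.inr hy₁)
    have h01 : EqvGen (EdgeLinked (addVertex 2 σ) (Sum.elim ![a, b] edge)) (.inl 0) (.inl 1) :=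
      .rel _ _ (.inl (by simp [addVertex, hr0]))
    have hmem : ∀ d, edge d = a ∨ edge d = b →
        EqvGen (EdgeLinked (addVertex 2 σ) (Sum.elim ![a, b] edge)) (.inr d) (.inl 0) := by
      rintro d (hd | hd)
      · rw [hu₀ _ hd]; exact h0
      · rw [hu₁ _ hd]; exact h1.trans _ _ _ h01.symm
    refine numClasses_congr Sum.inr (Sum.elim (fun _ => y₀) id) ?_ ?_ (fun _ => .refl _) ?_
    · rintro d d' (rfl | h)
      · exact .rel _ _ (.inl rfl)
      · beta_reduce at h
        by_cases hd : edge d = b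
        · by_cases hd' : edge d' = b
          · rw [hu₁ _ hd, hu₁ _ hd']; exact .refl _
          · rw [if_pos hd, if_neg hd'] at h
            exact (hmem _ (.inr hd)).trans _ _ _ (hmem _ (.inl h.symm)).symm
        · by_cases hd' : edge d' = b
          · rw [if_neg hd, if_pos hd'] at h
            exact (hmem _ (.inl h)).trans _ _ _ (hmem _ (.inr hd')).symm
          · rw [if_neg hd, if_neg hd'] at h
            exact .rel _ _ (.inr h)
    · have hg : ∀ i d, ![a, b] i = edge d → EqvGen
          (EdgeLinked σ (fun d => if edge d = b then a else edge d)) y₀ d := by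
        intro i d hd
        refine .rel _ _ (.inr ?_)
        fin_cases i
        · have : edge d = a := hd.symm
          simp [this, hy₀, hab]
        · have : edge d = b := hd.symm
          simp [this, hy₀]
      rintro (i | d) x' (rfl | h)
      · exact .refl _
      · rcases x' with j | d
        · exact .refl _
        · exact hg i d h
      · exact .rel _ _ (.inl rfl)
      · rcases x' with j | d'
        · exact (hg j d h.symm).symm
        · have h' : edge d = edge d' := h
          exact .rel _ _ (.inr (congrArg (fun c => if c = b then a else c) h'))
    · rintro (i | d)
      · fin_cases i
        · exact h0
        · exact h0.trans _ _ _ h01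
      · exact .refl _
  unfold EulerFormula at h ⊢
  rw [hF, hC]
  have hcard : Nat.card (Fin 2 ⊕ A) = 2 + Nat.card A := by
    rw [Nat.card_sum]; simp
  rw [hcard] at h
  omega

end Rotation

section Darts

variable {ε ε' ε'' : Type*}

instance (vs : List (List ε)) : Finite (Dart vs) := inferInstanceAs (Finite (Σ _, _))

/-- The rotation of the darts of a list of vertices. -/
def nextPerm (vs : List (List ε)) : Perm (Dart vs) := Equiv.sigmaCongrRight fun _ => finRotate _

theorem eqvGen_finRotate {n : ℕ} (i j : Fin n) : EqvGen (fun a b => b = finRotate n a) i j := by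
  obtain _ | n := n
  · exact i.elim0
  have key : ∀ k (hk : k < n + 1), EqvGen (fun a b => b = finRotate (n + 1) a) 0 ⟨k, hk⟩ := by
    intro k
    induction k with
    | zero => exact fun _ => .refl _
    | succ k ih =>
      intro hk
      refine (ih (by omega)).trans _ _ _ (.rel _ _ ?_)
      rw [finRotate_of_lt (by omega)]
  exact (key i i.2).symm.trans _ _ _ (key j j.2)

theorem eqvGen_dart {vs : List (List ε)} (v : Fin vs.length) (i j : Fin (vs.get v).length) :
    EqvGen (fun a b => b = nextPerm vs a) (⟨v, i⟩ : Dart vs) ⟨v, j⟩ :=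
  eqvGen_of_forall (Sigma.mk v) (fun _ _ h => .rel _ _ (by subst h; rfl)) (eqvGen_finRotate i j)

theorem length_eq_numCycles {vs : List (List ε)} (h : [] ∉ vs) :
    vs.length = numCycles (nextPerm vs) := by
  have hpos : ∀ v : Fin vs.length, 0 < (vs.get v).length := fun v =>
    List.length_pos_of_ne_nil fun e => h (e ▸ List.get_mem vs v)
  have h1 : numCycles (nextPerm vs) = numClasses (fun _ _ : Fin vs.length => False) := by
    refine numClasses_congr Sigma.fst (fun v => ⟨v, ⟨0, hpos v⟩⟩) ?_ (fun _ _ => False.elim) ?_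
      (fun _ => .refl _)
    · rintro a b rfl
      exact .refl _
    · rintro ⟨v, i⟩
      exact eqvGen_dart v _ _
  have h2 : numClasses (fun _ _ : Fin vs.length => False) = Nat.card (Fin vs.length) :=
    Nat.card_congr ⟨Quot.lift id (fun _ _ => False.elim), Quot.mk _, by rintro ⟨a⟩; rfl,
      fun _ => rfl⟩
  rw [h1, h2, Nat.card_fin]

theorem isSpherical_iff {vs : List (List ε)} (h : [] ∉ vs) :
    IsSpherical vs ↔ EulerFormula vs.length (nextPerm vs) Dart.edge := by
  have hpos : ∀ v : Fin vs.length, 0 < (vs.get v).length := fun v =>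
    List.length_pos_of_ne_nil fun e => h (e ▸ List.get_mem vs v)
  have hC : numClasses (Adjacent vs) = numClasses (EdgeLinked (nextPerm vs) Dart.edge) := by
    have hd : ∀ v i j, EqvGen (EdgeLinked (nextPerm vs) Dart.edge) (⟨v, i⟩ : Dart vs) ⟨v, j⟩ :=
      fun v i j => (eqvGen_dart v i j).mono fun _ _ h => .inl h
    refine numClasses_congr (fun v => ⟨v, ⟨0, hpos v⟩⟩) Sigma.fst ?_ ?_ (fun _ => .refl _) ?_
    · rintro v w ⟨a, hv, hw⟩
      obtain ⟨i, hi⟩ := List.get_of_mem hv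
      obtain ⟨j, hj⟩ := List.get_of_mem hw
      refine (hd v _ i).trans _ _ _ (.trans _ ⟨w, j⟩ _ (.rel _ _ (.inr ?_)) (hd w j _))
      exact hi.trans hj.symm
    · rintro d d' (rfl | hdd)
      · exact .refl _
      · refine .rel _ _ ⟨d.edge, List.get_mem _ _, ?_⟩
        rw [hdd]
        exact List.get_mem _ _
    · rintro ⟨v, i⟩
      exact hd v _ _
  unfold IsSpherical EulerFormula
  change 2 * (_ + _) = _ + 4 * numClasses _ ↔ _
  rw [hC]
  rfl

theorem sum_dart (vs : List (List ε)) (f : ε → ℕ) :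
    ∑ d : Dart vs, f d.edge = (vs.flatten.map f).sum := by
  rw [Fintype.sum_sigma]
  have h1 : ∀ v : Fin vs.length, ∑ j, f (Dart.edge (vs := vs) ⟨v, j⟩) = ((vs[v]).map f).sum :=
    fun v => Fin.sum_univ_fun_getElem (vs.get v) f
  simp_rw [h1]
  refine (Fin.sum_univ_fun_getElem vs (fun v => (v.map f).sum)).trans ?_
  rw [List.map_flatten, List.sum_flatten,
    List.map_map]
  rfl

/-- The number of occurrences of `x` in `l`. -/
def multiplicity [DecidableEq ε] (x : ε) (l : List ε) : ℕ := l.countP fun y => y = x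

theorem card_dart_edge [DecidableEq ε] (vs : List (List ε)) (x : ε) :
    (Finset.univ.filter fun d : Dart vs => d.edge = x).card = multiplicity x vs.flatten := by
  rw [Finset.card_filter, sum_dart vs fun e => if e = x then 1 else 0]
  unfold multiplicity
  induction vs.flatten with
  | nil => rfl
  | cons y l ih =>
    rw [List.map_cons, List.sum_cons, ih, List.countP_cons]
    by_cases h : y = x <;> simp [h, add_comm]

theorem pairedEdges_of_count [DecidableEq ε] {vs : List (List ε)}
    (h : ∀ x, multiplicity x vs.flatten = 0 ∨ multiplicity x vs.flatten = 2) :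
    PairedEdges (Dart.edge (vs := vs)) := by
  intro d
  have h1 := card_dart_edge vs d.edge
  have hd : d ∈ Finset.univ.filter fun d' : Dart vs => d'.edge = d.edge := by simp
  have h2 : (Finset.univ.filter fun d' : Dart vs => d'.edge = d.edge).card = 2 := by
    rcases h d.edge with h | h
    · rw [h, Finset.card_eq_zero] at h1
      rw [h1] at hd
      simp at hd
    · exact h1.trans h
  obtain ⟨x, y, hxy, he⟩ := Finset.card_eq_two.1 h2
  have hiff : ∀ c, Dart.edge c = d.edge ↔ c = x ∨ c = y := fun c => by
    simpa using congrArg (c ∈ ·) he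
  rcases (hiff d).1 rfl with rfl | rfl
  · exact ⟨y, hxy.symm, (hiff y).2 (.inr rfl), fun c hc => (hiff c).1 hc⟩
  · exact ⟨x, hxy, (hiff x).2 (.inl rfl), fun c hc => ((hiff c).1 hc).symm⟩

/-- The darts after a vertex has been added. -/
def consDart (v : List ε) (vs : List (List ε)) : Fin v.length ⊕ Dart vs ≃ Dart (v :: vs) where
  toFun := Sum.elim (fun i => ⟨(0 : Fin (vs.length + 1)), i⟩) fun d => ⟨d.1.succ, d.2⟩
  invFun d := match d with
    | ⟨⟨0, _⟩, i⟩ => .inl i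
    | ⟨⟨n + 1, h⟩, i⟩ => .inr ⟨⟨n, Nat.lt_of_succ_lt_succ h⟩, i⟩
  left_inv := by rintro (i | ⟨v, i⟩) <;> rfl
  right_inv := by rintro ⟨⟨_ | n, h⟩, i⟩ <;> rfl

theorem consDart_next (v : List ε) (vs : List (List ε)) (d : Fin v.length ⊕ Dart vs) :
    consDart v vs (addVertex v.length (nextPerm vs) d) = nextPerm (v :: vs) (consDart v vs d) := by
  rcases d with i | ⟨w, i⟩ <;> rfl

theorem consDart_edge (v : List ε) (vs : List (List ε)) (d : Fin v.length ⊕ Dart vs) :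
    (consDart v vs d).edge = Sum.elim v.get Dart.edge d := by
  rcases d with i | ⟨w, i⟩ <;> rfl

theorem eulerFormula_cons_iff {V : ℕ} (v : List ε) (vs : List (List ε)) :
    EulerFormula V (nextPerm (v :: vs)) Dart.edge ↔
      EulerFormula V (addVertex v.length (nextPerm vs)) (Sum.elim v.get Dart.edge) := by
  constructor
  · refine fun h => h.congr (consDart v vs).symm (fun d => ?_) fun d d' => ?_
    · rw [Equiv.symm_apply_eq, consDart_next, Equiv.apply_symm_apply]
    · rw [← consDart_edge, ← consDart_edge, Equiv.apply_symm_apply, Equiv.apply_symm_apply]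
  · refine fun h => h.congr (consDart v vs) (consDart_next v vs) fun d d' => ?_
    rw [← consDart_edge, ← consDart_edge]

theorem PairedEdges.cons {v : List ε} {vs : List (List ε)}
    (h : PairedEdges (Dart.edge (vs := v :: vs))) :
    PairedEdges (Sum.elim v.get (Dart.edge (vs := vs))) := by
  intro d
  obtain ⟨b, h1, h2, h3⟩ := h (consDart v vs d)
  obtain ⟨b, rfl⟩ := (consDart v vs).surjective b
  simp only [consDart_edge] at h2
  refine ⟨b, fun h => h1 (h ▸ rfl), h2, fun c hc => ?_⟩
  simpa using h3 (consDart v vs c) (by simpa only [consDart_edge] using hc)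

/-! ### Isomorphisms of maps -/

/-- The two vertices have the same darts up to rotation and the renaming `f` of edges. -/
def VertexIso (f : ε → ε') (v : List ε) (v' : List ε') : Prop :=
  ∃ e : Fin v.length ≃ Fin v'.length, (∀ i, e (finRotate _ i) = finRotate _ (e i)) ∧
    ∀ i, v'.get (e i) = f (v.get i)

/-- The two lists of vertices describe the same map up to the renaming `f` of edges. -/
def MapIso (f : ε → ε') (vs : List (List ε)) (vs' : List (List ε')) : Prop :=
  ∃ e : Dart vs ≃ Dart vs', (∀ d, e (nextPerm vs d) = nextPerm vs' (e d)) ∧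
    ∀ d, (e d).edge = f d.edge

theorem VertexIso.map (f : ε → ε') (v : List ε) : VertexIso f v (v.map f) := by
  refine ⟨finCongr (by simp), fun i => ?_, fun i => by simp⟩
  have : ∀ {n m : ℕ} (h : n = m) (i : Fin n), finCongr h (finRotate n i) =
      finRotate m (finCongr h i) := by
    rintro n _ rfl i; rfl
  exact this _ i

theorem VertexIso.refl (v : List ε) : VertexIso id v v :=
  ⟨Equiv.refl _, fun _ => rfl, fun _ => rfl⟩

theorem VertexIso.rotate_two (a b : ε) : VertexIso id [a, b] [b, a] :=
  ⟨finRotate 2, fun _ => rfl, by intro i; fin_cases i <;> rfl⟩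

theorem VertexIso.rotate_four (a b c d : ε) : VertexIso id [a, b, c, d] [c, d, a, b] :=
  ⟨finRotate 4 * finRotate 4, fun _ => rfl, by intro i; fin_cases i <;> rfl⟩

theorem VertexIso.rotate_four_one (a b c d : ε) : VertexIso id [a, b, c, d] [d, a, b, c] :=
  ⟨finRotate 4, fun _ => rfl, by intro i; fin_cases i <;> rfl⟩

theorem MapIso.refl (vs : List (List ε)) : MapIso id vs vs :=
  ⟨Equiv.refl _, fun _ => rfl, fun _ => rfl⟩

theorem MapIso.trans {f : ε → ε'} {g : ε' → ε''} {vs : List (List ε)} {vs' : List (List ε')}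
    {vs'' : List (List ε'')} (h : MapIso f vs vs') (h' : MapIso g vs' vs'') :
    MapIso (g ∘ f) vs vs'' := by
  obtain ⟨e, h1, h2⟩ := h
  obtain ⟨e', h1', h2'⟩ := h'
  exact ⟨e.trans e', fun d => by simp [h1, h1'], fun d => by simp [h2, h2']⟩

theorem MapIso.cons {f : ε → ε'} {v : List ε} {v' : List ε'} {vs : List (List ε)}
    {vs' : List (List ε')} (h : VertexIso f v v') (h' : MapIso f vs vs') :
    MapIso f (v :: vs) (v' :: vs') := by
  obtain ⟨e, h1, h2⟩ := h
  obtain ⟨e', h1', h2'⟩ := h'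
  refine ⟨(consDart v vs).symm.trans ((Equiv.sumCongr e e').trans (consDart v' vs')), ?_, ?_⟩
  · intro d
    obtain ⟨d, rfl⟩ := (consDart v vs).surjective d
    rw [← consDart_next]
    simp only [Equiv.trans_apply, Equiv.symm_apply_apply]
    rw [← consDart_next]
    rcases d with i | d
    · exact congrArg (fun x => consDart v' vs' (.inl x)) (h1 i)
    · exact congrArg (fun x => consDart v' vs' (.inr x)) (h1' d)
  · intro d
    obtain ⟨d, rfl⟩ := (consDart v vs).surjective d
    simp only [Equiv.trans_apply, Equiv.symm_apply_apply, consDart_edge]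
    rcases d with i | d
    · exact h2 i
    · exact h2' d

theorem MapIso.of_forall₂ {f : ε → ε'} {vs : List (List ε)} {vs' : List (List ε')}
    (h : List.Forall₂ (VertexIso f) vs vs') : MapIso f vs vs' := by
  induction h with
  | nil =>
    have h0' : IsEmpty (Dart ([] : List (List ε))) := ⟨fun d => d.1.elim0⟩
    have h0'' : IsEmpty (Dart ([] : List (List ε'))) := ⟨fun d => d.1.elim0⟩
    exact ⟨Equiv.equivOfIsEmpty _ _, fun d => h0'.elim d, fun d => h0'.elim d⟩
  | cons h _ ih => exact ih.cons h

theorem MapIso.of_perm {vs vs' : List (List ε)} (h : vs.Perm vs') : MapIso id vs vs' := by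
  induction h with
  | nil => exact .refl _
  | cons v _ ih => exact .cons (.refl v) ih
  | swap v w vs =>
    let e : Fin w.length ⊕ (Fin v.length ⊕ Dart vs) ≃ Fin v.length ⊕ (Fin w.length ⊕ Dart vs) :=
      (Equiv.sumAssoc _ _ _).symm.trans
        ((Equiv.sumCongr (Equiv.sumComm _ _) (Equiv.refl _)).trans (Equiv.sumAssoc _ _ _))
    let F : ∀ v w : List ε, Fin w.length ⊕ (Fin v.length ⊕ Dart vs) ≃ Dart (w :: v :: vs) :=
      fun v w => (Equiv.sumCongr (Equiv.refl _) (consDart v vs)).trans (consDart w (v :: vs))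
    refine ⟨(F v w).symm.trans (e.trans (F w v)), ?_, ?_⟩
    · intro d
      obtain ⟨d, rfl⟩ := (F v w).surjective d
      have hF : ∀ v w d, nextPerm (w :: v :: vs) (F v w d) =
          F v w (addVertex w.length (addVertex v.length (nextPerm vs)) d) := by
        rintro v w (i | i | i) <;> rfl
      rw [hF]
      simp only [Equiv.trans_apply, Equiv.symm_apply_apply]
      rw [hF]
      rcases d with i | i | i <;> rfl
    · intro d
      obtain ⟨d, rfl⟩ := (F v w).surjective d
      simp only [Equiv.trans_apply, Equiv.symm_apply_apply]
      rcases d with i | i | i <;> rfl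
  | trans _ _ ih ih' => exact ih.trans ih'

theorem IsSpherical.congr {f : ε → ε'} {vs : List (List ε)} {vs' : List (List ε')}
    (h : IsSpherical vs) (hf : Function.Injective f) (hvs : [] ∉ vs) (hvs' : [] ∉ vs')
    (hl : vs.length = vs'.length) (hiso : MapIso f vs vs') : IsSpherical vs' := by
  obtain ⟨e, h1, h2⟩ := hiso
  rw [isSpherical_iff hvs] at h
  rw [isSpherical_iff hvs', ← hl]
  exact h.congr e h1 fun a b => by rw [h2, h2, hf.eq_iff]

theorem IsSpherical.perm {vs vs' : List (List ε)} (h : IsSpherical vs) (hvs : [] ∉ vs)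
    (hp : vs.Perm vs') : IsSpherical vs' :=
  h.congr Function.injective_id hvs (fun h => hvs (hp.mem_iff.2 h)) hp.length_eq (.of_perm hp)

theorem IsSpherical.splice [DecidableEq ε] {a b : ε} {vs : List (List ε)} (hab : a ≠ b)
    (h : IsSpherical ([a, b] :: vs)) (hvs : [] ∉ vs)
    (hc : ∀ x, multiplicity x ([a, b] :: vs).flatten = 0 ∨
      multiplicity x ([a, b] :: vs).flatten = 2) :
    IsSpherical (vs.map (List.map fun x => if x = b then a else x)) := by
  rw [isSpherical_iff (by simp [hvs]), eulerFormula_cons_iff] at h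
  have hp := (pairedEdges_of_count hc).cons
  have hget : [a, b].get = ![a, b] := by
    funext i
    fin_cases i <;> rfl
  rw [hget] at h hp
  have h' := EulerFormula.splice hab h hp
  rw [isSpherical_iff (by simpa using hvs), List.length_map]
  obtain ⟨e, h1, h2⟩ : MapIso (fun x => if x = b then a else x) vs
      (vs.map (List.map fun x => if x = b then a else x)) := by
    refine .of_forall₂ ?_
    rw [List.forall₂_map_right_iff, List.forall₂_same]
    exact fun v _ => VertexIso.map _ v
  exact h'.congr e h1 fun d d' => by rw [h2, h2]

theorem IsSpherical.smooth [DecidableEq ε] {a b c d : ε} {vs : List (List ε)}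
    (h : IsSpherical ([a, b, c, d] :: vs)) (hvs : [] ∉ vs)
    (hc : ∀ x, multiplicity x ([a, b, c, d] :: vs).flatten = 0 ∨
      multiplicity x ([a, b, c, d] :: vs).flatten = 2) :
    IsSpherical ([a, b] :: [c, d] :: vs) := by
  classical
  have hne : [] ∉ [a, b, c, d] :: vs := by simp [hvs]
  rw [isSpherical_iff hne, length_eq_numCycles hne] at h
  have hs : (nextPerm ([a, b, c, d] :: vs)).SameCycle (consDart _ _ (.inl (1 : Fin 4)))
      (consDart _ _ (.inl (3 : Fin 4))) := ⟨2, rfl⟩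
  have h' := h.mul_swap (pairedEdges_of_count hc) (by
    intro e
    simpa using (consDart _ _).injective e) hs
  rw [← length_eq_numCycles hne] at h'
  rw [isSpherical_iff (by simp [hvs])]
  let F : Fin 4 ⊕ Dart vs ≃ Fin 2 ⊕ (Fin 2 ⊕ Dart vs) :=
    (Equiv.sumCongr (finSumFinEquiv (m := 2) (n := 2)).symm (Equiv.refl _)).trans
      (Equiv.sumAssoc _ _ _)
  let G : Fin 2 ⊕ (Fin 2 ⊕ Dart vs) ≃ Dart ([a, b] :: [c, d] :: vs) :=
    (Equiv.sumCongr (Equiv.refl _) (consDart [c, d] vs)).trans (consDart [a, b] ([c, d] :: vs))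
  have hedge : ∀ x, (G (F x)).edge = (consDart [a, b, c, d] vs x).edge := by
    rintro (i | i)
    · have : ∀ i : Fin 4, (G (F (.inl i))).edge = ![a, b, c, d] i := by
        intro i; fin_cases i <;> rfl
      refine (this i).trans ?_
      change ![a, b, c, d] i = [a, b, c, d].get i
      revert i
      intro i
      fin_cases i <;> rfl
    · rfl
  refine h'.congr ((consDart [a, b, c, d] vs).symm.trans (F.trans G)) ?_ ?_
  · intro x
    obtain ⟨x, rfl⟩ := (consDart [a, b, c, d] vs).surjective x
    simp only [Equiv.trans_apply, Equiv.symm_apply_apply, Perm.mul_apply]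
    rcases x with i | i
    · have hsw : swap (consDart [a, b, c, d] vs (.inl (1 : Fin 4)))
          (consDart [a, b, c, d] vs (.inl (3 : Fin 4))) (consDart [a, b, c, d] vs (.inl i)) =
          consDart [a, b, c, d] vs (.inl (swap (1 : Fin 4) 3 i)) := by
        rw [Function.Injective.swap_apply (consDart [a, b, c, d] vs).injective,
          Function.Injective.swap_apply Sum.inl_injective]
      rw [hsw, ← consDart_next, Equiv.symm_apply_apply]
      have key : ∀ i : Fin 4, G (F (.inl (finRotate 4 (swap (1 : Fin 4) 3 i)))) =
          nextPerm _ (G (F (.inl i))) := by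
        intro i; fin_cases i <;> rfl
      exact key i
    · rw [swap_apply_of_ne_of_ne]
      · rw [← consDart_next, Equiv.symm_apply_apply]
        rfl
      · intro e; simpa using (consDart _ _).injective e
      · intro e; simpa using (consDart _ _).injective e
  · intro x y
    obtain ⟨x, rfl⟩ := (consDart [a, b, c, d] vs).surjective x
    obtain ⟨y, rfl⟩ := (consDart [a, b, c, d] vs).surjective y
    simp only [Equiv.trans_apply, Equiv.symm_apply_apply, hedge]

end Darts

/-! ### The vertices of a diagram -/

/-- The vertices at the passages `ps` of base strand `n`, numbered from `o`. -/
def passageVertices (n : Fin 2) (ps : List Passage) (o : ℕ) : List (List (Arc ⊕ (Fin 2 × ℕ))) :=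
  (ps.zipIdx o).map fun pk =>
    [Sum.inl pk.1.east, Sum.inr (n, pk.2 + 1), Sum.inl pk.1.west, Sum.inr (n, pk.2)]

/-- The vertices on the base strands and the one outside the rectangle. -/
def strandVertices (s : Fin 2 → List Passage) : List (List (Arc ⊕ (Fin 2 × ℕ))) :=
  passageVertices 0 (s 0) 0 ++ passageVertices 1 (s 1) 0 ++
    [[Sum.inr (0, 0), Sum.inr (0, (s 0).length), Sum.inr (1, (s 1).length), Sum.inr (1, 0)]]

theorem Diagram.vertices_mk (cs : List Crossing) (js : List (Arc × Arc))
    (s : Fin 2 → List Passage) :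
    (⟨cs, js, s⟩ : Diagram).vertices = cs.map (fun X => X.ends.map Sum.inl) ++
      (js.map (fun p => [Sum.inl p.1, Sum.inl p.2]) ++ strandVertices s) := by
  have : List.finRange 2 = [0, 1] := rfl
  simp [Diagram.vertices, strandVertices, this, passageVertices]

theorem Diagram.nil_notMem_vertices (D : Diagram) : [] ∉ D.vertices := by
  rw [Diagram.vertices_mk]
  simp [strandVertices, passageVertices, Crossing.ends]

theorem filterMap_getLeft_passageVertices (n : Fin 2) (ps : List Passage) (o : ℕ) :
    (passageVertices n ps o).flatten.filterMap Sum.getLeft? =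
      ps.flatMap fun p => [p.east, p.west] := by
  induction ps generalizing o with
  | nil => rfl
  | cons p ps ih =>
    have := ih (o + 1)
    unfold passageVertices at this ⊢
    simp [List.zipIdx_cons, this, List.filterMap_cons]

theorem filterMap_getLeft_vertices (D : Diagram) :
    (D.vertices.flatten.filterMap Sum.getLeft?).Perm D.arcEnds := by
  have h1 : ∀ cs : List Crossing, (cs.map fun X => X.ends.map
      (Sum.inl : Arc → Arc ⊕ (Fin 2 × ℕ))).flatten.filterMap Sum.getLeft? =
      cs.flatMap Crossing.ends := by
    intro cs
    induction cs with
    | nil => rfl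
    | cons X cs ih =>
      rw [List.map_cons, List.flatten_cons, List.filterMap_append, ih]
      rfl
  have h2 : ∀ js : List (Arc × Arc), (js.map fun p =>
      [(Sum.inl p.1 : Arc ⊕ (Fin 2 × ℕ)), Sum.inl p.2]).flatten.filterMap Sum.getLeft? =
      js.flatMap fun p => [p.1, p.2] := by
    intro cs
    induction cs with
    | nil => rfl
    | cons X cs ih =>
      rw [List.map_cons, List.flatten_cons, List.filterMap_append, ih]
      rfl
  rw [Diagram.vertices_mk]
  simp only [List.flatten_append, List.filterMap_append, h1, h2, strandVertices,
    filterMap_getLeft_passageVertices, Diagram.arcEnds, List.append_assoc]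
  refine .append_left _ (.append_left _ ?_)
  have h3 : ∀ ps : List Passage, (ps.flatMap fun p => [p.east, p.west]).Perm
      (ps.flatMap fun p => [p.west, p.east]) := fun ps => .flatMap_left _ fun _ _ => .swap _ _ _
  exact (h3 (D.strands 0)).append ((List.append_nil _).symm ▸ h3 (D.strands 1))

theorem multiplicity_eq_count {α : Type*} [DecidableEq α] [BEq α] [LawfulBEq α] (a : α)
    (l : List α) : multiplicity a l = l.count a := by
  refine List.countP_congr fun y _ => ?_
  simp

theorem multiplicity_append {α : Type*} [DecidableEq α] (a : α) (l l' : List α) :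
    multiplicity a (l ++ l') = multiplicity a l + multiplicity a l' := List.countP_append

theorem multiplicity_cons {α : Type*} [DecidableEq α] (a b : α) (l : List α) :
    multiplicity a (b :: l) = multiplicity a l + if b = a then 1 else 0 := by
  simp [multiplicity, List.countP_cons]

theorem multiplicity_nil {α : Type*} [DecidableEq α] (a : α) :
    multiplicity a [] = 0 := rfl

theorem multiplicity_eq_zero {α : Type*} [DecidableEq α] {a : α} {l : List α} (h : a ∉ l) :
    multiplicity a l = 0 := by
  refine List.countP_eq_zero.2 fun y hy => ?_
  have : y ≠ a := by
    rintro rfl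
    exact h hy
  simpa using this

theorem Perm.multiplicity_eq {α : Type*} [DecidableEq α] {l l' : List α} (h : l.Perm l') (a : α) :
    multiplicity a l = multiplicity a l' := h.countP_eq _

theorem multiplicity_inl {α β : Type*} [DecidableEq α] [DecidableEq β] (l : List (α ⊕ β)) (a : α) :
    multiplicity (.inl a) l = multiplicity a (l.filterMap Sum.getLeft?) := by
  induction l with
  | nil => rfl
  | cons x l ih =>
    rw [multiplicity_cons, ih]
    rcases x with x | x <;> simp [multiplicity_cons, List.filterMap_cons]

theorem multiplicity_inr_passageVertices (n m : Fin 2) (k : ℕ) (ps : List Passage) (o : ℕ) :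
    multiplicity (.inr (m, k)) (passageVertices n ps o).flatten =
      (if n = m ∧ o ≤ k ∧ k < o + ps.length then 1 else 0) +
        if n = m ∧ o < k ∧ k ≤ o + ps.length then 1 else 0 := by
  induction ps generalizing o with
  | nil =>
    have h1 : ¬ (o ≤ k ∧ k < o) := by omega
    have h2 : ¬ (o < k ∧ k ≤ o) := by omega
    simp [passageVertices, h1, h2, multiplicity_nil]
  | cons p ps ih =>
    have := ih (o + 1)
    unfold passageVertices at this ⊢
    rw [List.zipIdx_cons, List.map_cons, List.flatten_cons, multiplicity_append, this]
    by_cases hn : n = m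
    · subst hn
      simp only [multiplicity_cons, multiplicity_nil, true_and, List.length_cons,
        Sum.inr.injEq, Prod.mk.injEq, reduceCtorEq, if_false]
      split_ifs <;> simp_all <;> omega
    · simp [hn, multiplicity_cons, multiplicity_nil]

theorem Diagram.WellFormed.count_vertices {D : Diagram} (h : D.WellFormed)
    (x : Arc ⊕ (Fin 2 × ℕ)) :
    multiplicity x D.vertices.flatten = 0 ∨ multiplicity x D.vertices.flatten = 2 := by
  rcases x with a | ⟨n, k⟩
  · rw [multiplicity_inl, multiplicity_eq_count, (filterMap_getLeft_vertices D).count_eq a]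
    exact h a
  · have h1 : ∀ cs : List Crossing, multiplicity (Sum.inr (n, k) : Arc ⊕ (Fin 2 × ℕ))
        (cs.map fun X => X.ends.map Sum.inl).flatten = 0 := by
      intro cs
      refine multiplicity_eq_zero ?_
      simp
    have h2 : ∀ js : List (Arc × Arc), multiplicity (Sum.inr (n, k) : Arc ⊕ (Fin 2 × ℕ))
        (js.map fun p => [Sum.inl p.1, Sum.inl p.2]).flatten = 0 := by
      intro cs
      refine multiplicity_eq_zero ?_
      simp
    rw [Diagram.vertices_mk]
    simp only [List.flatten_append, multiplicity_append, h1, h2, strandVertices,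
      multiplicity_inr_passageVertices, List.flatten_cons, List.flatten_nil, List.append_nil]
    simp only [multiplicity_cons, multiplicity_nil, Sum.inr.injEq, Prod.mk.injEq]
    fin_cases n <;> simp <;> split_ifs <;> omega

theorem Crossing.ends_map (f : Arc → Arc) (X : Crossing) : (X.map f).ends = X.ends.map f := rfl

theorem Diagram.arcEnds_map (f : Arc → Arc) (D : Diagram) :
    (D.map f).arcEnds = D.arcEnds.map f := by
  simp [Diagram.arcEnds, Diagram.map, List.flatMap_map, List.map_flatMap, Crossing.ends_map,
    Passage.map]

theorem passageVertices_map (f : Arc → Arc) (n : Fin 2) (ps : List Passage) (o : ℕ) :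
    passageVertices n (ps.map (Passage.map f)) o =
      (passageVertices n ps o).map (List.map (Sum.map f id)) := by
  simp [passageVertices, List.zipIdx_map, Passage.map]

theorem Diagram.vertices_map (f : Arc → Arc) (D : Diagram) :
    (D.map f).vertices = D.vertices.map (List.map (Sum.map f id)) := by
  rw [Diagram.vertices_mk, Diagram.map, Diagram.vertices_mk]
  simp only [strandVertices, passageVertices_map, List.map_append, List.map_map, List.length_map,
    List.map_cons, List.map_nil, Sum.map_inr, id]
  rfl

/-! ### Elementary changes of the description of a diagram -/

theorem Diagram.IsLink.of_perm {D D' : Diagram} (h : D.IsLink) (ha : D.arcEnds.Perm D'.arcEnds)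
    (hv : D.vertices.Perm D'.vertices) : D'.IsLink :=
  ⟨fun a => by rw [← ha.count_eq]; exact h.1 a, h.2.perm D.nil_notMem_vertices hv⟩

theorem Diagram.IsLink.of_forall₂ {D D' : Diagram} (h : D.IsLink)
    (ha : D.arcEnds.Perm D'.arcEnds)
    (hv : List.Forall₂ (VertexIso id) D.vertices D'.vertices) : D'.IsLink :=
  ⟨fun a => by rw [← ha.count_eq]; exact h.1 a, h.2.congr Function.injective_id
    D.nil_notMem_vertices D'.nil_notMem_vertices hv.length_eq (.of_forall₂ hv)⟩

theorem forall₂_refl_vertexIso {ε : Type*} (vs : List (List ε)) :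
    List.Forall₂ (VertexIso id) vs vs := List.forall₂_same.2 fun v _ => VertexIso.refl v

theorem count_map_merge {α : Type*} [DecidableEq α] [BEq α] [LawfulBEq α] {a b : α}
    (hab : a ≠ b) (l : List α) (x : α) :
    (l.map fun x => if x = b then a else x).count x =
      if x = b then 0 else if x = a then l.count a + l.count b else l.count x := by
  induction l with
  | nil => simp
  | cons y l ih =>
    rw [List.map_cons, List.count_cons, ih]
    simp only [List.count_cons, beq_iff_eq]
    grind

theorem PlanarMove.isLink {D D' : Diagram} (h : PlanarMove D D') (hD : D.IsLink) : D'.IsLink := by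
  cases h with
  | perm s hc hj =>
    refine hD.of_perm ?_ ?_
    · simp only [Diagram.arcEnds]
      exact (((hc.flatMap_right _).append (hj.flatMap_right _)).append_right _).append_right _
    · rw [Diagram.vertices_mk, Diagram.vertices_mk]
      exact (hc.map _).append ((hj.map _).append_right _)
  | rename f =>
    refine ⟨fun a => ?_, ?_⟩
    · obtain ⟨a, rfl⟩ := f.surjective a
      rw [Diagram.arcEnds_map, List.count_map_of_injective _ _ f.injective]
      exact hD.1 a
    · refine hD.2.congr (f := Sum.map f id) (f.injective.sumMap Function.injective_id)
        D.nil_notMem_vertices (Diagram.nil_notMem_vertices _) ?_ ?_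
      · rw [Diagram.vertices_map, List.length_map]
      · rw [Diagram.vertices_map]
        refine .of_forall₂ ?_
        rw [List.forall₂_map_right_iff, List.forall₂_same]
        exact fun v _ => VertexIso.map _ v
  | turn a b c d cs js s =>
    refine hD.of_forall₂ ?_ ?_
    · simp only [Diagram.arcEnds, List.flatMap_cons, List.append_assoc]
      exact List.Perm.append_right _ (List.perm_append_comm (l₁ := [a, b]) (l₂ := [c, d]))
    · rw [Diagram.vertices_mk, Diagram.vertices_mk]
      exact .cons (VertexIso.rotate_four _ _ _ _) (forall₂_refl_vertexIso _)
  | swap a b cs js s =>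
    refine hD.of_forall₂ ?_ ?_
    · simp only [Diagram.arcEnds, List.flatMap_cons, List.append_assoc]
      exact List.Perm.append_left _ (.swap _ _ _)
    · rw [Diagram.vertices_mk, Diagram.vertices_mk]
      exact List.rel_append (forall₂_refl_vertexIso _)
        (.cons (VertexIso.rotate_two _ _) (forall₂_refl_vertexIso _))
  | splice a b cs js s hab =>
    have ha : (⟨cs, (a, b) :: js, s⟩ : Diagram).arcEnds.Perm
        (a :: b :: (⟨cs, js, s⟩ : Diagram).arcEnds) := by
      simp only [Diagram.arcEnds, List.flatMap_cons, List.append_assoc]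
      exact List.perm_append_comm_assoc _ [a, b] _
    have hv : (⟨cs, (a, b) :: js, s⟩ : Diagram).vertices.Perm
        ([.inl a, .inl b] :: (⟨cs, js, s⟩ : Diagram).vertices) := by
      rw [Diagram.vertices_mk, Diagram.vertices_mk]
      exact List.perm_middle
    refine ⟨fun x => ?_, ?_⟩
    · rw [Diagram.arcEnds_map, count_map_merge hab]
      have h1 := hD.1 a
      have h2 := hD.1 b
      have h3 := hD.1 x
      rw [ha.count_eq] at h1 h2 h3
      simp only [List.count_cons, beq_iff_eq] at h1 h2 h3
      grind
    · have h1 := (hD.2.perm (Diagram.nil_notMem_vertices _) hv).splice (by simpa using hab)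
        (Diagram.nil_notMem_vertices _) (fun x => by
          rw [← Perm.multiplicity_eq hv.flatten]
          exact hD.1.count_vertices x)
      rw [Diagram.vertices_map]
      convert h1 using 3
      funext x
      rcases x with x | x
      · simp only [Sum.map_inl, Sum.inl.injEq]
        split_ifs <;> rfl
      · simp

theorem Diagram.IsLink.smooth_head {X : Crossing} {cs : List Crossing} {js : List (Arc × Arc)}
    {s : Fin 2 → List Passage} (h : (⟨X :: cs, js, s⟩ : Diagram).IsLink) (b : Bool) :
    (⟨cs, X.smoothing b ++ js, s⟩ : Diagram).IsLink := by
  have hv : (⟨X :: cs, js, s⟩ : Diagram).vertices =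
      X.ends.map Sum.inl :: (⟨cs, js, s⟩ : Diagram).vertices := by
    rw [Diagram.vertices_mk, Diagram.vertices_mk]
    rfl
  have hv' : (⟨cs, X.smoothing b ++ js, s⟩ : Diagram).vertices.Perm
      ((X.smoothing b).map (fun p => [Sum.inl p.1, Sum.inl p.2]) ++
        (⟨cs, js, s⟩ : Diagram).vertices) := by
    rw [Diagram.vertices_mk, Diagram.vertices_mk, List.map_append, List.append_assoc]
    exact List.perm_append_comm_assoc _ _ _
  have hc := h.1.count_vertices
  have hs := h.2
  rw [hv] at hs hc
  refine ⟨fun a => ?_, ?_⟩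
  · have : (⟨cs, X.smoothing b ++ js, s⟩ : Diagram).arcEnds.Perm
        (⟨X :: cs, js, s⟩ : Diagram).arcEnds := by
      simp only [Diagram.arcEnds, List.flatMap_cons, List.append_assoc, List.flatMap_append]
      refine (List.perm_append_comm_assoc _ _ _).trans (.append_right _ ?_)
      rcases X with ⟨x, y, z, w⟩
      cases b
      · exact .cons _ ((List.perm_append_comm (l₁ := [w]) (l₂ := [y, z])))
      · exact .refl _
    rw [this.count_eq]
    exact h.1 a
  · rcases X with ⟨x, y, z, w⟩
    cases b
    · have hr : List.Forall₂ (VertexIso id)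
          ([Sum.inl x, Sum.inl y, Sum.inl z, Sum.inl w] :: (⟨cs, js, s⟩ : Diagram).vertices)
          ([Sum.inl w, Sum.inl x, Sum.inl y, Sum.inl z] :: (⟨cs, js, s⟩ : Diagram).vertices) :=
        .cons (VertexIso.rotate_four_one _ _ _ _) (forall₂_refl_vertexIso _)
      have hn := Diagram.nil_notMem_vertices ⟨cs, js, s⟩
      have h1 := hs.congr Function.injective_id (by simp [hn, Crossing.ends]) (by simp [hn])
        hr.length_eq (.of_forall₂ hr)
      have h2 := h1.smooth (Diagram.nil_notMem_vertices _) (fun e => by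
        have hp : ([Sum.inl w, Sum.inl x, Sum.inl y, Sum.inl z] ++
            (⟨cs, js, s⟩ : Diagram).vertices.flatten).Perm
            ([Sum.inl x, Sum.inl y, Sum.inl z, Sum.inl w] ++
              (⟨cs, js, s⟩ : Diagram).vertices.flatten) :=
          List.Perm.append_right _ (List.perm_append_comm (l₁ := [_]) (l₂ := [_, _, _]))
        have := hc e
        rw [List.flatten_cons, Perm.multiplicity_eq hp]
        exact this)
      have h3 : IsSpherical ([Sum.inl x, Sum.inl w] :: [Sum.inl y, Sum.inl z] ::
          (⟨cs, js, s⟩ : Diagram).vertices) :=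
        have hr : List.Forall₂ (VertexIso id)
          ([Sum.inl w, Sum.inl x] :: [Sum.inl y, Sum.inl z] :: (⟨cs, js, s⟩ : Diagram).vertices)
          ([Sum.inl x, Sum.inl w] :: [Sum.inl y, Sum.inl z] :: (⟨cs, js, s⟩ : Diagram).vertices) :=
          .cons (VertexIso.rotate_two _ _) (forall₂_refl_vertexIso _)
        h2.congr Function.injective_id (by simp [hn]) (by simp [hn])
          hr.length_eq (.of_forall₂ hr)
      exact h3.perm (by simp [hn]) hv'.symm
    · have h2 := hs.smooth (Diagram.nil_notMem_vertices _) hc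
      exact h2.perm (by simp [Diagram.nil_notMem_vertices]) hv'.symm

theorem isLink_of_reflTransGen {D D' : Diagram} (h : ReflTransGen PlanarMove D D')
    (hD : D.IsLink) : D'.IsLink := by
  induction h with
  | refl => exact hD
  | tail _ h ih => exact h.isLink ih

theorem planarIsotopic_of_reflTransGen {D D' : Diagram} (h : ReflTransGen PlanarMove D D')
    (hD : D.IsLink) : PlanarIsotopic D D' := by
  induction h with
  | refl => exact .refl _
  | tail h1 h2 ih =>
    have h3 := isLink_of_reflTransGen h1 hD
    exact .trans _ _ _ ih (.rel _ _ ⟨h3, h2.isLink h3, h2⟩)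

theorem PlanarIsotopic.toSkein_eq {D D' : Diagram} (h : PlanarIsotopic D D') :
    D.toSkein = D'.toSkein := by
  induction h with
  | rel D D' h =>
    rw [Diagram.toSkein, Diagram.toSkein, dif_pos h.1, dif_pos h.2.1, Submodule.Quotient.eq]
    exact Submodule.subset_span (.planar ⟨D, h.1⟩ ⟨D', h.2.1⟩ h.2.2)
  | refl _ => rfl
  | symm _ _ _ ih => exact ih.symm
  | trans _ _ _ _ _ ih ih' => exact ih.trans ih'

/-! ### Planar moves that keep the order of the crossings -/

/-- The same crossing, described from the other end of the lower strand. -/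
def Crossing.turn (X : Crossing) : Crossing := ⟨X.c, X.d, X.a, X.b⟩

/-- Elementary changes of the description of a diagram that keep the order of its crossings. -/
inductive OrderedMove : Diagram → Diagram → Prop
  | perm {js js'} (cs s) (hj : List.Perm js js') : OrderedMove ⟨cs, js, s⟩ ⟨cs, js', s⟩
  | rename (f : Equiv.Perm Arc) (D : Diagram) : OrderedMove D (D.map f)
  | turn {cs cs'} (js s) (h : List.Forall₂ (fun X Y => Y = X ∨ Y = X.turn) cs cs') :
      OrderedMove ⟨cs, js, s⟩ ⟨cs', js, s⟩
  | swap (a b cs js s) : OrderedMove ⟨cs, (a, b) :: js, s⟩ ⟨cs, (b, a) :: js, s⟩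
  | splice (a b cs js s) (hab : a ≠ b) :
      OrderedMove ⟨cs, (a, b) :: js, s⟩
        ((⟨cs, js, s⟩ : Diagram).map (fun x => if x = b then a else x))

/-- Planar isotopy by moves that keep the order of the crossings. -/
abbrev OrderedIsotopic : Diagram → Diagram → Prop := ReflTransGen OrderedMove

theorem OrderedMove.reflTransGen {D D' : Diagram} (h : OrderedMove D D') :
    ReflTransGen PlanarMove D D' := by
  cases h with
  | perm cs s hj => exact .single (.perm s (.refl _) hj)
  | rename f => exact .single (.rename f D)
  | swap a b cs js s => exact .single (.swap a b cs js s)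
  | splice a b cs js s hab => exact .single (.splice a b cs js s hab)
  | @turn cs cs' js s h =>
    suffices H : ∀ ds, ReflTransGen PlanarMove ⟨cs ++ ds, js, s⟩ ⟨cs' ++ ds, js, s⟩ by
      simpa using H []
    induction h with
    | nil => exact fun _ => .refl
    | @cons X Y cs cs' h _ ih =>
      intro ds
      have h1 : ReflTransGen PlanarMove ⟨X :: cs ++ ds, js, s⟩ ⟨Y :: cs ++ ds, js, s⟩ := by
        rcases h with rfl | rfl
        · exact .refl
        · exact .single (.turn X.a X.b X.c X.d _ js s)
      refine h1.trans (.head (.perm s List.perm_middle.symm (.refl _)) ?_)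
      exact (ih (Y :: ds)).tail (.perm s List.perm_middle (.refl _))

theorem OrderedIsotopic.reflTransGen {D D' : Diagram} (h : OrderedIsotopic D D') :
    ReflTransGen PlanarMove D D' := by
  induction h with
  | refl => exact .refl
  | tail _ h ih => exact ih.trans h.reflTransGen

theorem OrderedIsotopic.isLink {D D' : Diagram} (h : OrderedIsotopic D D') (hD : D.IsLink) :
    D'.IsLink := isLink_of_reflTransGen h.reflTransGen hD

theorem OrderedIsotopic.planarIsotopic {D D' : Diagram} (h : OrderedIsotopic D D')
    (hD : D.IsLink) : PlanarIsotopic D D' := planarIsotopic_of_reflTransGen h.reflTransGen hD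

theorem smooth_cons_singleton (X : Crossing) (cs : List Crossing) (js : List (Arc × Arc))
    (s : Fin 2 → List Passage) (b : Bool) :
    (⟨X :: cs, js, s⟩ : Diagram).smooth [b] = ⟨cs, X.smoothing b ++ js, s⟩ := by
  simp [Diagram.smooth]

theorem smooth_nil_singleton (js : List (Arc × Arc)) (s : Fin 2 → List Passage) (b : Bool) :
    (⟨[], js, s⟩ : Diagram).smooth [b] = ⟨[], js, s⟩ := by
  simp [Diagram.smooth]

theorem Crossing.smoothing_map (f : Arc → Arc) (X : Crossing) (b : Bool) :
    (X.map f).smoothing b = (X.smoothing b).map (Prod.map f f) := by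
  cases b <;> rfl

theorem Diagram.smooth_map (f : Arc → Arc) (D : Diagram) (b : Bool) :
    (D.map f).smooth [b] = (D.smooth [b]).map f := by
  rcases D with ⟨_ | ⟨X, cs⟩, js, s⟩
  · simp [Diagram.map, smooth_nil_singleton]
  · simp [Diagram.map, smooth_cons_singleton, Crossing.smoothing_map]

theorem OrderedMove.smooth {D D' : Diagram} (h : OrderedMove D D') (b : Bool) :
    OrderedIsotopic (D.smooth [b]) (D'.smooth [b]) := by
  cases h with
  | perm cs s hj =>
    rcases cs with _ | ⟨X, cs⟩
    · simp only [smooth_nil_singleton]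
      exact .single (.perm _ s hj)
    · simp only [smooth_cons_singleton]
      exact .single (.perm _ s (hj.append_left _))
  | rename f =>
    rw [Diagram.smooth_map]
    exact .single (.rename f _)
  | turn js s h =>
    cases h with
    | nil => exact .refl
    | @cons X Y cs cs' h h' =>
      simp only [smooth_cons_singleton]
      refine .trans (.single (.turn _ s h')) ?_
      rcases h with rfl | rfl
      · exact .refl
      · rcases X with ⟨x, y, z, w⟩
        cases b
        · refine .head (.swap _ _ _ _ _) (.head (.perm _ _ (.swap _ _ _)) ?_)
          exact .single (.swap _ _ _ _ _)
        · exact .single (.perm _ _ (.swap _ _ _))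
  | swap x y cs js s =>
    rcases cs with _ | ⟨X, cs⟩
    · simp only [smooth_nil_singleton]
      exact .single (.swap _ _ _ _ _)
    · simp only [smooth_cons_singleton]
      refine .head (.perm _ _ List.perm_middle) (.head (.swap _ _ _ _ _) ?_)
      exact .single (.perm _ _ List.perm_middle.symm)
  | splice x y cs js s hab =>
    rw [Diagram.smooth_map]
    rcases cs with _ | ⟨X, cs⟩
    · simp only [smooth_nil_singleton]
      exact .single (.splice _ _ _ _ _ hab)
    · simp only [smooth_cons_singleton]
      exact .head (.perm _ _ List.perm_middle) (.single (.splice _ _ _ _ _ hab))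

theorem OrderedIsotopic.smooth {D D' : Diagram} (h : OrderedIsotopic D D') (b : Bool) :
    OrderedIsotopic (D.smooth [b]) (D'.smooth [b]) := by
  induction h with
  | refl => exact .refl
  | tail _ h ih => exact ih.trans (h.smooth b)

theorem smooth_cons (D : Diagram) (b : Bool) (σ : List Bool) (h : D.crossings ≠ []) :
    OrderedMove ((D.smooth [b]).smooth σ) (D.smooth (b :: σ)) := by
  rcases D with ⟨_ | ⟨X, cs⟩, js, s⟩
  · exact absurd rfl h
  · rw [smooth_cons_singleton]
    simp only [Diagram.smooth, List.length_cons, List.drop_succ_cons, List.zipWith_cons_cons,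
      List.flatten_cons, List.append_assoc]
    exact .perm _ _ (List.perm_append_comm_assoc _ _ _)

theorem smooth_concat (D : Diagram) (b : Bool) (σ : List Bool)
    (h : σ.length < D.crossings.length) :
    OrderedMove (D.smooth (σ ++ [b])) ((D.smooth σ).smooth [b]) := by
  rcases D with ⟨cs, js, s⟩
  obtain ⟨cs, X, ds, rfl, hl⟩ : ∃ cs' X ds, cs = cs' ++ X :: ds ∧ cs'.length = σ.length :=
    ⟨cs.take σ.length, cs[σ.length]'h, cs.drop (σ.length + 1), by simp, by
      simp only [List.length_take]
      change σ.length < cs.length at h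
      omega⟩
  have h1 : (⟨cs ++ X :: ds, js, s⟩ : Diagram).smooth σ =
      ⟨X :: ds, (List.zipWith Crossing.smoothing cs σ).flatten ++ js, s⟩ := by
    have := List.zipWith_append (f := Crossing.smoothing) (l₁ := cs) (l₁' := X :: ds)
      (l₂ := σ) (l₂' := []) hl
    rw [List.append_nil] at this
    simp [Diagram.smooth, ← hl, this]
  rw [h1, smooth_cons_singleton]
  have h2 : (⟨cs ++ X :: ds, js, s⟩ : Diagram).smooth (σ ++ [b]) =
      ⟨ds, (List.zipWith Crossing.smoothing cs σ).flatten ++ (X.smoothing b ++ js), s⟩ := by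
    have := List.zipWith_append (f := Crossing.smoothing) (l₁ := cs) (l₁' := X :: ds)
      (l₂ := σ) (l₂' := [b]) hl
    simp [Diagram.smooth, ← hl, this, ← List.drop_drop]
  rw [h2]
  exact .perm _ _ (List.perm_append_comm_assoc _ _ _)

theorem Diagram.IsLink.smooth {D : Diagram} (h : D.IsLink) (σ : List Bool)
    (hσ : σ.length ≤ D.crossings.length) : (D.smooth σ).IsLink := by
  induction σ generalizing D with
  | nil =>
    have : D.smooth [] = D := by simp [Diagram.smooth]
    rwa [this]
  | cons b σ ih =>
    rcases D with ⟨_ | ⟨X, cs⟩, js, s⟩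
    · simp at hσ
    · have h1 := h.smooth_head b
      rw [← smooth_cons_singleton] at h1
      refine OrderedIsotopic.isLink (.single (smooth_cons _ b σ (by simp))) (ih h1 ?_)
      rw [smooth_cons_singleton]
      simpa using hσ

/-! ### The state expansion -/

theorem toSkein_eq_smooth {D : Diagram} (h : D.IsLink) (hD : D.crossings ≠ []) :
    D.toSkein = (LaurentPolynomial.T 1 : ℂ[T;T⁻¹]) • (D.smooth [true]).toSkein +
      (LaurentPolynomial.T (-1) : ℂ[T;T⁻¹]) • (D.smooth [false]).toSkein := by
  rcases D with ⟨_ | ⟨X, cs⟩, js, s⟩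
  · exact absurd rfl hD
  · have h1 := h.smooth_head true
    have h2 := h.smooth_head false
    rw [smooth_cons_singleton, smooth_cons_singleton, Diagram.toSkein, Diagram.toSkein,
      Diagram.toSkein, dif_pos h, dif_pos h1, dif_pos h2, ← Submodule.Quotient.mk_smul,
      ← Submodule.Quotient.mk_smul, ← Submodule.Quotient.mk_add, Submodule.Quotient.eq,
      ← sub_sub]
    exact Submodule.subset_span (.skein X cs js s ⟨_, h⟩ ⟨_, h1⟩ ⟨_, h2⟩ rfl rfl rfl)

theorem toSkein_eq_sum_smooth {D : Diagram} (h : D.IsLink) (w : ℕ)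
    (hw : w ≤ D.crossings.length) :
    D.toSkein = ∑ σ : Fin w → Bool, (LaurentPolynomial.T (stateExponent σ) : ℂ[T;T⁻¹]) •
      (D.smooth (List.ofFn σ)).toSkein := by
  induction w generalizing D with
  | zero =>
    have : D.smooth [] = D := by simp [Diagram.smooth]
    simp [stateExponent, this]
  | succ w ih =>
    have hne : D.crossings ≠ [] := by
      intro e
      simp [e] at hw
    have key : ∀ b : Bool, (D.smooth [b]).toSkein = ∑ σ : Fin w → Bool,
        (LaurentPolynomial.T (stateExponent σ) : ℂ[T;T⁻¹]) •
          (D.smooth (b :: List.ofFn σ)).toSkein := by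
      intro b
      have h1 : (D.smooth [b]).IsLink := h.smooth [b] (by simp; omega)
      have hlen : w ≤ (D.smooth [b]).crossings.length := by
        simp [Diagram.smooth]
        omega
      rw [ih h1 hlen]
      refine Finset.sum_congr rfl fun σ _ => ?_
      rw [(OrderedIsotopic.planarIsotopic (.single (smooth_cons D b (List.ofFn σ) hne))
        (h1.smooth _ (by simpa using hlen))).toSkein_eq]
    rw [toSkein_eq_smooth h hne, key, key,
      ← (Fin.consEquiv fun _ : Fin (w + 1) => Bool).sum_comp, Fintype.sum_prod_type,
      Fintype.sum_bool, Finset.smul_sum, Finset.smul_sum]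
    congr 1 <;>
    · refine Finset.sum_congr rfl fun σ _ => ?_
      rw [smul_smul, ← LaurentPolynomial.T_add]
      simp [stateExponent, Fin.consEquiv, Fin.sum_univ_succ, List.ofFn_succ]

/-! ### Diagrams described by lists of points -/

/-- Renaming of the arcs at a point. -/
def Point.map (f : Arc → Arc) (p : Point) : Point := { p with inn := f p.inn, out := f p.out }

/-- The point after the direction of travel has been reversed. -/
def Point.rev (p : Point) : Point := ⟨p.e, p.i, p.e.turnQ p.q, p.out, p.inn⟩

/-- The points on base strand `n`. -/
def onStrand (P : List Point) (n : Fin 2) : List Point :=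
  P.filter fun p => p.e = .strand n true ∨ p.e = .strand n false

/-- The crossing of sign `u` with the given lower and upper point, if both are there. -/
def crossingOf (u : ℤ) : Option Point → Option Point → List Crossing
  | some lower, some upper => [mkSigned u lower upper]
  | _, _ => []

/-- The crossing of sign `u` with label `k` among the points `P`. -/
def crossingAt (P : List Point) (u : ℤ) (k : ℕ) : List Crossing :=
  crossingOf u (P.find? fun p => p.e = .self k false) (P.find? fun p => p.e = .self k true)

/-- The diagram with points `P`, joints `J` and crossings `w + 1, w + 2, …` of the signs `U`. -/
def pointDiagram (w : ℕ) (U : List ℤ) (P : List Point) (J : List (Arc × Arc)) : Diagram where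
  crossings := (U.zipIdx (w + 1)).flatMap fun uk => crossingAt P uk.1 uk.2
  joints := J
  strands := fun n =>
    ((onStrand P n).insertionSort (fun p p' => p.i ≤ p'.i)).map (Point.passage n)

/-- The points form the array of a link with the crossings `w + 1, …, w + r`. -/
structure ValidPoints (w r : ℕ) (P : List Point) : Prop where
  labels : ∀ k o, (P.map Point.e).count (.self k o) = if w < k ∧ k ≤ w + r then 1 else 0
  indices : ∀ n, ((onStrand P n).map Point.i).Nodup
  orientations : ∀ p ∈ P, p.e.Admits p.q

theorem find?_perm {α : Type*} {p : α → Bool} {l l' : List α} (h : l.Perm l')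
    (hc : l.countP p ≤ 1) : l.find? p = l'.find? p := by
  rw [← List.head?_filter, ← List.head?_filter]
  have h1 := h.filter p
  rw [List.countP_eq_length_filter] at hc
  generalize l.filter p = m at h1 hc
  rcases m with _ | ⟨x, _ | ⟨y, m⟩⟩
  · rw [h1.nil_eq]
  · rw [List.singleton_perm.1 h1]
  · simp at hc

theorem insertionSort_perm {α : Type*} {f : α → ℕ} {l l' : List α} (h : l.Perm l')
    (hf : (l.map f).Nodup) : l.insertionSort (fun x y => f x ≤ f y) =
      l'.insertionSort (fun x y => f x ≤ f y) := by
  have : Std.Total fun x y : α => f x ≤ f y := ⟨fun x y => le_total _ _⟩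
  have : IsTrans α fun x y : α => f x ≤ f y := ⟨fun x y z => le_trans⟩
  have h1 : (l.insertionSort (fun x y => f x ≤ f y)).Perm
      (l'.insertionSort (fun x y => f x ≤ f y)) :=
    (List.perm_insertionSort _ _).trans (h.trans (List.perm_insertionSort _ _).symm)
  refine h1.eq_of_pairwise ?_ (List.pairwise_insertionSort _ _) (List.pairwise_insertionSort _ _)
  intro x y hx hy hxy hyx
  exact List.inj_on_of_nodup_map hf ((List.mem_insertionSort _).1 hx)
    (h.mem_iff.2 ((List.mem_insertionSort _).1 hy)) (le_antisymm hxy hyx)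

theorem pointDiagram_perm {w r : ℕ} {U : List ℤ} {P P' : List Point} (J : List (Arc × Arc))
    (hv : ValidPoints w r P) (h : P.Perm P') : pointDiagram w U P J = pointDiagram w U P' J := by
  have h1 : ∀ k o, P.find? (fun p => p.e = .self k o) = P'.find? (fun p => p.e = .self k o) := by
    intro k o
    refine find?_perm h ?_
    have := hv.labels k o
    rw [List.count, List.countP_map] at this
    have h2 : P.countP (fun p => decide (p.e = .self k o)) =
        P.countP ((fun x => x == Entry.self k o) ∘ Point.e) :=
      List.countP_congr fun p _ => by simp
    rw [h2, this]
    split_ifs <;> simp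
  have h2 : ∀ n, (onStrand P n).insertionSort (fun p p' => p.i ≤ p'.i) =
      (onStrand P' n).insertionSort (fun p p' => p.i ≤ p'.i) := fun n =>
    insertionSort_perm (h.filter _) (hv.indices n)
  unfold pointDiagram crossingAt
  simp only [h1, h2]

theorem mkSigned_map (f : Arc → Arc) (u : ℤ) (p q : Point) :
    mkSigned u (p.map f) (q.map f) = (mkSigned u p q).map f := by
  unfold mkSigned
  split_ifs <;> rfl

theorem crossingAt_map (f : Arc → Arc) (P : List Point) (u : ℤ) (k : ℕ) :
    crossingAt (P.map (Point.map f)) u k = (crossingAt P u k).map (Crossing.map f) := by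
  unfold crossingAt
  rw [List.find?_map, List.find?_map]
  have h : ∀ o, (fun p : Point => decide (p.e = .self k o)) ∘ Point.map f =
      fun p => decide (p.e = .self k o) := fun o => rfl
  rw [h, h]
  generalize P.find? (fun p => decide (p.e = .self k false)) = x
  generalize P.find? (fun p => decide (p.e = .self k true)) = y
  rcases x with _ | x <;> rcases y with _ | y <;> simp [crossingOf, mkSigned_map]

theorem onStrand_map (f : Arc → Arc) (P : List Point) (n : Fin 2) :
    onStrand (P.map (Point.map f)) n = (onStrand P n).map (Point.map f) := by
  unfold onStrand
  rw [List.filter_map]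
  rfl

theorem Point.passage_map (f : Arc → Arc) (n : Fin 2) (p : Point) :
    (p.map f).passage n = (p.passage n).map f := by
  unfold Point.passage Point.map
  dsimp only
  split_ifs <;> rfl

theorem pointDiagram_map (f : Arc → Arc) (w : ℕ) (U : List ℤ) (P : List Point)
    (J : List (Arc × Arc)) :
    pointDiagram w U (P.map (Point.map f)) (J.map (Prod.map f f)) =
      (pointDiagram w U P J).map f := by
  unfold pointDiagram Diagram.map
  congr 1
  · simp only [crossingAt_map, List.map_flatMap]
  · funext n
    rw [onStrand_map, ← List.map_insertionSort (fun p p' => p.i ≤ p'.i) (fun p p' => p.i ≤ p'.i)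
      (Point.map f) _ (fun _ _ _ _ => Iff.rfl), List.map_map, List.map_map]
    refine List.map_congr_left fun p _ => ?_
    exact Point.passage_map f n p

theorem ValidPoints.congr {w r : ℕ} {P P' : List Point} (h : ValidPoints w r P)
    (hp : (P.map fun p => (p.e, p.i)).Perm (P'.map fun p => (p.e, p.i)))
    (ho : ∀ p ∈ P', p.e.Admits p.q) : ValidPoints w r P' where
  labels k o := by
    have := hp.map Prod.fst
    rw [List.map_map, List.map_map] at this
    rw [← h.labels k o]
    exact (this.count_eq _).symm
  indices n := by
    have key : ∀ P : List Point, (onStrand P n).map Point.i =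
        (((P.map fun p => (p.e, p.i)).filter fun x =>
          decide (x.1 = .strand n true ∨ x.1 = .strand n false)).map Prod.snd) := by
      intro P
      rw [List.filter_map, List.map_map]
      rfl
    rw [key]
    have := h.indices n
    rw [key] at this
    exact ((hp.filter _).map _).nodup_iff.1 this
  orientations := ho

theorem ValidPoints.map {w r : ℕ} {P : List Point} (h : ValidPoints w r P) (f : Arc → Arc) :
    ValidPoints w r (P.map (Point.map f)) := by
  refine h.congr ?_ ?_
  · rw [List.map_map]
    exact .refl _
  · intro p hp
    obtain ⟨p, hp', rfl⟩ := List.mem_map.1 hp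
    exact h.orientations p hp'

theorem ValidPoints.perm {w r : ℕ} {P P' : List Point} (h : ValidPoints w r P) (hp : P.Perm P') :
    ValidPoints w r P' :=
  h.congr (hp.map _) fun p h' => h.orientations p (hp.mem_iff.2 h')

theorem Entry.Admits.turnQ {e : Entry} {q : ℕ} (h : e.Admits q) : e.Admits (e.turnQ q) := by
  rcases e with ⟨n, o⟩ | ⟨k, o⟩
  · simp only [Entry.Admits, Entry.turnQ] at h ⊢
    split_ifs <;> simp
  · exact h

theorem ValidPoints.append_rev {w r : ℕ} {P P' : List Point} (h : ValidPoints w r (P ++ P')) :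
    ValidPoints w r (P ++ P'.map Point.rev) := by
  refine h.congr ?_ ?_
  · rw [List.map_append, List.map_append, List.map_map]
    exact .refl _
  · intro p hp
    rcases List.mem_append.1 hp with hp | hp
    · exact h.orientations p (List.mem_append_left _ hp)
    · obtain ⟨p, hp', rfl⟩ := List.mem_map.1 hp
      exact (h.orientations p (List.mem_append_right _ hp')).turnQ

theorem ValidPoints.remove {w r : ℕ} {p q : Point} {P : List Point} {o : Bool}
    (h : ValidPoints w (r + 1) (p :: q :: P)) (hp : p.e = .self (w + 1) o)
    (hq : q.e = .self (w + 1) (!o)) : ValidPoints (w + 1) r P where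
  labels k o' := by
    have := h.labels k o'
    simp only [List.map_cons, List.count_cons, hp, hq, beq_iff_eq, Entry.self.injEq] at this
    cases o <;> cases o' <;> simp at this <;> split_ifs at this ⊢ <;> omega
  indices n := by
    have := h.indices n
    unfold onStrand at this ⊢
    rwa [List.filter_cons_of_neg (by simp [hp]), List.filter_cons_of_neg (by simp [hq])] at this
  orientations p' hp' := h.orientations p' (by simp [hp'])

/-! ### The components of a link as closed paths -/

/-- The points lead along the link from arc `a` to arc `b`. -/
def IsPath : Arc → List Point → Arc → Prop
  | a, [], b => a = b
  | a, p :: ps, b => p.inn = a ∧ IsPath p.out ps b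

theorem isPath_append {a b : Arc} {ps qs : List Point} :
    IsPath a (ps ++ qs) b ↔ ∃ c, IsPath a ps c ∧ IsPath c qs b := by
  induction ps generalizing a with
  | nil => simp [IsPath]
  | cons p ps ih =>
    simp only [List.cons_append, IsPath, ih]
    constructor
    · rintro ⟨h, c, h1, h2⟩
      exact ⟨c, ⟨h, h1⟩, h2⟩
    · rintro ⟨c, ⟨h, h1⟩, h2⟩
      exact ⟨h, c, h1, h2⟩

theorem IsPath.map {a b : Arc} {ps : List Point} (h : IsPath a ps b) (f : Arc → Arc) :
    IsPath (f a) (ps.map (Point.map f)) (f b) := by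
  induction ps generalizing a with
  | nil => exact congrArg f h
  | cons p ps ih => exact ⟨congrArg f h.1, ih h.2⟩

theorem IsPath.reverse {a b : Arc} {ps : List Point} (h : IsPath a ps b) :
    IsPath b (ps.reverse.map Point.rev) a := by
  induction ps generalizing a with
  | nil => exact Eq.symm h
  | cons p ps ih =>
    rw [List.reverse_cons, List.map_append, isPath_append]
    exact ⟨p.out, ih h.2, rfl, h.1⟩

theorem IsPath.outs_eq {a b : Arc} {ps : List Point} (h : IsPath a ps b) :
    a :: ps.map Point.out = ps.map Point.inn ++ [b] := by
  induction ps generalizing a with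
  | nil => simp only [IsPath] at h; simp [h]
  | cons p ps ih => simp [ih h.2, h.1]

theorem IsPath.mem_outs {a b : Arc} {ps : List Point} (h : IsPath a ps b) :
    (ps = [] ∧ a = b) ∨ b ∈ ps.map Point.out := by
  rcases ps with _ | ⟨p, ps⟩
  · exact .inl ⟨rfl, h⟩
  · have h' := congrArg List.tail h.outs_eq
    simp only [List.tail_cons, List.map_cons, List.cons_append] at h'
    refine .inr ?_
    rw [List.map_cons, h']
    simp

/-- A component of a link: an arc and the points met from there until one is back. -/
abbrev Loop : Type := Arc × List Point

/-- The arcs of a component. -/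
def Loop.arcs : Loop → List Arc
  | (a, []) => [a]
  | (_, p :: ps) => (p :: ps).map Point.out

/-- The joint of a component without points. -/
def Loop.joints : Loop → List (Arc × Arc)
  | (a, []) => [(a, a)]
  | (_, _ :: _) => []

def Loop.map (f : Arc → Arc) (c : Loop) : Loop := (f c.1, c.2.map (Point.map f))

/-- All the points of the components. -/
def loopPoints (L : List Loop) : List Point := L.flatMap Prod.snd

/-- The joints of the components without points. -/
def loopJoints (L : List Loop) : List (Arc × Arc) := L.flatMap Loop.joints

/-- The components `L` of a link are recorded by the term `Z`. -/
structure Traces (Z : Term) (L : List Loop) : Prop where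
  E : Z.E = L.map fun c => c.2.map Point.e
  I : Z.I = L.map fun c => c.2.map Point.i
  Q : Z.Q = L.map fun c => c.2.map Point.q
  closed : ∀ c ∈ L, IsPath c.1 c.2 c.1
  nodup : (L.flatMap Loop.arcs).Nodup

/-- The components described by a term. -/
def Term.loops (Z : Term) : List Loop :=
  Z.E.zipIdx.map fun cl => ((cl.2, cl.1.length - 1), cl.1.zipIdx.map fun ej =>
    { e := ej.1
      i := (Z.I.getD cl.2 []).getD ej.2 0
      q := (Z.Q.getD cl.2 []).getD ej.2 0
      inn := (cl.2, (ej.2 + cl.1.length - 1) % cl.1.length)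
      out := (cl.2, ej.2) })

theorem Term.points_eq (Z : Term) : Z.points = loopPoints Z.loops := by
  unfold Term.points loopPoints Term.loops
  rw [List.flatMap_map]

theorem Term.diagram_eq (Z : Term) (w : ℕ) :
    Z.diagram w = pointDiagram w Z.U (loopPoints Z.loops) (loopJoints Z.loops) := by
  rw [← Term.points_eq]
  have : loopJoints Z.loops =
      Z.E.zipIdx.flatMap fun cl => if cl.1 = [] then [((cl.2, 0), (cl.2, 0))] else [] := by
    unfold loopJoints Term.loops
    rw [List.flatMap_map]
    congr 1
    funext ⟨c, l⟩
    rcases c with _ | ⟨x, c⟩ <;> rfl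
  rw [this]
  rfl

theorem Term.traces_loops {Z : Term} (hI : Z.I.map List.length = Z.E.map List.length)
    (hQ : Z.Q.map List.length = Z.E.map List.length) : Traces Z Z.loops where
  E := by
    unfold Term.loops
    rw [List.map_map]
    refine List.ext_getElem (by simp) fun l h1 h2 => List.ext_getElem (by simp) fun j h3 h4 => ?_
    simp
  I := by
    unfold Term.loops
    rw [List.map_map]
    have hl : Z.I.length = Z.E.length := by simpa using congrArg List.length hI
    refine List.ext_getElem (by simpa using hl) fun l h1 h2 => ?_
    have h2' : l < Z.E.length := by simpa using h2
    have hlen : Z.I[l].length = Z.E[l].length := by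
      have : (Z.I.map List.length)[l]'(by simpa using h1) =
          (Z.E.map List.length)[l]'(by simpa using h2') := by simp only [hI]
      simpa using this
    refine List.ext_getElem (by simpa using hlen) fun j h3 h4 => ?_
    simp [List.getD_eq_getElem?_getD, h1, h3]
  Q := by
    unfold Term.loops
    rw [List.map_map]
    have hl : Z.Q.length = Z.E.length := by simpa using congrArg List.length hQ
    refine List.ext_getElem (by simpa using hl) fun l h1 h2 => ?_
    have h2' : l < Z.E.length := by simpa using h2
    have hlen : Z.Q[l].length = Z.E[l].length := by
      have : (Z.Q.map List.length)[l]'(by simpa using h1) =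
          (Z.E.map List.length)[l]'(by simpa using h2') := by simp only [hQ]
      simpa using this
    refine List.ext_getElem (by simpa using hlen) fun j h3 h4 => ?_
    simp [List.getD_eq_getElem?_getD, h1, h3]
  closed := by
    intro c hc
    obtain ⟨⟨x, l⟩, -, rfl⟩ := List.mem_map.1 hc
    dsimp only
    have key : ∀ (y : List Entry) (o : ℕ), o + y.length = x.length →
        IsPath (l, (o + x.length - 1) % x.length) ((y.zipIdx o).map fun ej =>
          { e := ej.1
            i := (Z.I.getD l []).getD ej.2 0
            q := (Z.Q.getD l []).getD ej.2 0
            inn := (l, (ej.2 + x.length - 1) % x.length)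
            out := (l, ej.2) }) (l, x.length - 1) := by
      intro y
      induction y with
      | nil =>
        intro o ho
        simp only [List.length_nil, Nat.add_zero] at ho
        simp only [List.zipIdx_nil, List.map_nil, IsPath, Prod.mk.injEq, true_and]
        rcases Nat.eq_zero_or_pos x.length with h | h
        · simp [ho, h]
        · rw [ho, show x.length + x.length - 1 = (x.length - 1) + x.length by omega,
            Nat.add_mod_right, Nat.mod_eq_of_lt (by omega)]
      | cons e y ih =>
        intro o ho
        rw [List.length_cons] at ho
        rw [List.zipIdx_cons, List.map_cons]
        refine ⟨rfl, ?_⟩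
        have := ih (o + 1) (by omega)
        rwa [show o + 1 + x.length - 1 = o + x.length by omega, Nat.add_mod_right,
          Nat.mod_eq_of_lt (by omega)] at this
    have := key x 0 (by simp)
    rcases Nat.eq_zero_or_pos x.length with h | h
    · have hx := List.eq_nil_of_length_eq_zero h
      subst hx
      rfl
    · rwa [Nat.zero_add, Nat.mod_eq_of_lt (by omega)] at this
  nodup := by
    have harcs : ∀ (x : List Entry) (l : ℕ), ∃ m, Loop.arcs ((l, x.length - 1),
        x.zipIdx.map fun ej =>
          { e := ej.1
            i := (Z.I.getD l []).getD ej.2 0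
            q := (Z.Q.getD l []).getD ej.2 0
            inn := (l, (ej.2 + x.length - 1) % x.length)
            out := (l, ej.2) }) = (List.range m).map fun j => (l, j) := by
      intro x l
      rcases x with _ | ⟨e, x⟩
      · exact ⟨1, rfl⟩
      · refine ⟨x.length + 1, ?_⟩
        rw [List.zipIdx_cons, List.map_cons, Loop.arcs,
          ← List.map_cons (f := fun ej : Entry × ℕ => Point.mk ej.1 ((Z.I.getD l []).getD ej.2 0)
            ((Z.Q.getD l []).getD ej.2 0) (l, (ej.2 + (e :: x).length - 1) % (e :: x).length)
            (l, ej.2)), ← List.zipIdx_cons,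
          List.map_map, List.range_eq_range', ← List.length_cons, ← List.zipIdx_map_snd,
          List.map_map]
        rfl
    unfold Term.loops
    rw [List.flatMap_map, List.nodup_flatMap]
    constructor
    · rintro ⟨x, l⟩ -
      obtain ⟨m, hm⟩ := harcs x l
      rw [hm]
      exact List.nodup_range.map fun _ _ h => (Prod.mk.inj h).2
    · have hsnd : (Z.E.zipIdx.map Prod.snd).Nodup := by
        rw [List.zipIdx_map_snd]
        exact List.nodup_range'
      refine (List.pairwise_map.1 hsnd).imp ?_
      rintro ⟨x, l⟩ ⟨x', l'⟩ hne a ha ha'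
      obtain ⟨m, hm⟩ := harcs x l
      obtain ⟨m', hm'⟩ := harcs x' l'
      dsimp only at ha ha' hne
      rw [hm] at ha
      rw [hm'] at ha'
      simp only [List.mem_map] at ha ha'
      obtain ⟨_, _, rfl⟩ := ha
      obtain ⟨_, _, h⟩ := ha'
      exact hne (Prod.mk.inj h).1.symm

theorem exists_perm_map_eq {α : Type*} {A A' : List α} (hA : A.Nodup) (hA' : A'.Nodup)
    (hl : A.length = A'.length) : ∃ g : Equiv.Perm α, A.map g = A' := by
  classical
  induction A generalizing A' with
  | nil =>
    rw [List.length_nil] at hl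
    exact ⟨1, (List.eq_nil_of_length_eq_zero hl.symm).symm⟩
  | cons a A ih =>
    rcases A' with _ | ⟨a', A'⟩
    · simp at hl
    · rw [List.nodup_cons] at hA hA'
      obtain ⟨g, hg⟩ := ih hA.2 hA'.2 (by simpa using hl)
      refine ⟨g.trans (Equiv.swap (g a) a'), ?_⟩
      rw [List.map_cons, ← hg]
      simp only [Equiv.trans_apply, Equiv.swap_apply_left, List.cons.injEq, true_and]
      refine List.map_congr_left fun x hx => Equiv.swap_apply_of_ne_of_ne ?_ ?_
      · intro h
        exact hA.1 (g.injective h ▸ hx)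
      · rintro rfl
        exact hA'.1 (hg ▸ List.mem_map_of_mem hx)

theorem IsPath.eq_map {g : Arc → Arc} {a b b' : Arc} {ps ps' : List Point} (h : IsPath a ps b)
    (h' : IsPath (g a) ps' b') (he : ps.map Point.e = ps'.map Point.e)
    (hi : ps.map Point.i = ps'.map Point.i) (hq : ps.map Point.q = ps'.map Point.q)
    (ho : (ps.map Point.out).map g = ps'.map Point.out) : ps' = ps.map (Point.map g) := by
  induction ps generalizing a ps' with
  | nil => simpa using he.symm
  | cons p ps ih =>
    rcases ps' with _ | ⟨p', ps'⟩
    · simp at he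
    · simp only [List.map_cons, List.cons.injEq] at he hi hq ho ⊢
      obtain ⟨h1, h2⟩ := h
      obtain ⟨h1', h2'⟩ := h'
      refine ⟨?_, ih h2 (by rw [ho.1]; exact h2') he.2 hi.2 hq.2 ho.2⟩
      rcases p with ⟨e, i, q, x, y⟩
      rcases p' with ⟨e', i', q', x', y'⟩
      simp only at he hi hq ho h1 h1'
      simp [Point.map, he.1, hi.1, hq.1, ho.1, h1, h1']

theorem Loop.eq_map {g : Arc → Arc} {c c' : Loop} (h : IsPath c.1 c.2 c.1)
    (h' : IsPath c'.1 c'.2 c'.1) (he : c.2.map Point.e = c'.2.map Point.e)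
    (hi : c.2.map Point.i = c'.2.map Point.i) (hq : c.2.map Point.q = c'.2.map Point.q)
    (ho : c.arcs.map g = c'.arcs) : c' = c.map g := by
  rcases c with ⟨a, _ | ⟨p, ps⟩⟩ <;> rcases c' with ⟨a', _ | ⟨p', ps'⟩⟩
  · simp only [Loop.arcs, List.map_cons, List.map_nil, List.cons.injEq, and_true] at ho
    simp [Loop.map, ho]
  · simp at he
  · simp at he
  · dsimp only at h h' he hi hq
    have ha : a' = g a := by
      have h1 := congrArg List.getLast? h.outs_eq
      have h2 := congrArg List.getLast? h'.outs_eq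
      have h3 := congrArg List.getLast? ho
      simp only [Loop.arcs] at h3
      simp only [List.getLast?_cons_cons, List.map_cons, List.getLast?_append_of_ne_nil,
        ne_eq, List.cons_ne_nil, not_false_eq_true, List.getLast?_singleton] at h1 h2 h3
      rw [← List.map_cons, List.getLast?_map, h1, h2] at h3
      exact (Option.some.inj h3).symm
    subst ha
    simp only [Loop.map, Prod.mk.injEq, true_and]
    exact IsPath.eq_map h h' he hi hq ho

theorem Loop.length_arcs (c : Loop) : c.arcs.length = max 1 (c.2.map Point.e).length := by
  rcases c with ⟨a, _ | ⟨p, ps⟩⟩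
  · rfl
  · simp [Loop.arcs]

theorem eq_map_of_closed {g : Arc → Arc} {L L' : List Loop}
    (hE : L.map (fun c => c.2.map Point.e) = L'.map fun c => c.2.map Point.e)
    (hI : L.map (fun c => c.2.map Point.i) = L'.map fun c => c.2.map Point.i)
    (hQ : L.map (fun c => c.2.map Point.q) = L'.map fun c => c.2.map Point.q)
    (hc : ∀ c ∈ L, IsPath c.1 c.2 c.1) (hc' : ∀ c ∈ L', IsPath c.1 c.2 c.1)
    (ho : (L.flatMap Loop.arcs).map g = L'.flatMap Loop.arcs) : L' = L.map (Loop.map g) := by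
  induction L generalizing L' with
  | nil => simpa using hE.symm
  | cons c L ih =>
    rcases L' with _ | ⟨c', L'⟩
    · simp at hE
    · simp only [List.map_cons, List.cons.injEq, List.flatMap_cons, List.map_append] at *
      have hlen : (c.arcs.map g).length = c'.arcs.length := by
        rw [List.length_map, Loop.length_arcs, Loop.length_arcs, hE.1]
      obtain ⟨h1, h2⟩ := List.append_inj ho hlen
      exact ⟨Loop.eq_map (hc c (by simp)) (hc' c' (by simp)) hE.1 hI.1 hQ.1 h1,
        ih hE.2 hI.2 hQ.2 (fun d hd => hc d (by simp [hd])) (fun d hd => hc' d (by simp [hd])) h2⟩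

theorem Traces.eq_map {Z : Term} {L L' : List Loop} (h : Traces Z L) (h' : Traces Z L') :
    ∃ g : Equiv.Perm Arc, L' = L.map (Loop.map g) := by
  have hE := h.E.symm.trans h'.E
  have hlen : (L.flatMap Loop.arcs).length = (L'.flatMap Loop.arcs).length := by
    have key : ∀ L : List Loop, L.map (fun c => c.arcs.length) =
        (L.map fun c => c.2.map Point.e).map fun x => max 1 x.length := by
      intro L
      rw [List.map_map]
      exact List.map_congr_left fun c _ => Loop.length_arcs c
    rw [List.length_flatMap, List.length_flatMap, key, key, hE]
  obtain ⟨g, hg⟩ := exists_perm_map_eq h.nodup h'.nodup hlen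
  exact ⟨g, eq_map_of_closed hE (h.I.symm.trans h'.I) (h.Q.symm.trans h'.Q) h.closed h'.closed hg⟩

theorem loopPoints_map (f : Arc → Arc) (L : List Loop) :
    loopPoints (L.map (Loop.map f)) = (loopPoints L).map (Point.map f) := by
  unfold loopPoints
  rw [List.flatMap_map, List.map_flatMap]
  rfl

theorem loopJoints_map (f : Arc → Arc) (L : List Loop) :
    loopJoints (L.map (Loop.map f)) = (loopJoints L).map (Prod.map f f) := by
  unfold loopJoints
  rw [List.flatMap_map, List.map_flatMap]
  congr 1
  funext ⟨a, ps⟩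
  rcases ps with _ | ⟨p, ps⟩ <;> rfl

theorem Traces.dims {Z : Term} {L : List Loop} (h : Traces Z L) :
    Z.I.map List.length = Z.E.map List.length ∧ Z.Q.map List.length = Z.E.map List.length := by
  rw [h.E, h.I, h.Q]
  simp [Function.comp_def]

theorem Traces.orderedIsotopic {Z : Term} {L : List Loop} (h : Traces Z L) (w : ℕ) :
    OrderedIsotopic (pointDiagram w Z.U (loopPoints L) (loopJoints L)) (Z.diagram w) := by
  obtain ⟨g, hg⟩ := h.eq_map (Term.traces_loops h.dims.1 h.dims.2)
  rw [Term.diagram_eq, hg, loopPoints_map, loopJoints_map, pointDiagram_map]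
  exact .single (.rename g _)

theorem Traces.isSkeinArray {Z : Term} {L : List Loop} {w : ℕ} (h : Traces Z L)
    (hv : ValidPoints w Z.U.length (loopPoints L)) (hs : ∀ u ∈ Z.U, u = 1 ∨ u = -1)
    (hl : (Z.diagram w).IsLink) : Z.IsSkeinArray w := by
  obtain ⟨g, hg⟩ := h.eq_map (Term.traces_loops h.dims.1 h.dims.2)
  have hv' : ValidPoints w Z.U.length Z.points := by
    rw [Term.points_eq, hg, loopPoints_map]
    exact hv.map g
  refine ⟨h.dims.1, h.dims.2, fun k o => ?_, hs, hv'.indices, hv'.orientations, hl⟩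
  rw [← hv.labels k o, h.E, loopPoints, List.map_flatMap, List.flatMap_def]

theorem Term.IsSkeinArray.validPoints {Z : Term} {w : ℕ} (h : Z.IsSkeinArray w) :
    ValidPoints w Z.U.length (loopPoints Z.loops) where
  labels k o := by
    rw [← h.labels k o, (Term.traces_loops h.dimI h.dimQ).E, loopPoints, List.map_flatMap,
      List.flatMap_def]
  indices := by
    rw [← Term.points_eq]
    exact h.indices
  orientations := by
    rw [← Term.points_eq]
    exact h.orientations

/-! ### Contraction of two joints -/

/-- Renaming of arc `b` to `a`. -/
def merge (a b x : Arc) : Arc := if x = b then a else x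

/-- The renaming that identifies `a` with `b` and then `c` with `d`. -/
def mergeTwo (a b c d x : Arc) : Arc := merge (merge a b c) (merge a b d) (merge a b x)

theorem mergeTwo_left (a b c d : Arc) : mergeTwo a b c d a = mergeTwo a b c d b := by
  unfold mergeTwo
  congr 1
  simp [merge]

theorem mergeTwo_right (a b c d : Arc) : mergeTwo a b c d c = mergeTwo a b c d d := by
  unfold mergeTwo
  generalize merge a b c = c'
  generalize merge a b d = d'
  simp [merge]

theorem mergeTwo_eq_self {a b c d x : Arc} (h : a = b ∨ x ≠ b)
    (h' : merge a b c = merge a b d ∨ x ≠ merge a b d) : mergeTwo a b c d x = x := by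
  have h1 : merge a b x = x := by
    unfold merge
    split_ifs with hx
    · rcases h with h | h
      · exact h.trans hx.symm
      · exact absurd hx h
    · rfl
  rw [mergeTwo, h1]
  rcases h' with h' | h'
  · rw [h', merge]
    split_ifs with hx
    · exact hx.symm
    · rfl
  · rw [merge, if_neg h']

theorem Diagram.map_id (D : Diagram) : D.map id = D := by
  rcases D with ⟨cs, js, s⟩
  simp only [Diagram.map, Diagram.mk.injEq]
  refine ⟨?_, ?_, ?_⟩
  · exact (List.map_congr_left fun _ _ => rfl).trans (List.map_id _)
  · exact (List.map_congr_left fun _ _ => rfl).trans (List.map_id _)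
  · funext n
    exact (List.map_congr_left fun _ _ => rfl).trans (List.map_id _)

theorem Diagram.map_map (f g : Arc → Arc) (D : Diagram) : (D.map f).map g = D.map (g ∘ f) := by
  simp only [Diagram.map, List.map_map]
  rfl

theorem orderedIsotopic_merge (a b : Arc) (cs : List Crossing) (js : List (Arc × Arc))
    (s : Fin 2 → List Passage) : OrderedIsotopic ⟨cs, (a, b) :: js, s⟩
      ((⟨cs, (if a = b then [(a, b)] else []) ++ js, s⟩ : Diagram).map (merge a b)) := by
  by_cases h : a = b
  · subst h
    have : merge a a = id := by
      funext x
      simp only [merge, id]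
      split_ifs with h
      · exact h.symm
      · rfl
    rw [if_pos rfl, this, Diagram.map_id]
    exact .refl
  · rw [if_neg h]
    exact .single (.splice a b cs js s h)

theorem orderedIsotopic_mergeTwo (a b c d : Arc) (cs : List Crossing) (js : List (Arc × Arc))
    (s : Fin 2 → List Passage) : OrderedIsotopic ⟨cs, (a, b) :: (c, d) :: js, s⟩
      ((⟨cs, (if a = b then [(a, b)] else []) ++
        ((if merge a b c = merge a b d then [(c, d)] else []) ++ js), s⟩ : Diagram).map
          (mergeTwo a b c d)) := by
  refine (orderedIsotopic_merge a b cs ((c, d) :: js) s).trans ?_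
  refine .head (.perm _ _ (List.perm_middle.map _)) ?_
  rw [List.map_cons]
  refine (orderedIsotopic_merge (merge a b c) (merge a b d) _ _ _).trans ?_
  have : mergeTwo a b c d = merge (merge a b c) (merge a b d) ∘ merge a b := rfl
  rw [this, ← Diagram.map_map]
  refine .single (.perm _ _ (.map _ ?_))
  have : (if merge a b c = merge a b d then [(merge a b c, merge a b d)] else []) =
      (if merge a b c = merge a b d then [(c, d)] else []).map
        (Prod.map (merge a b) (merge a b)) := by
    split_ifs <;> rfl
  rw [this, ← List.map_append]
  exact (List.perm_append_comm_assoc _ _ _).map _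

/-! ### Smoothing of the first crossing -/

theorem find?_eq_none_of_count {P : List Point} {e : Entry} (h : (P.map Point.e).count e = 0) :
    P.find? (fun p => p.e = e) = none := by
  rw [List.count_eq_zero] at h
  rw [List.find?_eq_none]
  intro p hp
  simp only [decide_eq_true_eq]
  rintro rfl
  exact h (List.mem_map_of_mem hp)

theorem find?_eq_some_of_count {P : List Point} {e : Entry} (h : (P.map Point.e).count e ≠ 0) :
    ∃ x, P.find? (fun p => p.e = e) = some x := by
  rcases hx : P.find? (fun p => p.e = e) with _ | x
  · exfalso
    apply h
    rw [List.find?_eq_none] at hx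
    rw [List.count_eq_zero]
    intro hm
    obtain ⟨p, hp, rfl⟩ := List.mem_map.1 hm
    simpa using hx p hp
  · exact ⟨x, hx⟩

theorem ValidPoints.length_crossings {w : ℕ} {U : List ℤ} {P : List Point}
    (h : ValidPoints w U.length P) (J : List (Arc × Arc)) :
    (pointDiagram w U P J).crossings.length = U.length := by
  have h1 : ∀ uk ∈ U.zipIdx (w + 1), (crossingAt P uk.1 uk.2).length = 1 := by
    rintro ⟨u, k⟩ hk
    have hk' := List.le_snd_of_mem_zipIdx hk
    have hk'' := List.snd_lt_add_of_mem_zipIdx hk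
    dsimp only at hk' hk''
    have hc : ∀ o, ∃ x, P.find? (fun p => p.e = .self k o) = some x := fun o =>
      find?_eq_some_of_count (by rw [h.labels, if_pos (by omega)]; simp)
    obtain ⟨x, hx⟩ := hc false
    obtain ⟨y, hy⟩ := hc true
    simp [crossingAt, hx, hy, crossingOf]
  unfold pointDiagram
  rw [List.length_flatMap, List.map_congr_left h1]
  simp

theorem pointDiagram_cons {w : ℕ} {u : ℤ} {us : List ℤ} {p q : Point} {P : List Point} {o : Bool}
    (hp : p.e = .self (w + 1) o) (hq : q.e = .self (w + 1) (!o)) (J : List (Arc × Arc)) :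
    pointDiagram w (u :: us) (p :: q :: P) J =
      ⟨(if o then mkSigned u q p else mkSigned u p q) :: (pointDiagram (w + 1) us P J).crossings, J,
        (pointDiagram (w + 1) us P J).strands⟩ := by
  unfold pointDiagram
  rw [List.zipIdx_cons, List.flatMap_cons]
  have h1 : crossingAt (p :: q :: P) u (w + 1) =
      [if o then mkSigned u q p else mkSigned u p q] := by
    cases o <;> simp [crossingAt, hp, hq, crossingOf]
  have h2 : ∀ uk ∈ us.zipIdx (w + 1 + 1), crossingAt (p :: q :: P) uk.1 uk.2 =
      crossingAt P uk.1 uk.2 := by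
    rintro ⟨v, k⟩ hk
    have hk' := List.le_snd_of_mem_zipIdx hk
    have hne : w + 1 ≠ k := by
      dsimp only at hk'
      omega
    simp [crossingAt, hp, hq, hne]
  have h3 : ∀ n, onStrand (p :: q :: P) n = onStrand P n := by
    intro n
    unfold onStrand
    rw [List.filter_cons_of_neg (by simp [hp]), List.filter_cons_of_neg (by simp [hq])]
  simp only [h1, h3, List.flatMap_congr h2, List.singleton_append]

section Joints

variable (cs : List Crossing) (s : Fin 2 → List Passage)

theorem orderedIsotopic_swap_snd (j : Arc × Arc) (c d : Arc) (J : List (Arc × Arc)) :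
    OrderedIsotopic ⟨cs, j :: (c, d) :: J, s⟩ ⟨cs, j :: (d, c) :: J, s⟩ :=
  .head (.perm _ _ (.swap _ _ _)) (.head (.swap _ _ _ _ _) (.single (.perm _ _ (.swap _ _ _))))

theorem orderedIsotopic_smoothing_oriented {u : ℤ} (hu : u = 1 ∨ u = -1) (p q : Point) (o : Bool)
    (J : List (Arc × Arc)) : OrderedIsotopic
      ⟨cs, (if o then mkSigned u q p else mkSigned u p q).smoothing (decide (u = 1)) ++ J, s⟩
      ⟨cs, (q.inn, p.out) :: (p.inn, q.out) :: J, s⟩ := by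
  rcases hu with rfl | rfl <;> cases o
  · exact (orderedIsotopic_swap_snd _ _ _ _ _ _).tail (.perm _ _ (.swap _ _ _))
  · exact orderedIsotopic_swap_snd _ _ _ _ _ _
  · exact .single (.perm _ _ (.swap _ _ _))
  · exact .refl

theorem orderedIsotopic_smoothing_unoriented {u : ℤ} (hu : u = 1 ∨ u = -1) (p q : Point)
    (o : Bool) (J : List (Arc × Arc)) : OrderedIsotopic
      ⟨cs, (if o then mkSigned u q p else mkSigned u p q).smoothing (!decide (u = 1)) ++ J, s⟩
      ⟨cs, (p.inn, q.inn) :: (p.out, q.out) :: J, s⟩ := by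
  rcases hu with rfl | rfl <;> cases o
  · exact orderedIsotopic_swap_snd _ _ _ _ _ _
  · exact .single (.swap _ _ _ _ _)
  · exact .refl
  · exact .head (.swap _ _ _ _ _) (orderedIsotopic_swap_snd _ _ _ _ _ _)

end Joints

/-! ### Reversal of a section -/

/-- The signs of the crossings `k, k + 1, …` after the section with entries `R` has been
reversed. -/
def turnSigns (k : ℕ) (R : List Entry) (U : List ℤ) : List ℤ :=
  (U.zipIdx k).map fun uk =>
    if R.count (.self uk.2 true) + R.count (.self uk.2 false) = 1 then -uk.1 else uk.1

theorem length_turnSigns (k : ℕ) (R : List Entry) (U : List ℤ) :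
    (turnSigns k R U).length = U.length := by
  simp [turnSigns]

theorem turnSigns_nil (k : ℕ) (U : List ℤ) : turnSigns k [] U = U := by
  simp [turnSigns]

theorem turnSigns_signs {k : ℕ} {R : List Entry} {U : List ℤ} (h : ∀ u ∈ U, u = 1 ∨ u = -1) :
    ∀ u ∈ turnSigns k R U, u = 1 ∨ u = -1 := by
  intro v hv
  obtain ⟨⟨u, l⟩, hu, rfl⟩ := List.mem_map.1 hv
  have := h u (List.fst_mem_of_mem_zipIdx hu)
  dsimp only
  split_ifs <;> omega

theorem zipIdx_turnSigns (k : ℕ) (R : List Entry) (U : List ℤ) :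
    (turnSigns k R U).zipIdx k = (U.zipIdx k).map fun uk =>
      (if R.count (.self uk.2 true) + R.count (.self uk.2 false) = 1 then -uk.1 else uk.1,
        uk.2) := by
  unfold turnSigns
  induction U generalizing k with
  | nil => rfl
  | cons u U ih =>
    rw [List.zipIdx_cons, List.map_cons, List.zipIdx_cons, ih, List.map_cons]

theorem forall₂_flatMap {α β γ : Type*} {r : β → γ → Prop} {l : List α} {f : α → List β}
    {g : α → List γ} (h : ∀ x ∈ l, List.Forall₂ r (f x) (g x)) :
    List.Forall₂ r (l.flatMap f) (l.flatMap g) := by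
  induction l with
  | nil => exact .nil
  | cons x l ih =>
    rw [List.flatMap_cons, List.flatMap_cons]
    exact List.rel_append (h x (by simp)) (ih fun y hy => h y (by simp [hy]))

theorem Point.passage_rev {n : Fin 2} {p : Point} (h : p.e.Admits p.q)
    (hp : p.e = .strand n true ∨ p.e = .strand n false) : p.rev.passage n = p.passage n := by
  rcases p with ⟨e, i, q, x, y⟩
  have key : ∀ o, e = .strand n o → (Point.rev ⟨e, i, q, x, y⟩).passage n =
      (Point.mk e i q x y).passage n := by
    rintro o rfl
    simp only [Entry.Admits] at h
    rcases h with rfl | rfl <;> simp [Point.passage, Point.rev, Entry.turnQ]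
  rcases hp with h' | h'
  · exact key _ h'
  · exact key _ h'

theorem mkSigned_rev_lower {u : ℤ} (hu : u = 1 ∨ u = -1) (p q : Point) :
    mkSigned (-u) p.rev q = (mkSigned u p q).turn := by
  rcases hu with rfl | rfl <;> rfl

theorem mkSigned_rev_upper {u : ℤ} (hu : u = 1 ∨ u = -1) (p q : Point) :
    mkSigned (-u) p q.rev = mkSigned u p q := by
  rcases hu with rfl | rfl <;> rfl

theorem mkSigned_rev_rev {u : ℤ} (hu : u = 1 ∨ u = -1) (p q : Point) :
    mkSigned u p.rev q.rev = (mkSigned u p q).turn := by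
  rcases hu with rfl | rfl <;> rfl

theorem find?_map_rev (P : List Point) (e : Entry) :
    (P.map Point.rev).find? (fun p => p.e = e) = (P.find? fun p => p.e = e).map Point.rev := by
  rw [List.find?_map]
  rfl

theorem find?_cases {A B : List Point} {e : Entry}
    (h : ((A ++ B).map Point.e).count e = 1) :
    (∃ x, A.find? (fun p => p.e = e) = some x ∧ (B.map Point.e).count e = 0) ∨
      (A.find? (fun p => p.e = e) = none ∧ ∃ x, B.find? (fun p => p.e = e) = some x ∧
        (B.map Point.e).count e = 1) := by
  rw [List.map_append, List.count_append] at h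
  by_cases hA : (A.map Point.e).count e = 0
  · obtain ⟨x, hx⟩ := find?_eq_some_of_count (P := B) (e := e) (by omega)
    exact .inr ⟨find?_eq_none_of_count hA, x, hx, by omega⟩
  · obtain ⟨x, hx⟩ := find?_eq_some_of_count hA
    exact .inl ⟨x, hx, by omega⟩

theorem strands_rev {w w' r : ℕ} {U U' : List ℤ} {A B : List Point} {J J' : List (Arc × Arc)}
    (h : ValidPoints w r (A ++ B)) :
    (pointDiagram w' U' (A ++ B.map Point.rev) J').strands =
      (pointDiagram w' U (A ++ B) J).strands := by
  funext n
  have key : ∀ P : List Point, (P.insertionSort (fun p p' => p.i ≤ p'.i)).map (Point.passage n) =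
      ((P.map fun p => (p.i, p.passage n)).insertionSort (fun x y => x.1 ≤ y.1)).map Prod.snd := by
    intro P
    rw [← List.map_insertionSort (fun p p' : Point => p.i ≤ p'.i) (fun x y => x.1 ≤ y.1)
      (fun p : Point => (p.i, p.passage n)) P (fun _ _ _ _ => Iff.rfl), List.map_map]
    rfl
  have hrev : (onStrand (A ++ B.map Point.rev) n).map (fun p => (p.i, p.passage n)) =
      (onStrand (A ++ B) n).map fun p => (p.i, p.passage n) := by
    unfold onStrand
    rw [List.filter_append, List.filter_append, List.map_append, List.map_append, List.filter_map,
      List.map_map]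
    congr 1
    refine List.map_congr_left fun p hp => ?_
    obtain ⟨hp1, hp2⟩ := List.mem_filter.1 hp
    have := Point.passage_rev (n := n) (h.orientations p (List.mem_append_right _ hp1))
      (of_decide_eq_true (p := p.e = .strand n true ∨ p.e = .strand n false) hp2)
    simp only [Function.comp_apply, this]
    rfl
  unfold pointDiagram
  dsimp only
  rw [key, key, hrev]

theorem orderedIsotopic_rev {w : ℕ} {U : List ℤ} {A B : List Point} {R : List Entry}
    (h : ValidPoints w U.length (A ++ B)) (hU : ∀ u ∈ U, u = 1 ∨ u = -1)
    (hR : ∀ k o, w < k → R.count (.self k o) = (B.map Point.e).count (.self k o))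
    (J : List (Arc × Arc)) :
    OrderedIsotopic (pointDiagram w U (A ++ B) J)
      (pointDiagram w (turnSigns (w + 1) R U) (A ++ B.map Point.rev) J) := by
  have hs := strands_rev (w' := w) (U := U) (U' := turnSigns (w + 1) R U) (J := J) (J' := J) h
  have hc : List.Forall₂ (fun X Y => Y = X ∨ Y = X.turn) (pointDiagram w U (A ++ B) J).crossings
      (pointDiagram w (turnSigns (w + 1) R U) (A ++ B.map Point.rev) J).crossings := by
    unfold pointDiagram
    dsimp only
    rw [zipIdx_turnSigns, List.flatMap_map]
    refine forall₂_flatMap ?_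
    rintro ⟨u, k⟩ hk
    have hk' := List.le_snd_of_mem_zipIdx hk
    have hk'' := List.snd_lt_add_of_mem_zipIdx hk
    have hu := hU u (List.fst_mem_of_mem_zipIdx hk)
    dsimp only at hk' hk'' ⊢
    have hcount : ∀ o, ((A ++ B).map Point.e).count (.self k o) = 1 := fun o => by
      rw [h.labels, if_pos (by omega)]
    rw [hR k true (by omega), hR k false (by omega)]
    unfold crossingAt
    simp only [List.find?_append, find?_map_rev]
    rcases find?_cases (hcount false) with ⟨x, hx, hx'⟩ | ⟨hx, x, hx', hx''⟩ <;>
    rcases find?_cases (hcount true) with ⟨y, hy, hy'⟩ | ⟨hy, y, hy', hy''⟩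
    · simp [hx, hy, hx', hy', crossingOf]
    · simp [hx, hy, hx', hy', hy'', crossingOf, mkSigned_rev_upper hu]
    · simp [hx, hy, hx', hy', hx'', crossingOf, mkSigned_rev_lower hu]
    · simp [hx, hy, hx', hy', hx'', hy'', crossingOf, mkSigned_rev_rev hu]
  have : pointDiagram w (turnSigns (w + 1) R U) (A ++ B.map Point.rev) J =
      ⟨(pointDiagram w (turnSigns (w + 1) R U) (A ++ B.map Point.rev) J).crossings, J,
        (pointDiagram w U (A ++ B) J).strands⟩ := by
    rw [← hs]
    rfl
  rw [this]
  exact .single (.turn _ _ hc)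

/-! ### One resolution step -/

/-- `Z'` is the term that describes the `b`-smoothing of the first crossing of `Z`. -/
structure ResolvesTo (w : ℕ) (Z Z' : Term) (b : Bool) : Prop where
  isSkeinArray : Z'.IsSkeinArray (w + 1)
  length_U : Z'.U.length + 1 = Z.U.length
  c_eq : Z'.c = Z.c
  s_eq : Z'.s = Z.s + if b then 1 else -1
  isotopic : OrderedIsotopic ((Z.diagram w).smooth [b]) (Z'.diagram (w + 1))

theorem resolvesTo_of {w : ℕ} {Z Z' : Term} {b : Bool} {u : ℤ} {us : List ℤ} {L' : List Loop}
    {p q : Point} {o : Bool} {A B : List Point} {R : List Entry} {x y x' y' : Arc}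
    (h : Z.IsSkeinArray w) (hU : Z.U = u :: us)
    (hP : (loopPoints Z.loops).Perm (p :: q :: (A ++ B)))
    (hp : p.e = .self (w + 1) o) (hq : q.e = .self (w + 1) (!o))
    (hb : ∀ cs s J, OrderedIsotopic
      ⟨cs, (if o then mkSigned u q p else mkSigned u p q).smoothing b ++ J, s⟩
      ⟨cs, (x, y) :: (x', y') :: J, s⟩)
    (hR : ∀ k o, w + 1 < k → R.count (.self k o) = (B.map Point.e).count (.self k o))
    (hP' : (loopPoints L').Perm (A ++ B.map Point.rev))
    (hJ : (((if x = y then [(x, y)] else []) ++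
      ((if merge x y x' = merge x y y' then [(x', y')] else []) ++ loopJoints Z.loops)).map
        (Prod.map (mergeTwo x y x' y') (mergeTwo x y x' y'))).Perm
      ((loopJoints L').map (Prod.map (mergeTwo x y x' y') (mergeTwo x y x' y'))))
    (hZ' : Traces Z' (L'.map (Loop.map (mergeTwo x y x' y'))))
    (hU' : Z'.U = turnSigns (w + 1 + 1) R us) (hc : Z'.c = Z.c)
    (hs : Z'.s = Z.s + if b then 1 else -1) : ResolvesTo w Z Z' b := by
  have hsig := h.signs
  rw [hU] at hsig
  have hv := h.validPoints.perm hP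
  rw [hU, List.length_cons] at hv
  have hv1 := hv.remove hp hq
  have hv2 := hv1.append_rev.perm hP'.symm
  have hsmooth : (Z.diagram w).smooth [b] =
      ⟨(pointDiagram (w + 1) us (A ++ B) (loopJoints Z.loops)).crossings,
        (if o then mkSigned u q p else mkSigned u p q).smoothing b ++ loopJoints Z.loops,
        (pointDiagram (w + 1) us (A ++ B) (loopJoints Z.loops)).strands⟩ := by
    rw [Term.diagram_eq, pointDiagram_perm _ h.validPoints hP, hU, pointDiagram_cons hp hq,
      smooth_cons_singleton]
  have hiso : OrderedIsotopic ((Z.diagram w).smooth [b]) (Z'.diagram (w + 1)) := by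
    rw [hsmooth]
    refine (hb _ _ _).trans ((orderedIsotopic_mergeTwo _ _ _ _ _ _ _).trans ?_)
    refine .trans ?_ (hZ'.orderedIsotopic (w + 1))
    rw [hU', loopPoints_map, loopJoints_map]
    refine .head (b := (pointDiagram (w + 1) us (A ++ B) (loopJoints L')).map
      (mergeTwo x y x' y')) (.perm _ _ hJ) ?_
    rw [← pointDiagram_map]
    have h1 := orderedIsotopic_rev (A := A.map (Point.map (mergeTwo x y x' y')))
      (B := B.map (Point.map (mergeTwo x y x' y'))) (R := R) (U := us) (w := w + 1)
      (by rw [← List.map_append]; exact hv1.map _) (fun u hu => hsig u (by simp [hu]))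
      (fun k o hk => by
        rw [hR k o hk, List.map_map]
        rfl) ((loopJoints L').map (Prod.map (mergeTwo x y x' y') (mergeTwo x y x' y')))
    have h2 : A.map (Point.map (mergeTwo x y x' y')) ++
        (B.map (Point.map (mergeTwo x y x' y'))).map Point.rev =
        (A ++ B.map Point.rev).map (Point.map (mergeTwo x y x' y')) := by
      rw [List.map_append, List.map_map, List.map_map]
      rfl
    rw [h2, ← pointDiagram_perm _ (hv2.map _) (hP'.map _), ← List.map_append] at h1
    exact h1
  have hlen : Z'.U.length = us.length := by rw [hU', length_turnSigns]
  refine ⟨hZ'.isSkeinArray ?_ ?_ ?_, ?_, hc, hs, hiso⟩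
  · rw [hlen, loopPoints_map]
    exact hv2.map _
  · rw [hU']
    exact turnSigns_signs fun u hu => hsig u (by simp [hu])
  · refine hiso.isLink (h.isLink.smooth [b] ?_)
    rw [Term.diagram_eq, h.validPoints.length_crossings, hU]
    simp
  · rw [hlen, hU, List.length_cons]

/-! ### The components after a smoothing -/

theorem Loop.arcs_of_ne_nil {a : Arc} {ps : List Point} (h : ps ≠ []) :
    Loop.arcs (a, ps) = ps.map Point.out := by
  rcases ps with _ | ⟨p, ps⟩
  · exact absurd rfl h
  · rfl

theorem Loop.joints_of_ne_nil {a : Arc} {ps : List Point} (h : ps ≠ []) :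
    Loop.joints (a, ps) = [] := by
  rcases ps with _ | ⟨p, ps⟩
  · exact absurd rfl h
  · rfl

theorem Loop.arcs_map (f : Arc → Arc) (c : Loop) : (c.map f).arcs = c.arcs.map f := by
  rcases c with ⟨a, _ | ⟨p, ps⟩⟩
  · rfl
  · simp only [Loop.map, Loop.arcs, List.map_cons, List.map_map]
    rfl

/-- Identifying `x` with `y` and `x'` with `y'` turns the components `L`, with two new joints, into
the components `L'`. -/
structure Contracts (x y x' y' : Arc) (L L' : List Loop) : Prop where
  closed : ∀ c ∈ L'.map (Loop.map (mergeTwo x y x' y')), IsPath c.1 c.2 c.1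
  nodup : ((L'.map (Loop.map (mergeTwo x y x' y'))).flatMap Loop.arcs).Nodup
  joints : (((if x = y then [(x, y)] else []) ++
      ((if merge x y x' = merge x y y' then [(x', y')] else []) ++ loopJoints L)).map
        (Prod.map (mergeTwo x y x' y') (mergeTwo x y x' y'))).Perm
      ((loopJoints L').map (Prod.map (mergeTwo x y x' y') (mergeTwo x y x' y')))

theorem nodup_arcs_map {x y x' y' : Arc} {L : List Loop}
    (hN : ∀ z, (L.flatMap Loop.arcs).count z ≤ 1)
    (h1 : x = y ∨ (L.flatMap Loop.arcs).count y = 0)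
    (h2 : merge x y x' = merge x y y' ∨ (L.flatMap Loop.arcs).count (merge x y y') = 0) :
    ((L.map (Loop.map (mergeTwo x y x' y'))).flatMap Loop.arcs).Nodup := by
  rw [List.flatMap_map]
  simp only [Loop.arcs_map]
  rw [← List.map_flatMap, List.map_congr_left (g := id), List.map_id]
  · exact List.nodup_iff_count_le_one.2 hN
  · intro z hz
    refine mergeTwo_eq_self (h1.imp_right fun h => ?_) (h2.imp_right fun h => ?_)
    · rintro rfl
      exact List.count_eq_zero.1 h hz
    · rintro rfl
      exact List.count_eq_zero.1 h hz

theorem perm_joints {α β : Type*} {F : α → β} {X X' Y Y' J J' : List α} (hX : X.map F = X'.map F)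
    (hY : Y.map F = Y'.map F) :
    ((X ++ (Y ++ (J ++ J'))).map F).Perm ((J ++ (X' ++ (Y' ++ J'))).map F) := by
  simp only [List.map_append, hX, hY]
  have h := (List.perm_append_comm_assoc (Y'.map F) (J.map F) (J'.map F)).append_left (X'.map F)
  exact h.trans (List.perm_append_comm_assoc _ _ _)

theorem forall_closed_map {f : Arc → Arc} {L : List Loop} (h : ∀ c ∈ L, IsPath c.1 c.2 c.1) :
    ∀ c ∈ L.map (Loop.map f), IsPath c.1 c.2 c.1 := by
  intro c hc
  obtain ⟨d, hd, rfl⟩ := List.mem_map.1 hc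
  exact (h d hd).map f

theorem IsPath.eq_or_count_pos {a b : Arc} {ps : List Point} (h : IsPath a ps b) :
    (ps = [] ∧ a = b) ∨ (ps ≠ [] ∧ 0 < (ps.map Point.out).count b) := by
  by_cases hps : ps = []
  · subst hps
    exact .inl ⟨rfl, h⟩
  · refine .inr ⟨hps, ?_⟩
    rcases h.mem_outs with h | h
    · exact absurd h.1 hps
    · exact List.count_pos_iff.2 h

theorem IsPath.append {a b c : Arc} {ps qs : List Point} (h : IsPath a ps b) (h' : IsPath b qs c) :
    IsPath a (ps ++ qs) c := isPath_append.2 ⟨b, h, h'⟩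

theorem IsPath.count_eq {a b : Arc} {ps : List Point} (h : IsPath a ps b) (z : Arc) :
    (ps.map Point.out).count z + (if a = z then 1 else 0) =
      (ps.map Point.inn).count z + if b = z then 1 else 0 := by
  have := congrArg (List.count z) h.outs_eq
  simpa only [List.count_cons, List.count_append, List.count_nil, beq_iff_eq, Nat.zero_add]
    using this

section SameComponent

variable {L₁ L₂ : List Loop} {a : Arc} {ps₁ ps₂ ps₃ : List Point} {p q : Point}

theorem isPath_of_closed_two (hc : IsPath a (ps₁ ++ p :: (ps₂ ++ q :: ps₃)) a) :
    IsPath a ps₁ p.inn ∧ IsPath p.out ps₂ q.inn ∧ IsPath q.out ps₃ a := by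
  obtain ⟨b, h1, rfl, h2⟩ := isPath_append.1 hc
  obtain ⟨b, h3, rfl, h4⟩ := isPath_append.1 h2
  exact ⟨h1, h3, h4⟩

theorem count_arcs_two
    (hn : ((L₁ ++ (a, ps₁ ++ p :: (ps₂ ++ q :: ps₃)) :: L₂).flatMap Loop.arcs).Nodup) (z : Arc) :
    (L₁.flatMap Loop.arcs).count z + ((ps₁.map Point.out).count z + (ps₂.map Point.out).count z +
      (ps₃.map Point.out).count z + (if p.out = z then 1 else 0) + if q.out = z then 1 else 0) +
      (L₂.flatMap Loop.arcs).count z ≤ 1 := by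
  have := List.nodup_iff_count_le_one.1 hn z
  rw [List.flatMap_append, List.flatMap_cons, Loop.arcs_of_ne_nil (by simp)] at this
  simp only [List.count_append, List.map_append, List.map_cons, List.count_cons,
    beq_iff_eq] at this
  omega

theorem loopJoints_two : loopJoints (L₁ ++ (a, ps₁ ++ p :: (ps₂ ++ q :: ps₃)) :: L₂) =
    loopJoints L₁ ++ loopJoints L₂ := by
  unfold loopJoints
  rw [List.flatMap_append, List.flatMap_cons, Loop.joints_of_ne_nil (by simp)]
  rfl

theorem contracts_split
    (hc : ∀ c ∈ L₁ ++ (a, ps₁ ++ p :: (ps₂ ++ q :: ps₃)) :: L₂, IsPath c.1 c.2 c.1)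
    (hn : ((L₁ ++ (a, ps₁ ++ p :: (ps₂ ++ q :: ps₃)) :: L₂).flatMap Loop.arcs).Nodup) :
    Contracts q.inn p.out p.inn q.out (L₁ ++ (a, ps₁ ++ p :: (ps₂ ++ q :: ps₃)) :: L₂)
      (L₁ ++ (q.inn, ps₂) :: (a, ps₁ ++ ps₃) :: L₂) := by
  obtain ⟨h1, h2, h3⟩ := isPath_of_closed_two (hc (a, ps₁ ++ p :: (ps₂ ++ q :: ps₃)) (by simp))
  have hcount := count_arcs_two hn
  have hl := mergeTwo_left q.inn p.out p.inn q.out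
  have hr := mergeTwo_right q.inn p.out p.inn q.out
  have hne : q.out ≠ p.out := by
    intro e
    have := hcount p.out
    rw [if_pos rfl, if_pos e] at this
    omega
  have hm : merge q.inn p.out q.out = q.out := if_neg hne
  have h31 := h3.append h1
  have hpne : p.inn ≠ p.out := by
    intro e
    have := hcount p.out
    rcases h31.eq_or_count_pos with ⟨-, h⟩ | ⟨-, h⟩
    · exact hne (h.trans e)
    · rw [e, List.map_append, List.count_append] at h
      rw [if_pos rfl] at this
      omega
  have hm' : merge q.inn p.out p.inn = p.inn := if_neg hpne
  have hin : (ps₂ = [] ∧ q.inn = p.out) ∨ (ps₂ ≠ [] ∧ q.inn ≠ p.out) := by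
    rcases h2.eq_or_count_pos with h | ⟨h, h'⟩
    · exact .inl ⟨h.1, h.2.symm⟩
    · refine .inr ⟨h, fun e => ?_⟩
      have := hcount p.out
      rw [if_pos rfl] at this
      rw [e] at h'
      omega
  have hout : (ps₁ ++ ps₃ = [] ∧ p.inn = q.out ∧ a = q.out) ∨
      (ps₁ ++ ps₃ ≠ [] ∧ p.inn ≠ q.out) := by
    rcases h31.eq_or_count_pos with ⟨h, h'⟩ | ⟨h, h'⟩
    · obtain ⟨rfl, rfl⟩ := List.append_eq_nil_iff.1 h
      exact .inl ⟨rfl, h'.symm, Eq.symm h3⟩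
    · refine .inr ⟨fun e => h ?_, fun e => ?_⟩
      · simp only [List.append_eq_nil_iff] at e ⊢
        exact e.symm
      · have := hcount q.out
        rw [if_pos rfl] at this
        rw [e, List.map_append, List.count_append] at h'
        omega
  refine ⟨?_, ?_, ?_⟩
  · intro c hc'
    simp only [List.map_append, List.map_cons, List.mem_append, List.mem_cons] at hc'
    rcases hc' with h | rfl | rfl | h
    · exact forall_closed_map (fun c hc' => hc c (by simp [hc'])) c h
    · have := h2.map (mergeTwo q.inn p.out p.inn q.out)
      rwa [← hl] at this
    · have h1' := h1.map (mergeTwo q.inn p.out p.inn q.out)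
      have h3' := h3.map (mergeTwo q.inn p.out p.inn q.out)
      rw [hr] at h1'
      have := h1'.append h3'
      rwa [← List.map_append] at this
    · exact forall_closed_map (fun c hc' => hc c (by simp [hc'])) c h
  · have key : ∀ z, ((L₁ ++ (q.inn, ps₂) :: (a, ps₁ ++ ps₃) :: L₂).flatMap Loop.arcs).count z =
        (L₁.flatMap Loop.arcs).count z + ((ps₁.map Point.out).count z +
          (ps₂.map Point.out).count z + (ps₃.map Point.out).count z +
          (if q.inn = p.out ∧ p.out = z then 1 else 0) +
          if p.inn = q.out ∧ q.out = z then 1 else 0) + (L₂.flatMap Loop.arcs).count z := by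
      intro z
      rw [List.flatMap_append, List.flatMap_cons, List.flatMap_cons]
      simp only [List.count_append]
      have e1 : (Loop.arcs (q.inn, ps₂)).count z = (ps₂.map Point.out).count z +
          if q.inn = p.out ∧ p.out = z then 1 else 0 := by
        rcases hin with ⟨h, h'⟩ | ⟨h, h'⟩
        · subst h
          simp [Loop.arcs, h', List.count_cons]
        · simp [Loop.arcs_of_ne_nil h, h']
      have e2 : (Loop.arcs (a, ps₁ ++ ps₃)).count z = (ps₁.map Point.out).count z +
          (ps₃.map Point.out).count z + if p.inn = q.out ∧ q.out = z then 1 else 0 := by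
        rcases hout with ⟨h, h', h''⟩ | ⟨h, h'⟩
        · obtain ⟨rfl, rfl⟩ := List.append_eq_nil_iff.1 h
          simp [Loop.arcs, h', h'', List.count_cons]
        · simp [Loop.arcs_of_ne_nil h, h']
      omega
    refine nodup_arcs_map ?_ ?_ ?_
    · intro z
      rw [key]
      have := hcount z
      split_ifs at this ⊢ <;> first | omega | tauto
    · by_cases h : q.inn = p.out
      · exact .inl h
      · refine .inr ?_
        rw [key]
        have := hcount p.out
        rw [if_pos rfl, if_neg hne] at this
        simp only [h, hne, false_and, and_false, if_false]
        omega
    · rw [hm, hm']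
      by_cases h : p.inn = q.out
      · exact .inl h
      · refine .inr ?_
        rw [key]
        have := hcount q.out
        rw [if_pos rfl, if_neg hne.symm] at this
        simp only [h, hne.symm, false_and, and_false, if_false]
        omega
  · rw [loopJoints_two]
    have : loopJoints (L₁ ++ (q.inn, ps₂) :: (a, ps₁ ++ ps₃) :: L₂) = loopJoints L₁ ++
        (Loop.joints (q.inn, ps₂) ++ (Loop.joints (a, ps₁ ++ ps₃) ++ loopJoints L₂)) := by
      simp [loopJoints]
    rw [this]
    refine perm_joints ?_ ?_
    · rcases hin with ⟨rfl, h'⟩ | ⟨h, h'⟩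
      · rw [if_pos h']
        simp [Loop.joints, ← h']
      · rw [if_neg h', Loop.joints_of_ne_nil h]
    · rw [hm, hm']
      rcases hout with ⟨h, h', h''⟩ | ⟨h, h'⟩
      · rw [if_pos h', h, h', h'']
        rfl
      · rw [if_neg h', Loop.joints_of_ne_nil h]

theorem contracts_reverse
    (hc : ∀ c ∈ L₁ ++ (a, ps₁ ++ p :: (ps₂ ++ q :: ps₃)) :: L₂, IsPath c.1 c.2 c.1)
    (hn : ((L₁ ++ (a, ps₁ ++ p :: (ps₂ ++ q :: ps₃)) :: L₂).flatMap Loop.arcs).Nodup) :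
    Contracts p.inn q.inn p.out q.out (L₁ ++ (a, ps₁ ++ p :: (ps₂ ++ q :: ps₃)) :: L₂)
      (L₁ ++ (a, ps₁ ++ ps₂.reverse.map Point.rev ++ ps₃) :: L₂) := by
  obtain ⟨h1, h2, h3⟩ := isPath_of_closed_two (hc (a, ps₁ ++ p :: (ps₂ ++ q :: ps₃)) (by simp))
  have hcount := count_arcs_two hn
  have hl := mergeTwo_left p.inn q.inn p.out q.out
  have hr := mergeTwo_right p.inn q.inn p.out q.out
  have hcount2 := h2.count_eq
  have hne : q.out ≠ q.inn := by
    intro e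
    have := hcount q.inn
    have := hcount2 q.inn
    simp only [e, if_true] at *
    omega
  have hm : merge p.inn q.inn q.out = q.out := if_neg hne
  have h31 := h3.append h1
  have hpq : p.inn ≠ q.inn := by
    intro e
    have h4 := hcount q.inn
    have h5 := hcount2 q.inn
    rcases h31.eq_or_count_pos with ⟨-, h⟩ | ⟨-, h⟩
    · exact hne (h.trans e)
    · rw [e, List.map_append, List.count_append] at h
      rw [if_pos rfl] at h5
      omega
  have hall : (ps₁ ++ ps₂.reverse.map Point.rev ++ ps₃ = [] ∧ merge p.inn q.inn p.out = q.out ∧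
      a = q.out) ∨ (ps₁ ++ ps₂.reverse.map Point.rev ++ ps₃ ≠ [] ∧
      merge p.inn q.inn p.out ≠ q.out) := by
    unfold merge
    rcases h2.eq_or_count_pos with ⟨rfl, h⟩ | ⟨h, h'⟩
    · rw [if_pos h]
      rcases h31.eq_or_count_pos with ⟨h, h'⟩ | ⟨h, h'⟩
      · obtain ⟨rfl, rfl⟩ := List.append_eq_nil_iff.1 h
        exact .inl ⟨rfl, h'.symm, Eq.symm h3⟩
      · refine .inr ⟨fun e => h ?_, fun e => ?_⟩
        · simp only [List.append_eq_nil_iff] at e ⊢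
          exact ⟨e.2, e.1.1⟩
        · have := hcount q.out
          rw [if_pos rfl] at this
          rw [e, List.map_append, List.count_append] at h'
          omega
    · refine .inr ⟨by simp [h], ?_⟩
      have h4 := hcount q.out
      rw [if_pos rfl] at h4
      split_ifs with hpo
      · have h5 := hcount q.inn
        rw [if_pos hpo] at h5
        omega
      · intro e
        rw [if_pos e] at h4
        omega
  refine ⟨?_, ?_, ?_⟩
  · intro c hc'
    simp only [List.map_append, List.map_cons, List.mem_append, List.mem_cons] at hc'
    rcases hc' with h | rfl | h
    · exact forall_closed_map (fun c hc' => hc c (by simp [hc'])) c h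
    · have h1' := h1.map (mergeTwo p.inn q.inn p.out q.out)
      have h2' := h2.reverse.map (mergeTwo p.inn q.inn p.out q.out)
      have h3' := h3.map (mergeTwo p.inn q.inn p.out q.out)
      rw [hl] at h1'
      rw [hr] at h2'
      have := (h1'.append h2').append h3'
      rwa [← List.map_append, ← List.map_append] at this
    · exact forall_closed_map (fun c hc' => hc c (by simp [hc'])) c h
  · have key : ∀ z, ((L₁ ++ (a, ps₁ ++ ps₂.reverse.map Point.rev ++ ps₃) :: L₂).flatMap
        Loop.arcs).count z =
        (L₁.flatMap Loop.arcs).count z + ((ps₁.map Point.out).count z +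
          (ps₂.map Point.inn).count z + (ps₃.map Point.out).count z +
          if merge p.inn q.inn p.out = q.out ∧ q.out = z then 1 else 0) +
          (L₂.flatMap Loop.arcs).count z := by
      intro z
      rw [List.flatMap_append, List.flatMap_cons]
      simp only [List.count_append]
      rcases hall with ⟨h, h', h''⟩ | ⟨h, h'⟩
      · simp only [List.append_eq_nil_iff, List.map_eq_nil_iff, List.reverse_eq_nil_iff] at h
        obtain ⟨⟨rfl, rfl⟩, rfl⟩ := h
        simp [Loop.arcs, h', h'', List.count_cons]
        omega
      · rw [Loop.arcs_of_ne_nil h]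
        have e : (ps₂.reverse.map Point.rev).map Point.out = (ps₂.map Point.inn).reverse := by
          rw [List.map_map, ← List.map_reverse]
          rfl
        simp only [List.map_append, e, List.count_append, List.count_reverse, h', false_and,
          if_false]
        omega
    refine nodup_arcs_map ?_ (.inr ?_) ?_
    · intro z
      rw [key]
      have := hcount z
      have := hcount2 z
      split_ifs at * <;> first | omega | tauto
    · rw [key]
      have h4 := hcount q.inn
      have h5 := hcount2 q.inn
      simp only [hne, and_false, if_false, if_true] at h4 h5 ⊢
      split_ifs at * <;> omega
    · rw [hm]
      by_cases h : merge p.inn q.inn p.out = q.out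
      · exact .inl h
      · refine .inr ?_
        rw [key]
        have h4 := hcount q.out
        have h5 := hcount2 q.out
        simp only [h, false_and, if_false, if_true] at h4 h5 ⊢
        split_ifs at * <;> omega
  · rw [loopJoints_two]
    have : loopJoints (L₁ ++ (a, ps₁ ++ ps₂.reverse.map Point.rev ++ ps₃) :: L₂) =
        loopJoints L₁ ++ ([] ++
          (Loop.joints (a, ps₁ ++ ps₂.reverse.map Point.rev ++ ps₃) ++ loopJoints L₂)) := by
      simp [loopJoints]
    rw [this, if_neg hpq]
    refine perm_joints rfl ?_
    rw [hm]
    rcases hall with ⟨h, h', h''⟩ | ⟨h, h'⟩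
    · rw [if_pos h', h, h'']
      simp [Loop.joints, hr]
    · rw [if_neg h', Loop.joints_of_ne_nil h]

end SameComponent

section DistinctComponents

variable {L₁ L₂ L₃ : List Loop} {a b : Arc} {ps₁ ps₂ qs₁ qs₂ : List Point} {p q : Point}

theorem isPath_of_closed_one (hc : IsPath a (ps₁ ++ p :: ps₂) a) :
    IsPath a ps₁ p.inn ∧ IsPath p.out ps₂ a := by
  obtain ⟨b, h1, rfl, h2⟩ := isPath_append.1 hc
  exact ⟨h1, h2⟩

theorem count_arcs_one_one
    (hn : ((L₁ ++ (a, ps₁ ++ p :: ps₂) :: (L₂ ++ (b, qs₁ ++ q :: qs₂) :: L₃)).flatMap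
      Loop.arcs).Nodup) (z : Arc) :
    (L₁.flatMap Loop.arcs).count z + ((ps₁.map Point.out).count z + (ps₂.map Point.out).count z +
      (qs₁.map Point.out).count z + (qs₂.map Point.out).count z +
      (if p.out = z then 1 else 0) + if q.out = z then 1 else 0) +
      (L₂.flatMap Loop.arcs).count z + (L₃.flatMap Loop.arcs).count z ≤ 1 := by
  have := List.nodup_iff_count_le_one.1 hn z
  rw [List.flatMap_append, List.flatMap_cons, List.flatMap_append, List.flatMap_cons,
    Loop.arcs_of_ne_nil (by simp), Loop.arcs_of_ne_nil (by simp)] at this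
  simp only [List.count_append, List.map_append, List.map_cons, List.count_cons,
    beq_iff_eq] at this
  omega

theorem loopJoints_one_one :
    loopJoints (L₁ ++ (a, ps₁ ++ p :: ps₂) :: (L₂ ++ (b, qs₁ ++ q :: qs₂) :: L₃)) =
      loopJoints L₁ ++ loopJoints (L₂ ++ L₃) := by
  unfold loopJoints
  rw [List.flatMap_append, List.flatMap_cons, List.flatMap_append, List.flatMap_cons,
    Loop.joints_of_ne_nil (by simp), Loop.joints_of_ne_nil (by simp), List.flatMap_append]
  rfl

theorem contracts_forward
    (hc : ∀ c ∈ L₁ ++ (a, ps₁ ++ p :: ps₂) :: (L₂ ++ (b, qs₁ ++ q :: qs₂) :: L₃),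
      IsPath c.1 c.2 c.1)
    (hn : ((L₁ ++ (a, ps₁ ++ p :: ps₂) :: (L₂ ++ (b, qs₁ ++ q :: qs₂) :: L₃)).flatMap
      Loop.arcs).Nodup) :
    Contracts q.inn p.out p.inn q.out
      (L₁ ++ (a, ps₁ ++ p :: ps₂) :: (L₂ ++ (b, qs₁ ++ q :: qs₂) :: L₃))
      (L₁ ++ (a, ps₁ ++ (qs₂ ++ qs₁) ++ ps₂) :: (L₂ ++ L₃)) := by
  obtain ⟨h1, h2⟩ := isPath_of_closed_one (hc (a, ps₁ ++ p :: ps₂) (by simp))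
  obtain ⟨h3, h4⟩ := isPath_of_closed_one (hc (b, qs₁ ++ q :: qs₂) (by simp))
  have hcount := count_arcs_one_one hn
  have hl := mergeTwo_left q.inn p.out p.inn q.out
  have hr := mergeTwo_right q.inn p.out p.inn q.out
  have h21 := h2.append h1
  have h43 := h4.append h3
  have hne : q.out ≠ p.out := by
    intro e
    have := hcount p.out
    rw [if_pos rfl, if_pos e] at this
    omega
  have hm : merge q.inn p.out q.out = q.out := if_neg hne
  have hqp : q.inn ≠ p.out := by
    intro e
    rcases h43.eq_or_count_pos with ⟨-, h⟩ | ⟨-, h⟩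
    · exact hne (h.trans e)
    · have := hcount p.out
      rw [e, List.map_append, List.count_append] at h
      rw [if_pos rfl] at this
      omega
  have hall : (ps₁ ++ (qs₂ ++ qs₁) ++ ps₂ = [] ∧ merge q.inn p.out p.inn = q.out ∧ a = p.inn) ∨
      (ps₁ ++ (qs₂ ++ qs₁) ++ ps₂ ≠ [] ∧ merge q.inn p.out p.inn ≠ q.out) := by
    unfold merge
    rcases h21.eq_or_count_pos with ⟨h, h'⟩ | ⟨h, h'⟩
    · obtain ⟨rfl, rfl⟩ := List.append_eq_nil_iff.1 h
      rw [if_pos h'.symm]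
      rcases h43.eq_or_count_pos with ⟨h5, h6⟩ | ⟨h5, h6⟩
      · exact .inl ⟨by simp [h5], h6.symm, h1⟩
      · refine .inr ⟨by simpa using h5, fun e => ?_⟩
        have := hcount q.out
        rw [if_pos rfl] at this
        rw [e, List.map_append, List.count_append] at h6
        omega
    · rw [List.map_append, List.count_append] at h'
      have hpp : p.inn ≠ p.out := by
        intro e
        have := hcount p.out
        rw [if_pos rfl] at this
        rw [e] at h'
        omega
      rw [if_neg hpp]
      refine .inr ⟨fun e => h ?_, fun e => ?_⟩
      · simp only [List.append_eq_nil_iff] at e ⊢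
        exact ⟨e.2, e.1.1⟩
      · have := hcount q.out
        rw [if_pos rfl] at this
        rw [e] at h'
        omega
  refine ⟨?_, ?_, ?_⟩
  · intro c hc'
    simp only [List.map_append, List.map_cons, List.mem_append, List.mem_cons] at hc'
    rcases hc' with h | rfl | h | h
    · exact forall_closed_map (fun c hc' => hc c (by simp [hc'])) c h
    · have h1' := h1.map (mergeTwo q.inn p.out p.inn q.out)
      have h2' := h2.map (mergeTwo q.inn p.out p.inn q.out)
      have h43' := h43.map (mergeTwo q.inn p.out p.inn q.out)
      rw [hr] at h1'
      rw [hl] at h43'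
      have := (h1'.append h43').append h2'
      rwa [← List.map_append, ← List.map_append] at this
    · exact forall_closed_map (fun c hc' => hc c (by simp [hc'])) c h
    · exact forall_closed_map (fun c hc' => hc c (by simp [hc'])) c h
  · have hbase : ∃ a', mergeTwo q.inn p.out p.inn q.out a' = mergeTwo q.inn p.out p.inn q.out a ∧
        (merge q.inn p.out p.inn = q.out → a' = q.out) := by
      by_cases h : merge q.inn p.out p.inn = q.out
      · rcases hall with ⟨-, -, h'⟩ | ⟨-, h'⟩
        · exact ⟨q.out, by rw [h', hr], fun _ => rfl⟩
        · exact absurd h h'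
      · exact ⟨a, rfl, fun h' => absurd h' h⟩
    obtain ⟨a', ha', ha''⟩ := hbase
    have hL : (L₁ ++ (a, ps₁ ++ (qs₂ ++ qs₁) ++ ps₂) :: (L₂ ++ L₃)).map
        (Loop.map (mergeTwo q.inn p.out p.inn q.out)) =
        (L₁ ++ (a', ps₁ ++ (qs₂ ++ qs₁) ++ ps₂) :: (L₂ ++ L₃)).map
        (Loop.map (mergeTwo q.inn p.out p.inn q.out)) := by
      simp [Loop.map, ha']
    rw [hL]
    have key : ∀ z, ((L₁ ++ (a', ps₁ ++ (qs₂ ++ qs₁) ++ ps₂) :: (L₂ ++ L₃)).flatMap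
        Loop.arcs).count z =
        (L₁.flatMap Loop.arcs).count z + ((ps₁.map Point.out).count z +
          (ps₂.map Point.out).count z + (qs₁.map Point.out).count z + (qs₂.map Point.out).count z +
          if merge q.inn p.out p.inn = q.out ∧ q.out = z then 1 else 0) +
          (L₂.flatMap Loop.arcs).count z + (L₃.flatMap Loop.arcs).count z := by
      intro z
      rw [List.flatMap_append, List.flatMap_cons, List.flatMap_append]
      simp only [List.count_append]
      rcases hall with ⟨h, h', h''⟩ | ⟨h, h'⟩
      · simp only [List.append_eq_nil_iff] at h
        obtain ⟨⟨rfl, rfl, rfl⟩, rfl⟩ := h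
        simp [Loop.arcs, h', ha'' h', List.count_cons]
        omega
      · rw [Loop.arcs_of_ne_nil h]
        simp only [List.map_append, List.count_append, h', false_and, if_false]
        omega
    refine nodup_arcs_map ?_ (.inr ?_) ?_
    · intro z
      rw [key]
      have := hcount z
      split_ifs at * <;> first | omega | tauto
    · rw [key]
      have h4 := hcount p.out
      simp only [hne, and_false, if_false, if_true] at h4 ⊢
      omega
    · rw [hm]
      by_cases h : merge q.inn p.out p.inn = q.out
      · exact .inl h
      · refine .inr ?_
        rw [key]
        have h4 := hcount q.out
        simp only [h, false_and, if_false, if_true] at h4 ⊢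
        omega
  · rw [loopJoints_one_one]
    have : loopJoints (L₁ ++ (a, ps₁ ++ (qs₂ ++ qs₁) ++ ps₂) :: (L₂ ++ L₃)) =
        loopJoints L₁ ++ ([] ++
          (Loop.joints (a, ps₁ ++ (qs₂ ++ qs₁) ++ ps₂) ++ loopJoints (L₂ ++ L₃))) := by
      simp [loopJoints]
    rw [this, if_neg hqp]
    refine perm_joints rfl ?_
    rw [hm]
    rcases hall with ⟨h, h', h''⟩ | ⟨h, h'⟩
    · rw [if_pos h', h, h'']
      simp [Loop.joints, hr]
    · rw [if_neg h', Loop.joints_of_ne_nil h]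

theorem contracts_backward
    (hc : ∀ c ∈ L₁ ++ (a, ps₁ ++ p :: ps₂) :: (L₂ ++ (b, qs₁ ++ q :: qs₂) :: L₃),
      IsPath c.1 c.2 c.1)
    (hn : ((L₁ ++ (a, ps₁ ++ p :: ps₂) :: (L₂ ++ (b, qs₁ ++ q :: qs₂) :: L₃)).flatMap
      Loop.arcs).Nodup) :
    Contracts p.inn q.inn q.out p.out
      (L₁ ++ (a, ps₁ ++ p :: ps₂) :: (L₂ ++ (b, qs₁ ++ q :: qs₂) :: L₃))
      (L₁ ++ (a, ps₁ ++ (qs₁.reverse ++ qs₂.reverse).map Point.rev ++ ps₂) :: (L₂ ++ L₃)) := by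
  obtain ⟨h1, h2⟩ := isPath_of_closed_one (hc (a, ps₁ ++ p :: ps₂) (by simp))
  obtain ⟨h3, h4⟩ := isPath_of_closed_one (hc (b, qs₁ ++ q :: qs₂) (by simp))
  have hcount := count_arcs_one_one hn
  have hl := mergeTwo_left p.inn q.inn q.out p.out
  have hr := mergeTwo_right p.inn q.inn q.out p.out
  have h21 := h2.append h1
  have h43 := h4.append h3
  have hcount3 := h3.count_eq
  have hcount4 := h4.count_eq
  have hqp : p.out ≠ q.inn := by
    intro e
    have h5 := hcount q.inn
    have h6 := hcount3 q.inn
    have h7 := hcount4 q.inn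
    simp only [e, if_true] at h5 h6 h7
    omega
  have hm : merge p.inn q.inn p.out = p.out := if_neg hqp
  have hpq : p.inn ≠ q.inn := by
    intro e
    rcases h21.eq_or_count_pos with ⟨-, h⟩ | ⟨-, h⟩
    · exact hqp (h.trans e)
    · have h5 := hcount q.inn
      have h6 := hcount3 q.inn
      have h7 := hcount4 q.inn
      rw [e, List.map_append, List.count_append] at h
      rw [if_pos rfl] at h6
      omega
  have hqo : q.out ≠ p.out := by
    intro e
    have := hcount p.out
    rw [if_pos rfl, if_pos e] at this
    omega
  have hall : (ps₁ ++ (qs₁.reverse ++ qs₂.reverse).map Point.rev ++ ps₂ = [] ∧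
      merge p.inn q.inn q.out = p.out ∧ a = p.out) ∨
      (ps₁ ++ (qs₁.reverse ++ qs₂.reverse).map Point.rev ++ ps₂ ≠ [] ∧
        merge p.inn q.inn q.out ≠ p.out) := by
    unfold merge
    rcases h43.eq_or_count_pos with ⟨h, h'⟩ | ⟨h, h'⟩
    · obtain ⟨rfl, rfl⟩ := List.append_eq_nil_iff.1 h
      rw [if_pos h']
      rcases h21.eq_or_count_pos with ⟨h5, h6⟩ | ⟨h5, h6⟩
      · obtain ⟨rfl, rfl⟩ := List.append_eq_nil_iff.1 h5
        exact .inl ⟨by simp, h6.symm, Eq.symm h2⟩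
      · refine .inr ⟨fun e => h5 ?_, fun e => ?_⟩
        · simp only [List.append_eq_nil_iff] at e ⊢
          exact ⟨e.2, e.1.1⟩
        · have := hcount p.out
          rw [if_pos rfl] at this
          rw [e, List.map_append, List.count_append] at h6
          omega
    · rw [List.map_append, List.count_append] at h'
      refine .inr ⟨fun e => h ?_, ?_⟩
      · simp only [List.append_eq_nil_iff, List.map_eq_nil_iff, List.reverse_eq_nil_iff] at e ⊢
        exact ⟨e.1.2.2, e.1.2.1⟩
      · rw [if_neg]
        · exact hqo
        · intro e
          have := hcount q.inn
          rw [if_pos e] at this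
          omega
  refine ⟨?_, ?_, ?_⟩
  · intro c hc'
    simp only [List.map_append, List.map_cons, List.mem_append, List.mem_cons] at hc'
    rcases hc' with h | rfl | h | h
    · exact forall_closed_map (fun c hc' => hc c (by simp [hc'])) c h
    · have h1' := h1.map (mergeTwo p.inn q.inn q.out p.out)
      have h2' := h2.map (mergeTwo p.inn q.inn q.out p.out)
      have h43' := (h3.reverse.append h4.reverse).map (mergeTwo p.inn q.inn q.out p.out)
      rw [hl] at h1'
      rw [hr] at h43'
      have := (h1'.append h43').append h2'
      rwa [← List.map_append, ← List.map_append] at this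
    · exact forall_closed_map (fun c hc' => hc c (by simp [hc'])) c h
    · exact forall_closed_map (fun c hc' => hc c (by simp [hc'])) c h
  · have key : ∀ z, ((L₁ ++ (a, ps₁ ++ (qs₁.reverse ++ qs₂.reverse).map Point.rev ++ ps₂) ::
        (L₂ ++ L₃)).flatMap Loop.arcs).count z =
        (L₁.flatMap Loop.arcs).count z + ((ps₁.map Point.out).count z +
          (ps₂.map Point.out).count z + (qs₁.map Point.inn).count z + (qs₂.map Point.inn).count z +
          if merge p.inn q.inn q.out = p.out ∧ p.out = z then 1 else 0) +
          (L₂.flatMap Loop.arcs).count z + (L₃.flatMap Loop.arcs).count z := by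
      intro z
      rw [List.flatMap_append, List.flatMap_cons, List.flatMap_append]
      simp only [List.count_append]
      rcases hall with ⟨h, h', h''⟩ | ⟨h, h'⟩
      · simp only [List.append_eq_nil_iff, List.map_eq_nil_iff, List.reverse_eq_nil_iff] at h
        obtain ⟨⟨rfl, rfl, rfl⟩, rfl⟩ := h
        simp [Loop.arcs, h', h'', List.count_cons]
        omega
      · rw [Loop.arcs_of_ne_nil h]
        have e : ∀ ps : List Point, (ps.reverse.map Point.rev).map Point.out =
            (ps.map Point.inn).reverse := by
          intro ps
          rw [List.map_map, ← List.map_reverse]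
          rfl
        simp only [List.map_append, e, List.count_append, List.count_reverse, h', false_and,
          if_false]
        omega
    refine nodup_arcs_map ?_ (.inr ?_) ?_
    · intro z
      rw [key]
      have := hcount z
      have := hcount3 z
      have := hcount4 z
      split_ifs at * <;> first | omega | tauto
    · rw [key]
      have h5 := hcount q.inn
      have h6 := hcount3 q.inn
      have h7 := hcount4 q.inn
      simp only [hqp, and_false, if_false, if_true] at h5 h6 h7 ⊢
      omega
    · rw [hm]
      by_cases h : merge p.inn q.inn q.out = p.out
      · exact .inl h
      · refine .inr ?_
        rw [key]
        have h5 := hcount p.out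
        have h6 := hcount3 p.out
        have h7 := hcount4 p.out
        simp only [h, false_and, if_false, if_true] at h5 h6 h7 ⊢
        omega
  · rw [loopJoints_one_one]
    have : loopJoints (L₁ ++ (a, ps₁ ++ (qs₁.reverse ++ qs₂.reverse).map Point.rev ++ ps₂) ::
        (L₂ ++ L₃)) = loopJoints L₁ ++ ([] ++
          (Loop.joints (a, ps₁ ++ (qs₁.reverse ++ qs₂.reverse).map Point.rev ++ ps₂) ++
            loopJoints (L₂ ++ L₃))) := by
      simp [loopJoints]
    rw [this, if_neg hpq]
    refine perm_joints rfl ?_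
    rw [hm]
    rcases hall with ⟨h, h', h''⟩ | ⟨h, h'⟩
    · rw [if_pos h', h, h'']
      simp [Loop.joints, hr]
    · rw [if_neg h', Loop.joints_of_ne_nil h]

end DistinctComponents

/-! ### The array operators at given places -/

section Operators

variable {α : Type*}

theorem take_append_cons (x₁ x₂ : List α) (e : α) :
    (x₁ ++ e :: x₂).take x₁.length = x₁ := by simp

theorem drop_append_cons (x₁ x₂ : List α) (e : α) :
    (x₁ ++ e :: x₂).drop (x₁.length + 1) = x₂ := by simp

theorem inner_append_cons (x₁ x₂ x₃ : List α) (e e' : α) :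
    inner (x₁ ++ e :: (x₂ ++ e' :: x₃)) x₁.length (x₁.length + 1 + x₂.length) = x₂ := by
  have h : x₁ ++ e :: (x₂ ++ e' :: x₃) = (x₁ ++ e :: x₂) ++ e' :: x₃ := by simp
  have hl : x₁.length + 1 + x₂.length = (x₁ ++ e :: x₂).length := by
    simp only [List.length_append, List.length_cons]
    omega
  rw [inner, h, hl, take_append_cons, drop_append_cons]

theorem drop_append_cons_two (x₁ x₂ x₃ : List α) (e e' : α) :
    (x₁ ++ e :: (x₂ ++ e' :: x₃)).drop (x₁.length + 1 + x₂.length + 1) = x₃ := by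
  have h : x₁ ++ e :: (x₂ ++ e' :: x₃) = (x₁ ++ e :: x₂) ++ e' :: x₃ := by simp
  have hl : x₁.length + 1 + x₂.length = (x₁ ++ e :: x₂).length := by
    simp only [List.length_append, List.length_cons]
    omega
  rw [h, hl, drop_append_cons]

theorem opC_append_cons (x₁ x₂ x₃ : List α) (e e' : α) :
    opC (x₁ ++ e :: (x₂ ++ e' :: x₃)) x₁.length (x₁.length + 1 + x₂.length) =
      (x₂, x₁ ++ x₃) := by
  rw [opC, inner_append_cons, take_append_cons, drop_append_cons_two]

theorem opR_append_cons (x₁ x₂ x₃ : List α) (e e' : α) :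
    opR (x₁ ++ e :: (x₂ ++ e' :: x₃)) x₁.length (x₁.length + 1 + x₂.length) =
      x₁ ++ x₂.reverse ++ x₃ := by
  rw [opR, inner_append_cons, take_append_cons, drop_append_cons_two]

theorem opF_append_cons (x₁ x₂ y₁ y₂ : List α) (e e' : α) :
    opF (x₁ ++ e :: x₂) (y₁ ++ e' :: y₂) x₁.length y₁.length = x₁ ++ (y₂ ++ y₁) ++ x₂ := by
  rw [opF, take_append_cons, drop_append_cons, take_append_cons, drop_append_cons]

theorem opB_append_cons (x₁ x₂ y₁ y₂ : List α) (e e' : α) :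
    opB (x₁ ++ e :: x₂) (y₁ ++ e' :: y₂) x₁.length y₁.length =
      x₁ ++ (y₁.reverse ++ y₂.reverse) ++ x₂ := by
  rw [opB, take_append_cons, drop_append_cons, take_append_cons, drop_append_cons]

theorem getD_append_cons (X₁ X₂ : List α) (x d : α) :
    (X₁ ++ x :: X₂).getD X₁.length d = x := by simp [List.getD_eq_getElem?_getD]

theorem set_append_cons (X₁ X₂ : List α) (x y : α) :
    (X₁ ++ x :: X₂).set X₁.length y = X₁ ++ y :: X₂ := by simp

theorem insertIdx_append_cons (X₁ X₂ : List α) (x y : α) :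
    (X₁ ++ x :: X₂).insertIdx (X₁.length + 1) y = X₁ ++ x :: y :: X₂ := by
  induction X₁ with
  | nil => simp
  | cons z X₁ ih => simpa using ih

theorem applyC_append_cons (X₁ X₂ : List (List α)) (x₁ x₂ x₃ : List α) (e e' : α) :
    applyC (X₁ ++ (x₁ ++ e :: (x₂ ++ e' :: x₃)) :: X₂) X₁.length x₁.length
      (x₁.length + 1 + x₂.length) = X₁ ++ x₂ :: (x₁ ++ x₃) :: X₂ := by
  rw [applyC, getD_append_cons, opC_append_cons, set_append_cons, insertIdx_append_cons]

theorem applyR_append_cons (X₁ X₂ : List (List α)) (x₁ x₂ x₃ : List α) (e e' : α) :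
    applyR (X₁ ++ (x₁ ++ e :: (x₂ ++ e' :: x₃)) :: X₂) X₁.length x₁.length
      (x₁.length + 1 + x₂.length) = X₁ ++ (x₁ ++ x₂.reverse ++ x₃) :: X₂ := by
  rw [applyR, getD_append_cons, opR_append_cons, set_append_cons]

theorem getD_append_cons_two (X₁ X₂ X₃ : List α) (x y d : α) :
    (X₁ ++ x :: (X₂ ++ y :: X₃)).getD (X₁.length + 1 + X₂.length) d = y := by
  have h : X₁ ++ x :: (X₂ ++ y :: X₃) = (X₁ ++ x :: X₂) ++ y :: X₃ := by simp
  have hl : X₁.length + 1 + X₂.length = (X₁ ++ x :: X₂).length := by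
    simp only [List.length_append, List.length_cons]
    omega
  rw [h, hl, getD_append_cons]

theorem eraseIdx_append_cons (X₁ X₂ : List α) (x : α) :
    (X₁ ++ x :: X₂).eraseIdx X₁.length = X₁ ++ X₂ := by
  simp [List.eraseIdx_append_of_length_le]

theorem eraseIdx_append_cons_two (X₁ X₂ X₃ : List α) (x y : α) :
    (X₁ ++ x :: (X₂ ++ y :: X₃)).eraseIdx (X₁.length + 1 + X₂.length) =
      X₁ ++ x :: (X₂ ++ X₃) := by
  have h : X₁ ++ x :: (X₂ ++ y :: X₃) = (X₁ ++ x :: X₂) ++ y :: X₃ := by simp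
  have hl : X₁.length + 1 + X₂.length = (X₁ ++ x :: X₂).length := by
    simp only [List.length_append, List.length_cons]
    omega
  rw [h, hl, eraseIdx_append_cons]
  simp

theorem applyF_append_cons (X₁ X₂ X₃ : List (List α)) (x₁ x₂ y₁ y₂ : List α) (e e' : α) :
    applyF (X₁ ++ (x₁ ++ e :: x₂) :: (X₂ ++ (y₁ ++ e' :: y₂) :: X₃)) X₁.length
      (X₁.length + 1 + X₂.length) x₁.length y₁.length =
      X₁ ++ (x₁ ++ (y₂ ++ y₁) ++ x₂) :: (X₂ ++ X₃) := by
  rw [applyF, getD_append_cons, getD_append_cons_two, eraseIdx_append_cons_two, set_append_cons,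
    opF_append_cons]

theorem applyB_append_cons (X₁ X₂ X₃ : List (List α)) (x₁ x₂ y₁ y₂ : List α) (e e' : α) :
    applyB (X₁ ++ (x₁ ++ e :: x₂) :: (X₂ ++ (y₁ ++ e' :: y₂) :: X₃)) X₁.length
      (X₁.length + 1 + X₂.length) x₁.length y₁.length =
      X₁ ++ (x₁ ++ (y₁.reverse ++ y₂.reverse) ++ x₂) :: (X₂ ++ X₃) := by
  rw [applyB, getD_append_cons, getD_append_cons_two, eraseIdx_append_cons_two, set_append_cons,
    opB_append_cons]

theorem turnInner_append_cons (X₁ X₂ : List (List Entry)) (Y₁ Y₂ : List (List ℕ))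
    (x₁ x₂ x₃ : List Entry) (y₁ y₂ y₃ : List ℕ) (e e' : Entry) (i i' : ℕ)
    (hX : X₁.length = Y₁.length) (h₁ : x₁.length = y₁.length) (h₂ : x₂.length = y₂.length) :
    turnInner (X₁ ++ (x₁ ++ e :: (x₂ ++ e' :: x₃)) :: X₂)
      (Y₁ ++ (y₁ ++ i :: (y₂ ++ i' :: y₃)) :: Y₂) X₁.length x₁.length
      (x₁.length + 1 + x₂.length) =
      Y₁ ++ (y₁ ++ i :: (List.zipWith Entry.turnQ x₂ y₂ ++ i' :: y₃)) :: Y₂ := by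
  rw [turnInner, getD_append_cons, inner_append_cons, hX, h₁, h₂, getD_append_cons,
    inner_append_cons, set_append_cons]
  have e1 : (y₁ ++ i :: (y₂ ++ i' :: y₃)).take (y₁.length + 1) = y₁ ++ [i] := by
    simp [List.take_append]
  have e2 : (y₁ ++ i :: (y₂ ++ i' :: y₃)).drop (y₁.length + 1 + y₂.length) = i' :: y₃ := by
    rw [← List.drop_drop, drop_append_cons]
    simp
  rw [e1, e2]
  simp

theorem turnAll_append_cons (X₁ X₂ : List (List Entry)) (Y₁ Y₂ : List (List ℕ)) (x : List Entry)
    (y : List ℕ) (hX : X₁.length = Y₁.length) :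
    turnAll (X₁ ++ x :: X₂) (Y₁ ++ y :: Y₂) X₁.length =
      Y₁ ++ List.zipWith Entry.turnQ x y :: Y₂ := by
  rw [turnAll, getD_append_cons, hX, getD_append_cons, set_append_cons]

end Operators

/-! ### The two points of a crossing -/

theorem loopPoints_append (L L' : List Loop) :
    loopPoints (L ++ L') = loopPoints L ++ loopPoints L' := List.flatMap_append

theorem loopPoints_cons (c : Loop) (L : List Loop) :
    loopPoints (c :: L) = c.2 ++ loopPoints L := List.flatMap_cons

theorem exists_of_mem_loopPoints {L : List Loop} {x : Point} (h : x ∈ loopPoints L) :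
    ∃ L₁ a ps₁ ps₂ L₂, L = L₁ ++ (a, ps₁ ++ x :: ps₂) :: L₂ := by
  obtain ⟨⟨a, ps⟩, hc, hx⟩ := List.mem_flatMap.1 h
  obtain ⟨L₁, L₂, rfl⟩ := List.append_of_mem hc
  obtain ⟨ps₁, ps₂, h⟩ := List.append_of_mem hx
  dsimp only at h
  subst h
  exact ⟨L₁, a, ps₁, ps₂, L₂, rfl⟩

theorem exists_two_points {L : List Loop} {ρ : ℕ}
    (h : ∀ o, ((loopPoints L).map Point.e).count (.self ρ o) = 1) :
    ∃ (p q : Point) (o : Bool), p.e = .self ρ o ∧ q.e = .self ρ (!o) ∧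
      ((∃ L₁ a ps₁ ps₂ ps₃ L₂, L = L₁ ++ (a, ps₁ ++ p :: (ps₂ ++ q :: ps₃)) :: L₂) ∨
        ∃ L₁ a ps₁ ps₂ L₂ b qs₁ qs₂ L₃,
          L = L₁ ++ (a, ps₁ ++ p :: ps₂) :: (L₂ ++ (b, qs₁ ++ q :: qs₂) :: L₃)) := by
  have hmem : ∀ o, ∃ x ∈ loopPoints L, x.e = .self ρ o := by
    intro o
    have : 0 < ((loopPoints L).map Point.e).count (.self ρ o) := by rw [h]; exact Nat.one_pos
    exact List.mem_map.1 (List.count_pos_iff.1 this)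
  obtain ⟨x, hx, hxe⟩ := hmem true
  obtain ⟨y, hy, hye⟩ := hmem false
  obtain ⟨L₁, a, ps₁, ps₂, L₂, rfl⟩ := exists_of_mem_loopPoints hx
  rw [loopPoints_append, loopPoints_cons] at hy
  simp only [List.mem_append, List.mem_cons] at hy
  rcases hy with hy | (hy | rfl | hy) | hy
  · obtain ⟨K₁, b, qs₁, qs₂, K₂, rfl⟩ := exists_of_mem_loopPoints hy
    exact ⟨y, x, false, hye, hxe, .inr ⟨K₁, b, qs₁, qs₂, K₂, a, ps₁, ps₂, L₂, by simp⟩⟩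
  · obtain ⟨qs₁, qs₂, rfl⟩ := List.append_of_mem hy
    exact ⟨y, x, false, hye, hxe, .inl ⟨L₁, a, qs₁, qs₂, ps₂, L₂, by simp⟩⟩
  · rw [hxe] at hye
    simp at hye
  · obtain ⟨qs₁, qs₂, rfl⟩ := List.append_of_mem hy
    exact ⟨x, y, true, hxe, hye, .inl ⟨L₁, a, ps₁, qs₁, qs₂, L₂, rfl⟩⟩
  · obtain ⟨K₁, b, qs₁, qs₂, K₂, rfl⟩ := exists_of_mem_loopPoints hy
    exact ⟨x, y, true, hxe, hye, .inr ⟨L₁, a, ps₁, ps₂, K₁, b, qs₁, qs₂, K₂, rfl⟩⟩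

/-- The entry belongs to the crossing with label `ρ`. -/
abbrev Entry.HasLabel (ρ : ℕ) (e : Entry) : Prop := e = .self ρ true ∨ e = .self ρ false

theorem not_hasLabel_of_perm {P R : List Point} {p q : Point} {ρ : ℕ} {o : Bool}
    (h : ∀ o, (P.map Point.e).count (.self ρ o) = 1) (hP : P.Perm (p :: q :: R))
    (hp : p.e = .self ρ o) (hq : q.e = .self ρ (!o)) : ∀ x ∈ R, ¬ x.e.HasLabel ρ := by
  have key : ∀ o', (R.map Point.e).count (.self ρ o') = 0 := by
    intro o'
    have := h o'
    rw [(hP.map _).count_eq] at this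
    simp only [List.map_cons, List.count_cons, hp, hq, beq_iff_eq, Entry.self.injEq,
      true_and] at this
    cases o <;> cases o' <;> simp at this ⊢ <;> omega
  rintro x hx (hxe | hxe)
  · exact List.count_eq_zero.1 (key true) (hxe ▸ List.mem_map_of_mem hx)
  · exact List.count_eq_zero.1 (key false) (hxe ▸ List.mem_map_of_mem hx)

/-- The places of the label `ρ` in row `l`, numbered from `n`. -/
def locateRow (ρ l : ℕ) (x : List Entry) (n : ℕ) : List (ℕ × ℕ) :=
  (x.zipIdx n).filterMap fun ej =>
    if ej.1 = .self ρ true ∨ ej.1 = .self ρ false then some (l, ej.2) else none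

/-- The places of the label `ρ` in the rows `E`, numbered from `l`. -/
def locateFrom (ρ : ℕ) (E : List (List Entry)) (l : ℕ) : List (ℕ × ℕ) :=
  (E.zipIdx l).flatMap fun cl => locateRow ρ cl.2 cl.1 0

theorem locateRow_append (ρ l : ℕ) (x y : List Entry) (n : ℕ) :
    locateRow ρ l (x ++ y) n = locateRow ρ l x n ++ locateRow ρ l y (n + x.length) := by
  rw [locateRow, List.zipIdx_append, List.filterMap_append]
  rfl

theorem locateRow_cons {ρ : ℕ} (l : ℕ) {e : Entry} (h : e.HasLabel ρ) (x : List Entry) (n : ℕ) :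
    locateRow ρ l (e :: x) n = (l, n) :: locateRow ρ l x (n + 1) := by
  rw [locateRow, List.zipIdx_cons, List.filterMap_cons, if_pos h]
  rfl

theorem locateRow_eq_nil {ρ : ℕ} (l : ℕ) {ps : List Point} (h : ∀ p ∈ ps, ¬ p.e.HasLabel ρ)
    (n : ℕ) : locateRow ρ l (ps.map Point.e) n = [] := by
  rw [locateRow, List.filterMap_eq_nil_iff]
  rintro ⟨e, j⟩ he
  obtain ⟨p, hp, rfl⟩ := List.mem_map.1 (List.fst_mem_of_mem_zipIdx he)
  exact if_neg (h p hp)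

theorem locateFrom_append (ρ : ℕ) (E F : List (List Entry)) (l : ℕ) :
    locateFrom ρ (E ++ F) l = locateFrom ρ E l ++ locateFrom ρ F (l + E.length) := by
  rw [locateFrom, List.zipIdx_append, List.flatMap_append]
  rfl

theorem locateFrom_cons (ρ : ℕ) (x : List Entry) (E : List (List Entry)) (l : ℕ) :
    locateFrom ρ (x :: E) l = locateRow ρ l x 0 ++ locateFrom ρ E (l + 1) := by
  rw [locateFrom, List.zipIdx_cons, List.flatMap_cons]
  rfl

theorem locateFrom_eq_nil {ρ : ℕ} {L : List Loop} (h : ∀ p ∈ loopPoints L, ¬ p.e.HasLabel ρ)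
    (l : ℕ) : locateFrom ρ (L.map fun c => c.2.map Point.e) l = [] := by
  rw [locateFrom, List.flatMap_eq_nil_iff]
  rintro ⟨x, k⟩ hx
  obtain ⟨c, hc, rfl⟩ := List.mem_map.1 (List.fst_mem_of_mem_zipIdx hx)
  exact locateRow_eq_nil _ (fun p hp => h p (List.mem_flatMap.2 ⟨c, hc, hp⟩)) 0

theorem perm_two (L₁ L₂ : List Loop) (a : Arc) (ps₁ ps₂ ps₃ : List Point) (p q : Point) :
    (loopPoints (L₁ ++ (a, ps₁ ++ p :: (ps₂ ++ q :: ps₃)) :: L₂)).Perm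
      (p :: q :: (loopPoints L₁ ++ (ps₁ ++ (ps₃ ++ loopPoints L₂)) ++ ps₂)) := by
  classical
  rw [List.perm_iff_count]
  intro z
  simp only [loopPoints_append, loopPoints_cons, List.count_append, List.count_cons]
  omega

theorem perm_one_one (L₁ L₂ L₃ : List Loop) (a b : Arc) (ps₁ ps₂ qs₁ qs₂ : List Point)
    (p q : Point) :
    (loopPoints (L₁ ++ (a, ps₁ ++ p :: ps₂) :: (L₂ ++ (b, qs₁ ++ q :: qs₂) :: L₃))).Perm
      (p :: q :: (loopPoints L₁ ++ (ps₁ ++ (ps₂ ++ (loopPoints L₂ ++ loopPoints L₃))) ++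
        (qs₁ ++ qs₂))) := by
  classical
  rw [List.perm_iff_count]
  intro z
  simp only [loopPoints_append, loopPoints_cons, List.count_append, List.count_cons]
  omega

theorem locate_two {L₁ L₂ : List Loop} {a : Arc} {ps₁ ps₂ ps₃ : List Point} {p q : Point} {ρ : ℕ}
    (hp : p.e.HasLabel ρ) (hq : q.e.HasLabel ρ)
    (h : ∀ x ∈ loopPoints L₁ ++ (ps₁ ++ (ps₃ ++ loopPoints L₂)) ++ ps₂, ¬ x.e.HasLabel ρ) :
    locate ρ ((L₁ ++ (a, ps₁ ++ p :: (ps₂ ++ q :: ps₃)) :: L₂).map fun c => c.2.map Point.e) =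
      [(L₁.length, ps₁.length), (L₁.length, ps₁.length + 1 + ps₂.length)] := by
  change locateFrom ρ _ 0 = _
  rw [List.map_append, List.map_cons, locateFrom_append, locateFrom_cons, List.map_append,
    List.map_cons, List.map_append, List.map_cons, locateRow_append, locateRow_cons _ hp,
    locateRow_append, locateRow_cons _ hq,
    locateFrom_eq_nil fun x hx => h x (by simp [hx]),
    locateFrom_eq_nil fun x hx => h x (by simp [hx]),
    locateRow_eq_nil _ fun x hx => h x (by simp [hx]),
    locateRow_eq_nil _ fun x hx => h x (by simp [hx]),
    locateRow_eq_nil _ fun x hx => h x (by simp [hx])]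
  simp

theorem locate_one_one {L₁ L₂ L₃ : List Loop} {a b : Arc} {ps₁ ps₂ qs₁ qs₂ : List Point}
    {p q : Point} {ρ : ℕ} (hp : p.e.HasLabel ρ) (hq : q.e.HasLabel ρ)
    (h : ∀ x ∈ loopPoints L₁ ++ (ps₁ ++ (ps₂ ++ (loopPoints L₂ ++ loopPoints L₃))) ++
        (qs₁ ++ qs₂), ¬ x.e.HasLabel ρ) :
    locate ρ ((L₁ ++ (a, ps₁ ++ p :: ps₂) :: (L₂ ++ (b, qs₁ ++ q :: qs₂) :: L₃)).map
      fun c => c.2.map Point.e) =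
      [(L₁.length, ps₁.length), (L₁.length + 1 + L₂.length, qs₁.length)] := by
  change locateFrom ρ _ 0 = _
  simp only [List.map_append, List.map_cons]
  rw [locateFrom_append, locateFrom_cons, locateFrom_append, locateFrom_cons, locateRow_append,
    locateRow_cons _ hp, locateRow_append, locateRow_cons _ hq,
    locateFrom_eq_nil fun x hx => h x (by simp [hx]),
    locateFrom_eq_nil fun x hx => h x (by simp [hx]),
    locateFrom_eq_nil fun x hx => h x (by simp [hx]),
    locateRow_eq_nil _ fun x hx => h x (by simp [hx]),
    locateRow_eq_nil _ fun x hx => h x (by simp [hx]),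
    locateRow_eq_nil _ fun x hx => h x (by simp [hx]),
    locateRow_eq_nil _ fun x hx => h x (by simp [hx])]
  simp

/-! ### Resolution of a crossing -/

theorem Contracts.traces {x y x' y' : Arc} {L L' : List Loop} {Z : Term}
    (h : Contracts x y x' y' L L') (hE : Z.E = L'.map fun c => c.2.map Point.e)
    (hI : Z.I = L'.map fun c => c.2.map Point.i) (hQ : Z.Q = L'.map fun c => c.2.map Point.q) :
    Traces Z (L'.map (Loop.map (mergeTwo x y x' y'))) where
  E := by
    rw [hE, List.map_map]
    exact List.map_congr_left fun c _ => by simp only [Loop.map, Function.comp, List.map_map]; rfl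
  I := by
    rw [hI, List.map_map]
    exact List.map_congr_left fun c _ => by simp only [Loop.map, Function.comp, List.map_map]; rfl
  Q := by
    rw [hQ, List.map_map]
    exact List.map_congr_left fun c _ => by simp only [Loop.map, Function.comp, List.map_map]; rfl
  closed := h.closed
  nodup := h.nodup

section Map

variable {β : Type*} (g : Point → β)

theorem applyC_map (L₁ L₂ : List Loop) (a a' b' : Arc) (ps₁ ps₂ ps₃ : List Point) (p q : Point) :
    applyC ((L₁ ++ (a, ps₁ ++ p :: (ps₂ ++ q :: ps₃)) :: L₂).map fun c => c.2.map g) L₁.length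
      ps₁.length (ps₁.length + 1 + ps₂.length) =
      (L₁ ++ (a', ps₂) :: (b', ps₁ ++ ps₃) :: L₂).map fun c => c.2.map g := by
  have := applyC_append_cons (L₁.map fun c => c.2.map g) (L₂.map fun c => c.2.map g)
    (ps₁.map g) (ps₂.map g) (ps₃.map g) (g p) (g q)
  simp only [List.length_map] at this
  simpa using this

theorem applyR_map (hg : ∀ p, g p.rev = g p) (L₁ L₂ : List Loop) (a a' : Arc)
    (ps₁ ps₂ ps₃ : List Point) (p q : Point) :
    applyR ((L₁ ++ (a, ps₁ ++ p :: (ps₂ ++ q :: ps₃)) :: L₂).map fun c => c.2.map g) L₁.length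
      ps₁.length (ps₁.length + 1 + ps₂.length) =
      (L₁ ++ (a', ps₁ ++ ps₂.reverse.map Point.rev ++ ps₃) :: L₂).map fun c => c.2.map g := by
  have := applyR_append_cons (L₁.map fun c => c.2.map g) (L₂.map fun c => c.2.map g)
    (ps₁.map g) (ps₂.map g) (ps₃.map g) (g p) (g q)
  simp only [List.length_map] at this
  have hg' : g ∘ Point.rev = g := funext hg
  simpa [hg'] using this

theorem applyF_map (L₁ L₂ L₃ : List Loop) (a b a' : Arc) (ps₁ ps₂ qs₁ qs₂ : List Point)
    (p q : Point) :
    applyF ((L₁ ++ (a, ps₁ ++ p :: ps₂) :: (L₂ ++ (b, qs₁ ++ q :: qs₂) :: L₃)).map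
      fun c => c.2.map g) L₁.length (L₁.length + 1 + L₂.length) ps₁.length qs₁.length =
      (L₁ ++ (a', ps₁ ++ (qs₂ ++ qs₁) ++ ps₂) :: (L₂ ++ L₃)).map fun c => c.2.map g := by
  have := applyF_append_cons (L₁.map fun c => c.2.map g) (L₂.map fun c => c.2.map g)
    (L₃.map fun c => c.2.map g) (ps₁.map g) (ps₂.map g) (qs₁.map g) (qs₂.map g) (g p) (g q)
  simp only [List.length_map] at this
  simpa using this

theorem applyB_map (hg : ∀ p, g p.rev = g p) (L₁ L₂ L₃ : List Loop) (a b a' : Arc)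
    (ps₁ ps₂ qs₁ qs₂ : List Point) (p q : Point) :
    applyB ((L₁ ++ (a, ps₁ ++ p :: ps₂) :: (L₂ ++ (b, qs₁ ++ q :: qs₂) :: L₃)).map
      fun c => c.2.map g) L₁.length (L₁.length + 1 + L₂.length) ps₁.length qs₁.length =
      (L₁ ++ (a', ps₁ ++ (qs₁.reverse ++ qs₂.reverse).map Point.rev ++ ps₂) ::
        (L₂ ++ L₃)).map fun c => c.2.map g := by
  have := applyB_append_cons (L₁.map fun c => c.2.map g) (L₂.map fun c => c.2.map g)
    (L₃.map fun c => c.2.map g) (ps₁.map g) (ps₂.map g) (qs₁.map g) (qs₂.map g) (g p) (g q)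
  simp only [List.length_map] at this
  have hg' : g ∘ Point.rev = g := funext hg
  simpa [hg'] using this

end Map

theorem zipWith_turnQ (ps : List Point) :
    List.zipWith Entry.turnQ (ps.map Point.e) (ps.map Point.q) =
      (ps.map Point.rev).map Point.q := by
  rw [List.zipWith_map, List.zipWith_self, List.map_map]
  rfl

theorem applyR_turnInner (L₁ L₂ : List Loop) (a a' : Arc) (ps₁ ps₂ ps₃ : List Point)
    (p q : Point) :
    applyR (turnInner
      ((L₁ ++ (a, ps₁ ++ p :: (ps₂ ++ q :: ps₃)) :: L₂).map fun c => c.2.map Point.e)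
      ((L₁ ++ (a, ps₁ ++ p :: (ps₂ ++ q :: ps₃)) :: L₂).map fun c => c.2.map Point.q) L₁.length
      ps₁.length (ps₁.length + 1 + ps₂.length)) L₁.length ps₁.length
      (ps₁.length + 1 + ps₂.length) =
      (L₁ ++ (a', ps₁ ++ ps₂.reverse.map Point.rev ++ ps₃) :: L₂).map
        fun c => c.2.map Point.q := by
  have h1 := turnInner_append_cons (L₁.map fun c => c.2.map Point.e)
    (L₂.map fun c => c.2.map Point.e) (L₁.map fun c => c.2.map Point.q)
    (L₂.map fun c => c.2.map Point.q) (ps₁.map Point.e) (ps₂.map Point.e) (ps₃.map Point.e)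
    (ps₁.map Point.q) (ps₂.map Point.q) (ps₃.map Point.q) p.e q.e p.q q.q (by simp) (by simp)
    (by simp)
  have h2 := applyR_append_cons (L₁.map fun c => c.2.map Point.q)
    (L₂.map fun c => c.2.map Point.q) (ps₁.map Point.q) ((ps₂.map Point.rev).map Point.q)
    (ps₃.map Point.q) p.q q.q
  rw [zipWith_turnQ] at h1
  simp only [List.length_map] at h1 h2
  simp only [List.map_append, List.map_cons]
  rw [h1, h2]
  simp

theorem applyB_turnAll (L₁ L₂ L₃ : List Loop) (a b a' : Arc) (ps₁ ps₂ qs₁ qs₂ : List Point)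
    (p q : Point) :
    applyB (turnAll
      ((L₁ ++ (a, ps₁ ++ p :: ps₂) :: (L₂ ++ (b, qs₁ ++ q :: qs₂) :: L₃)).map
        fun c => c.2.map Point.e)
      ((L₁ ++ (a, ps₁ ++ p :: ps₂) :: (L₂ ++ (b, qs₁ ++ q :: qs₂) :: L₃)).map
        fun c => c.2.map Point.q) (L₁.length + 1 + L₂.length)) L₁.length
      (L₁.length + 1 + L₂.length) ps₁.length qs₁.length =
      (L₁ ++ (a', ps₁ ++ (qs₁.reverse ++ qs₂.reverse).map Point.rev ++ ps₂) ::
        (L₂ ++ L₃)).map fun c => c.2.map Point.q := by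
  have h1 := turnAll_append_cons
    ((L₁ ++ (a, ps₁ ++ p :: ps₂) :: L₂).map fun c => c.2.map Point.e)
    (L₃.map fun c => c.2.map Point.e)
    ((L₁ ++ (a, ps₁ ++ p :: ps₂) :: L₂).map fun c => c.2.map Point.q)
    (L₃.map fun c => c.2.map Point.q) ((qs₁ ++ q :: qs₂).map Point.e)
    ((qs₁ ++ q :: qs₂).map Point.q) (by simp)
  have h2 := applyB_append_cons (L₁.map fun c => c.2.map Point.q)
    (L₂.map fun c => c.2.map Point.q) (L₃.map fun c => c.2.map Point.q) (ps₁.map Point.q)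
    (ps₂.map Point.q) ((qs₁.map Point.rev).map Point.q) ((qs₂.map Point.rev).map Point.q) p.q
    q.rev.q
  rw [zipWith_turnQ] at h1
  have hl : ((L₁ ++ (a, ps₁ ++ p :: ps₂) :: L₂).map fun c => c.2.map Point.e).length =
      L₁.length + 1 + L₂.length := by
    simp only [List.length_map, List.length_append, List.length_cons]
    omega
  rw [hl] at h1
  simp only [List.length_map] at h2
  simp only [List.map_append, List.map_cons, List.append_assoc, List.cons_append] at h1 h2 ⊢
  rw [h1, h2]
  simp

theorem exists_resolve {w : ℕ} {Z : Term} (h : Z.IsSkeinArray w) (hU : Z.U ≠ []) :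
    ∃ Z' Z'' b, Z.resolve (w + 1) = [Z', Z''] ∧ ResolvesTo w Z Z' b ∧ ResolvesTo w Z Z'' (!b) := by
  obtain ⟨u, us, hU⟩ := List.exists_cons_of_ne_nil hU
  have hu : u = 1 ∨ u = -1 := h.signs u (by simp [hU])
  have hT := Term.traces_loops h.dimI h.dimQ
  have hcount : ∀ o, ((loopPoints Z.loops).map Point.e).count (.self (w + 1) o) = 1 := by
    intro o
    rw [h.validPoints.labels, if_pos]
    rw [hU, List.length_cons]
    omega
  have hs : Z.s + Z.U.headD 0 = Z.s + if decide (u = 1) then 1 else -1 := by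
    rw [hU]
    rcases hu with rfl | rfl <;> rfl
  have hs' : Z.s - Z.U.headD 0 = Z.s + if !decide (u = 1) then 1 else -1 := by
    rw [hU]
    rcases hu with rfl | rfl <;> rfl
  have htail : Z.U.tail = turnSigns (w + 1 + 1) [] us := by rw [hU, turnSigns_nil]; rfl
  have hadjust : ∀ R, adjustU (w + 1) R Z.U = turnSigns (w + 1 + 1) R us := by
    intro R
    rw [hU]
    rfl
  obtain ⟨p, q, o, hp, hq, ⟨L₁, a, ps₁, ps₂, ps₃, L₂, hL⟩ |
    ⟨L₁, a, ps₁, ps₂, L₂, b, qs₁, qs₂, L₃, hL⟩⟩ := exists_two_points hcount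
  · have hperm := perm_two L₁ L₂ a ps₁ ps₂ ps₃ p q
    rw [← hL] at hperm
    have hnot := not_hasLabel_of_perm hcount hperm hp hq
    have hlp : p.e.HasLabel (w + 1) := by cases o <;> simp [hp, Entry.HasLabel]
    have hlq : q.e.HasLabel (w + 1) := by cases o <;> simp [hq, Entry.HasLabel]
    have hloc := locate_two (a := a) hlp hlq hnot
    have hE := hT.E
    have hI := hT.I
    have hQ := hT.Q
    have hc := hT.closed
    have hn := hT.nodup
    rw [hL] at hE hI hQ hc hn
    rw [← hE] at hloc
    refine ⟨_, _, decide (u = 1), by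
      unfold Term.resolve
      rw [hloc]
      exact if_pos rfl, ?_, ?_⟩
    · have hC := contracts_split hc hn
      have hJ := hC.joints
      rw [← hL] at hJ
      refine resolvesTo_of (B := []) (R := []) h hU
        (by simpa using hperm) hp hq
        (fun cs s J => orderedIsotopic_smoothing_oriented cs s hu p q o J)
        (fun _ _ _ => rfl) ?_ hJ
        (hC.traces ?_ ?_ ?_) htail rfl hs
      · classical
        rw [List.perm_iff_count]
        intro z
        simp only [loopPoints_append, loopPoints_cons, List.count_append, List.map_nil,
          List.count_nil]
        omega
      · rw [hE]
        exact applyC_map _ _ _ _ _ _ _ _ _ _ _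
      · rw [hI]
        exact applyC_map _ _ _ _ _ _ _ _ _ _ _
      · rw [hQ]
        exact applyC_map _ _ _ _ _ _ _ _ _ _ _
    · have hC := contracts_reverse hc hn
      have hJ := hC.joints
      rw [← hL] at hJ
      refine resolvesTo_of (R := ps₂.map Point.e) h hU hperm hp hq
        (fun cs s J => orderedIsotopic_smoothing_unoriented cs s hu p q o J)
        (fun _ _ _ => rfl) ?_ hJ
        (hC.traces ?_ ?_ ?_) ?_ rfl hs'
      · classical
        rw [List.perm_iff_count]
        intro z
        simp only [loopPoints_append, loopPoints_cons, List.count_append, List.map_reverse,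
          List.count_reverse]
        omega
      · rw [hE]
        exact applyR_map _ (fun _ => rfl) _ _ _ _ _ _ _ _ _
      · rw [hI]
        exact applyR_map _ (fun _ => rfl) _ _ _ _ _ _ _ _ _
      · rw [hE, hQ]
        exact applyR_turnInner _ _ _ _ _ _ _ _ _
      · rw [hadjust]
        refine congrArg (fun R => turnSigns (w + 1 + 1) R us) ?_
        rw [hE, List.map_append, List.map_cons]
        have h1 := getD_append_cons (L₁.map fun c => c.2.map Point.e)
          (L₂.map fun c => c.2.map Point.e)
          ((ps₁ ++ p :: (ps₂ ++ q :: ps₃)).map Point.e) []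
        rw [List.length_map] at h1
        rw [h1]
        have h2 := inner_append_cons (ps₁.map Point.e) (ps₂.map Point.e) (ps₃.map Point.e) p.e q.e
        simpa using h2
  · have hperm := perm_one_one L₁ L₂ L₃ a b ps₁ ps₂ qs₁ qs₂ p q
    rw [← hL] at hperm
    have hnot := not_hasLabel_of_perm hcount hperm hp hq
    have hlp : p.e.HasLabel (w + 1) := by cases o <;> simp [hp, Entry.HasLabel]
    have hlq : q.e.HasLabel (w + 1) := by cases o <;> simp [hq, Entry.HasLabel]
    have hloc := locate_one_one (a := a) (b := b) hlp hlq hnot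
    have hE := hT.E
    have hI := hT.I
    have hQ := hT.Q
    have hc := hT.closed
    have hn := hT.nodup
    rw [hL] at hE hI hQ hc hn
    rw [← hE] at hloc
    refine ⟨_, _, decide (u = 1), by
      unfold Term.resolve
      rw [hloc]
      exact if_neg (by omega), ?_, ?_⟩
    · have hC := contracts_forward hc hn
      have hJ := hC.joints
      rw [← hL] at hJ
      refine resolvesTo_of (B := []) (R := []) h hU
        (by simpa using hperm) hp hq
        (fun cs s J => orderedIsotopic_smoothing_oriented cs s hu p q o J)
        (fun _ _ _ => rfl) ?_ hJ
        (hC.traces ?_ ?_ ?_) htail rfl hs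
      · classical
        rw [List.perm_iff_count]
        intro z
        simp only [loopPoints_append, loopPoints_cons, List.count_append, List.map_nil,
          List.count_nil]
        omega
      · rw [hE]
        exact applyF_map _ _ _ _ _ _ _ _ _ _ _ _ _
      · rw [hI]
        exact applyF_map _ _ _ _ _ _ _ _ _ _ _ _ _
      · rw [hQ]
        exact applyF_map _ _ _ _ _ _ _ _ _ _ _ _ _
    · have hC := contracts_backward hc hn
      have hJ := hC.joints
      rw [← hL] at hJ
      refine resolvesTo_of (R := (qs₁ ++ q :: qs₂).map Point.e) h hU hperm hp hq
        (fun cs s J => (orderedIsotopic_smoothing_unoriented cs s hu p q o J).trans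
          (orderedIsotopic_swap_snd _ _ _ _ _ _)) ?_ ?_ hJ
        (hC.traces ?_ ?_ ?_) ?_ rfl hs'
      · intro k o' hk
        have : q.e ≠ .self k o' := by
          rw [hq]
          intro e
          have := (Entry.self.inj e).1
          omega
        simp [this]
      · classical
        rw [List.perm_iff_count]
        intro z
        simp only [loopPoints_append, loopPoints_cons, List.count_append, List.map_reverse,
          List.count_reverse, List.map_append]
        omega
      · rw [hE]
        exact applyB_map _ (fun _ => rfl) _ _ _ _ _ _ _ _ _ _ _ _
      · rw [hI]
        exact applyB_map _ (fun _ => rfl) _ _ _ _ _ _ _ _ _ _ _ _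
      · rw [hE, hQ]
        exact applyB_turnAll _ _ _ _ _ _ _ _ _ _ _ _
      · rw [hadjust]
        refine congrArg (fun R => turnSigns (w + 1 + 1) R us) ?_
        rw [hE, List.map_append, List.map_cons, List.map_append, List.map_cons]
        have h1 := getD_append_cons_two (L₁.map fun c => c.2.map Point.e)
          (L₂.map fun c => c.2.map Point.e) (L₃.map fun c => c.2.map Point.e)
          ((ps₁ ++ p :: ps₂).map Point.e) ((qs₁ ++ q :: qs₂).map Point.e) []
        rw [List.length_map, List.length_map] at h1
        simpa using h1

/-! ### The terms and the states -/

/-- The term `Z` is the smoothing of the first `w` crossings of `Z₀` according to `σ`. -/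
structure IsStateTerm (Z₀ : Term) (w : ℕ) (Z : Term) (σ : List Bool) : Prop where
  length : σ.length = w
  isSkeinArray : Z.IsSkeinArray w
  length_U : Z.U.length + w = Z₀.U.length
  c_eq : Z.c = Z₀.c
  s_eq : Z.s = Z₀.s + (σ.map fun b => if b then (1 : ℤ) else -1).sum
  isotopic : OrderedIsotopic ((Z₀.diagram 0).smooth σ) (Z.diagram w)

theorem Term.IsSkeinArray.length_crossings {Z : Term} {w : ℕ} (h : Z.IsSkeinArray w) :
    (Z.diagram w).crossings.length = Z.U.length := by
  rw [Term.diagram_eq]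
  exact h.validPoints.length_crossings _

theorem IsStateTerm.resolve {Z₀ Z Z' : Term} {w : ℕ} {σ : List Bool} {b : Bool}
    (h₀ : Z₀.IsSkeinArray 0) (hw : w < Z₀.U.length) (h : IsStateTerm Z₀ w Z σ)
    (h' : ResolvesTo w Z Z' b) : IsStateTerm Z₀ (w + 1) Z' (σ ++ [b]) where
  length := by simp [h.length]
  isSkeinArray := h'.isSkeinArray
  length_U := by
    have := h.length_U
    have := h'.length_U
    omega
  c_eq := h'.c_eq.trans h.c_eq
  s_eq := by
    rw [h'.s_eq, h.s_eq]
    simp [add_assoc]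
  isotopic := .head (smooth_concat _ _ _ (by rwa [h.length, h₀.length_crossings]))
    ((h.isotopic.smooth b).trans h'.isotopic)

theorem exists_states {Z₀ : Term} (h₀ : Z₀.IsSkeinArray 0) (w : ℕ) (hw : w ≤ Z₀.U.length) :
    ∃ S : List (List Bool), S.Nodup ∧ S.length = 2 ^ w ∧
      List.Forall₂ (IsStateTerm Z₀ w) (resolveArray Z₀ w) S := by
  induction w with
  | zero =>
    exact ⟨[[]], by simp, rfl, .cons ⟨rfl, h₀, rfl, rfl, by simp, by
      have : (Z₀.diagram 0).smooth [] = Z₀.diagram 0 := by simp [Diagram.smooth]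
      rw [this]⟩ .nil⟩
  | succ w ih =>
    obtain ⟨S, hS, hl, h⟩ := ih (by omega)
    rw [pow_succ, ← hl]
    clear hl
    change ∃ T : List (List Bool), T.Nodup ∧ T.length = S.length * 2 ∧
      List.Forall₂ (IsStateTerm Z₀ (w + 1)) ((resolveArray Z₀ w).flatMap (Term.resolve (w + 1))) T
    suffices ∃ T : List (List Bool), T.Nodup ∧ (∀ τ ∈ T, ∃ σ ∈ S, ∃ b, τ = σ ++ [b]) ∧
        T.length = S.length * 2 ∧ List.Forall₂ (IsStateTerm Z₀ (w + 1))
          ((resolveArray Z₀ w).flatMap (Term.resolve (w + 1))) T by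
      obtain ⟨T, h1, -, h2, h3⟩ := this
      exact ⟨T, h1, h2, h3⟩
    generalize resolveArray Z₀ w = L at h ⊢
    induction h with
    | nil => exact ⟨[], by simp, by simp, rfl, .nil⟩
    | @cons Z σ L S hZ _ ih =>
      obtain ⟨hσ, hS⟩ := List.nodup_cons.1 hS
      obtain ⟨T, h1, h2, h3, h4⟩ := ih hS
      have hU : Z.U ≠ [] := by
        have := hZ.length_U
        rw [← List.length_pos_iff]
        omega
      obtain ⟨Z', Z'', b, hr, h', h''⟩ := exists_resolve hZ.isSkeinArray hU
      have hT : ∀ c, σ ++ [c] ∉ T := by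
        intro c hc
        obtain ⟨τ, hτ, d, e⟩ := h2 _ hc
        obtain ⟨rfl, -⟩ := List.append_inj' e rfl
        exact hσ hτ
      refine ⟨(σ ++ [b]) :: (σ ++ [!b]) :: T, ?_, ?_, ?_, ?_⟩
      · simp [h1, hT]
      · intro τ hτ
        simp only [List.mem_cons] at hτ
        obtain rfl | rfl | hτ := hτ
        · exact ⟨σ, by simp, b, rfl⟩
        · exact ⟨σ, by simp, !b, rfl⟩
        · obtain ⟨ρ, hρ, d, e⟩ := h2 _ hτ
          exact ⟨ρ, by simp [hρ], d, e⟩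
      · simp [h3, add_mul]
      · rw [List.flatMap_cons, hr]
        exact .cons (hZ.resolve h₀ (by omega) h') (.cons (hZ.resolve h₀ (by omega) h'') h4)

/-- The terms are indexed by the states. -/
theorem exists_equiv_states {Z₀ : Term} (h₀ : Z₀.IsSkeinArray 0) (w : ℕ) (hw : w ≤ Z₀.U.length) :
    ∃ (Z : Fin (2 ^ w) → Term) (e : Fin (2 ^ w) ≃ (Fin w → Bool)),
      resolveArray Z₀ w = List.ofFn Z ∧ ∀ z, IsStateTerm Z₀ w (Z z) (List.ofFn (e z)) := by
  obtain ⟨S, hS, hl, h⟩ := exists_states h₀ w hw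
  have hlen : (resolveArray Z₀ w).length = 2 ^ w := h.length_eq.trans hl
  have hZ : ∀ z : Fin (2 ^ w), IsStateTerm Z₀ w ((resolveArray Z₀ w)[z.1]'(by omega))
      (S[z.1]'(by omega)) := fun z => h.get _ _
  let f : Fin (2 ^ w) → Fin w → Bool := fun z k =>
    (S[z.1]'(by omega))[k.1]'(by rw [(hZ z).length]; exact k.2)
  have hf : ∀ z, List.ofFn (f z) = S[z.1]'(by omega) := by
    intro z
    refine List.ext_getElem (by simp [(hZ z).length]) fun i _ _ => ?_
    simp [f]
  have hinj : Function.Injective f := by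
    intro y z hyz
    have := (hf y).symm.trans ((congrArg List.ofFn hyz).trans (hf z))
    exact Fin.ext ((hS.getElem_inj_iff).1 this)
  refine ⟨fun z => (resolveArray Z₀ w)[z.1]'(by omega),
    Equiv.ofBijective f ((Fintype.bijective_iff_injective_and_card f).2 ⟨hinj, by simp⟩), ?_, ?_⟩
  · exact List.ext_getElem (by simp [hlen]) fun i _ _ => by simp
  · intro z
    rw [Equiv.ofBijective_apply, hf]
    exact hZ z

end Skein

end

/-- Resolving the crossings `1, …, w` of a skein with `r` crossings by the array operators gives `2^w`
terms; each of them is the array of a skein with the crossings `w + 1, …, r` left, their combination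
is the original skein, and they are the terms of the expansion over the states of the
crossings `1, …, w`. For `w = r` no crossing is left and this is the state expansion of the skein. -/
theorem proposition1 (U : List ℤ) (E : List (List Skein.Entry)) (I Q : List (List ℕ))
    (hZ : (Skein.initialTerm U E I Q).IsSkeinArray 0) (r w : ℕ) (hr : U.length = r) (hw : w ≤ r) :
    ∃ Z : Fin (2 ^ w) → Skein.Term,
      Skein.resolveArray (Skein.initialTerm U E I Q) w = List.ofFn Z ∧
      (∀ z, (Z z).IsSkeinArray w ∧ (Z z).U.length = r - w) ∧
      ((Skein.initialTerm U E I Q).diagram 0).toSkein =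
        ∑ z, (Z z).coeff • ((Z z).diagram w).toSkein ∧
      (∃ e : Fin (2 ^ w) ≃ (Fin w → Bool), ∀ z,
        (Z z).c = 1 ∧ (Z z).s = Skein.stateExponent (e z) ∧
        Skein.PlanarIsotopic ((Z z).diagram w)
          (((Skein.initialTerm U E I Q).diagram 0).smooth (List.ofFn (e z)))) ∧
      (w = r →
        (∀ z, (Z z).U = [] ∧ ∀ k o, Skein.Entry.self k o ∉ (Z z).E.flatten) ∧
        (∀ σ : Fin w → Bool,
          (((Skein.initialTerm U E I Q).diagram 0).smooth (List.ofFn σ)).IsLink ∧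
          (((Skein.initialTerm U E I Q).diagram 0).smooth (List.ofFn σ)).crossings = []) ∧
        ∑ z, (Z z).coeff • ((Z z).diagram w).toSkein =
          ∑ σ : Fin w → Bool, (LaurentPolynomial.T (Skein.stateExponent σ) : ℂ[T;T⁻¹]) •
            (((Skein.initialTerm U E I Q).diagram 0).smooth (List.ofFn σ)).toSkein) := by
  have hU : (Skein.initialTerm U E I Q).U.length = r := hr
  have hcr : ((Skein.initialTerm U E I Q).diagram 0).crossings.length = r :=
    hZ.length_crossings.trans hU
  have hlink : ∀ σ : Fin w → Bool,
      (((Skein.initialTerm U E I Q).diagram 0).smooth (List.ofFn σ)).IsLink := fun σ =>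
    hZ.isLink.smooth _ (by rw [List.length_ofFn, hcr]; exact hw)
  obtain ⟨Z, e, hres, h⟩ := Skein.exists_equiv_states hZ w (hU ▸ hw)
  have hs : ∀ z, (Z z).s = Skein.stateExponent (e z) := by
    intro z
    rw [(h z).s_eq, List.map_ofFn, List.sum_ofFn]
    exact zero_add _
  have hc : ∀ z, (Z z).c = 1 := fun z => (h z).c_eq
  have hlen : ∀ z, (Z z).U.length = r - w := by
    intro z
    have := (h z).length_U
    omega
  have hiso : ∀ z, Skein.PlanarIsotopic ((Z z).diagram w)
      (((Skein.initialTerm U E I Q).diagram 0).smooth (List.ofFn (e z))) := fun z =>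
    ((h z).isotopic.planarIsotopic (hlink _)).symm
  have hsum : ∑ z, (Z z).coeff • ((Z z).diagram w).toSkein =
      ∑ σ : Fin w → Bool, (LaurentPolynomial.T (Skein.stateExponent σ) : ℂ[T;T⁻¹]) •
        (((Skein.initialTerm U E I Q).diagram 0).smooth (List.ofFn σ)).toSkein := by
    refine Fintype.sum_equiv e _ _ fun z => ?_
    rw [(hiso z).toSkein_eq, Skein.Term.coeff, hc, hs, map_one, one_mul]
  refine ⟨Z, hres, fun z => ⟨(h z).isSkeinArray, hlen z⟩, ?_, ⟨e, fun z => ⟨hc z, hs z, hiso z⟩⟩,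
    fun hwr => ⟨fun z => ?_, fun σ => ⟨hlink σ, ?_⟩, hsum⟩⟩
  · rw [hsum]
    exact Skein.toSkein_eq_sum_smooth hZ.isLink w (hcr.symm ▸ hw)
  · have hz : (Z z).U.length = 0 := by
      rw [hlen]
      omega
    refine ⟨List.length_eq_zero_iff.1 hz, fun k o => ?_⟩
    rw [← List.count_eq_zero, (h z).isSkeinArray.labels, if_neg (by omega)]
  · refine List.drop_eq_nil_of_le ?_
    rw [hcr, List.length_ofFn]
    exact hwr.ge
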